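/- Let $r_1\mid r_2\mid\dots\mid r_n$ be positive integers, $G=\mathbb Z/r_1\times\dots\times\mathbb Z/r_n$, and let $q$ be a prime power with $q\equiv 1 \pmod{r_n}$. Put $\mathcal R'=\prod_j\{0,\dots,r_j-1\}$, $\mathcal R=\mathcal R'\setminus\{0\}$ and $e(\vec v)=\operatorname{lcm}_j\big(r_j/\gcd(r_j,v_j)\big)$. For each $m\mid r_n$ let $\chi_m$ be a multiplicative character of $\mathbb F_q^*$ of order $m$, with $\chi_m(0)=0$. *Family.* Let $d(\vec\alpha)\ge 0$ ($\vec\alpha\in\mathcal R$) be integers with $\sum_{\vec\alpha}\alpha_jd(\vec\alpha)\equiv 0\pmod{r_j}$ for all $j$. Let $\hat{\mathcal F}_{[\vec d(\vec\alpha)]}$ be the set of $(\vec c,(f_{\vec\alpha})_{\vec\alpha\in\mathcal R})$ with $\vec c\in(\mathbb F_q^*)^n$ and $f_{\vec\alpha}\in\mathbb F_q[X]$ monic, squarefree and pairwise coprime, such that either $\deg f_{\vec\alpha}=d(\vec\alpha)$ for all $\vec\alpha$, or, for some $\vec\beta\in\mathcal R$, $\deg f_{\vec\beta}=d(\vec\beta)-1$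 and $\deg f_{\vec\alpha}=d(\vec\alpha)$ for all $\vec\alpha\ne\vec\beta$. *Values.* Let $(\vec s,\vec\omega)$ range over the pairs of vectors with $s_j\mid r_j$, $1\le\omega_j\le s_j$, $\gcd(\omega_j,s_j)=1$; put $\ell(\vec s)=\operatorname{lcm}(s_1,\dots,s_n)$ and let $\langle a\rangle$ denote the least non-negative residue of $a$ mod $\ell(\vec s)$. Define $$c_{(\vec s)}^{(\vec\omega)}=\prod_j c_j^{\langle \ell(\vec s)\omega_j/s_j\rangle},\qquad F_{(\vec s)}^{(\vec\omega)}(X)=c_{(\vec s)}^{(\vec\omega)}\prod_{\vec\alpha\in\mathcal R}f_{\vec\alpha}(X)^{\langle\sum_j \ell(\vec s)\omega_j\alpha_j/s_j\rangle}.$$ At the point at infinity, $F_{(\vec s)}^{(\vec\omega)}(\infty)=c_{(\vec s)}^{(\vec\omega)}$ if $\sum_j\frac{\ell(\vec s)}{s_j}\omega_j\sum_{\vec\alpha}\alpha_j\deg f_{\vec\alpha}\equiv0\pmod{\ell(\vec s)}$, and $F_{(\vec s)}^{(\vec\omega)}(\infty)=0$ otherwise. Let $x_1,\dots,x_q$ be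 the elements of $\mathbb F_q$ and $x_{q+1}=\infty$. *Admissibility.* A family $(\epsilon_{\vec s,\vec\omega})$ of complex numbers is admissible if there are a member of $\hat{\mathcal F}_{[\vec d(\vec\alpha)]}$ and a point $x\in\mathbb P^1(\mathbb F_q)$ with $\epsilon_{\vec s,\vec\omega}=\chi_{\ell(\vec s)}(F_{(\vec s)}^{(\vec\omega)}(x))$ for all $(\vec s,\vec\omega)$. For $\vec\beta\in\mathcal R'$ let $A_{\vec\beta}$ be the set of $(\vec s,\vec\omega)$ with $\sum_j\frac{\ell(\vec s)}{s_j}\omega_j\beta_j\equiv0\pmod{\ell(\vec s)}$. Write $\vec\beta\sim\vec\beta'$ if $A_{\vec\beta}=A_{\vec\beta'}$, and let $[\vec\beta]$ be the class of $\vec\beta$. An admissible family is $[\vec\beta]$-admissible if $\epsilon_{\vec s,\vec\omega}=0$ exactly for $(\vec s,\vec\omega)\notin A_{\vec\beta}$. *Claim.* For $1\le i\le q+1$ let $(\epsilon_{\vec s,\vec\omega,i})_{\vec s,\vec\omega}$ be admissible, and let $m_{[\vec\beta]}$ be the number of $i\in\{1,\dots,q+1\}$ for which it is $[\vec\beta]$-admissible.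 Let $N$ be the number of $(\vec c,(f_{\vec\alpha}))\in\hat{\mathcal F}_{[\vec d(\vec\alpha)]}$ with $\chi_{\ell(\vec s)}(F_{(\vec s)}^{(\vec\omega)}(x_i))=\epsilon_{\vec s,\vec\omega,i}$ for all $\vec s,\vec\omega$ and all $i=1,\dots,q+1$. Put $$\Delta=\prod_{[\vec\beta]\ne[\vec 0]}\left(\frac{\phi(e(\vec\beta)^2)}{|G|(q+|G|-1)}\right)^{m_{[\vec\beta]}}\left(\frac{q}{|G|(q+|G|-1)}\right)^{m_{[\vec 0]}},$$ the product being over the classes, with $\phi$ Euler's function. Then $$N=\frac{(q-1)^n(q+|G|-1)}{q}\cdot\frac{L_{|G|-2}\,q^{\sum_{\vec\alpha} d(\vec\alpha)}}{\zeta_q(2)^{|G|-1}}\cdot\Delta\cdot\left(1+O\left(q^{-\min d(\vec\alpha)/2}\right)\right)$$ and $$\frac{N}{|\hat{\mathcal F}_{[\vec d(\vec\alpha)]}|}=\Delta\cdot\left(1+O\left(q^{-\min d(\vec\alpha)/2}\right)\right),$$ where $\zeta_q(s)=\sum_{f\text{ monic}}|f|^{-s}$ with $|f|=q^{\deg f}$,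 $L_m=\prod_{j=1}^m\prod_P\left(1-\frac{j}{(|P|+1)(|P|+j)}\right)$ over the monic irreducible $P\in\mathbb F_q[X]$ (an empty product for $m\le 0$), and the implied constants depend only on $q$ and $r_1,\dots,r_n$. In particular, both formulas are the same whatever is prescribed at the point at infinity: it only enters, like any other point, through the numbers $m_{[\vec\beta]}$. (For trivial $G$ the minimum over the empty set is read as $0$.) -/

import Mathlib

open Polynomial

namespace AbelianCovers

/-! Throughout, `G = ℤ/r₁ × ⋯ × ℤ/rₙ` is encoded by `r : Fin n → ℕ` with nonzero entries, `F` is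
the finite field with `q` elements, and the projective line over `F` is `OnePoint F`. -/

section Combinatorics

variable {n : ℕ} (r : Fin n → ℕ)

/-- The set `R' = [0, r₁ - 1] × ⋯ × [0, rₙ - 1]`. -/
abbrev RPrime : Type := (j : Fin n) → Fin (r j)

/-- The set `R` of the nonzero vectors in `R'`. -/
abbrev RIdx [∀ j, NeZero (r j)] : Type := {α : RPrime r // α ≠ 0}

/-- The order `|G| = r₁ ⋯ rₙ`. -/
def groupOrder : ℕ := ∏ j, r j

/-- `e(v) = lcm_j (r_j / gcd (r_j, v_j))`. -/
def ramIndex (v : Fin n → ℕ) : ℕ := Finset.univ.lcm fun j => r j / Nat.gcd (r j) (v j)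

/-- The pairs `(s, ω)` with `s_j ∣ r_j`, `1 ≤ ω_j ≤ s_j` and `gcd (ω_j, s_j) = 1` for all `j`. -/
def SOmega : Type :=
  {p : (Fin n → ℕ) × (Fin n → ℕ) //
    (∀ j, p.1 j ∣ r j) ∧ ∀ j, 1 ≤ p.2 j ∧ p.2 j ≤ p.1 j ∧ Nat.Coprime (p.2 j) (p.1 j)}

variable {r}

/-- The vector `s` of a pair `(s, ω)`. -/
def SOmega.s (p : SOmega r) : Fin n → ℕ := p.1.1

/-- The vector `ω` of a pair `(s, ω)`. -/
def SOmega.ω (p : SOmega r) : Fin n → ℕ := p.1.2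

/-- `ℓ(s) = lcm (s₁, …, sₙ)`. -/
def SOmega.ell (p : SOmega r) : ℕ := Finset.univ.lcm p.s

/-- The pairing `∑_j (ℓ(s) / s_j) ω_j v_j`. -/
def SOmega.pairing (p : SOmega r) (v : Fin n → ℕ) : ℕ := ∑ j, p.ell / p.s j * p.ω j * v j

/-- `A_β`, the set of pairs `(s, ω)` with `∑_j (ℓ(s) / s_j) ω_j β_j ≡ 0 mod ℓ(s)`. -/
def ASet (β : RPrime r) : Set (SOmega r) := {p | p.ell ∣ p.pairing fun j => (β j : ℕ)}

variable (r)

/-- The equivalence relation on `R'`: `β ∼ β'` if and only if `A_β = A_β'`. -/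
def simSetoid : Setoid (RPrime r) := Setoid.ker ASet

/-- The set of classes `[β]`. -/
def RTilde : Type := Quotient (simSetoid r)

noncomputable instance : Fintype (RTilde r) :=
  @Fintype.ofFinite _ (inferInstanceAs (Finite (Quotient (simSetoid r))))

noncomputable instance : DecidableEq (RTilde r) := Classical.decEq _

/-- The class `[0]`. -/
def zeroClass [∀ j, NeZero (r j)] : RTilde r := Quotient.mk (simSetoid r) 0

variable {r}

/-- A representative of a class; the quantities below are evaluated at it, and they depend only on
the class. -/
noncomputable def RTilde.rep (b : RTilde r) : RPrime r := Quotient.out b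

end Combinatorics

section Families

variable {n : ℕ} {r : Fin n → ℕ} [∀ j, NeZero (r j)] (F : Type*) [Field F]

/-- The monic, squarefree, pairwise coprime tuples with `deg f_α = d(α)`. -/
def tuples (d : RIdx r → ℕ) : Set (RIdx r → F[X]) :=
  {f | (∀ α, (f α).Monic ∧ Squarefree (f α) ∧ (f α).natDegree = d α) ∧
    ∀ α β, α ≠ β → IsCoprime (f α) (f β)}

/-- The same tuples, with the degree of `f_β` equal to `d(β) - 1` instead of `d(β)`
(there are none if `d(β) = 0`). -/
def tuplesDrop (d : RIdx r → ℕ) (β : RIdx r) : Set (RIdx r → F[X]) :=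
  {f | (∀ α, (f α).Monic ∧ Squarefree (f α)) ∧ (f β).natDegree + 1 = d β ∧
    (∀ α, α ≠ β → (f α).natDegree = d α) ∧ ∀ α γ, α ≠ γ → IsCoprime (f α) (f γ)}

/-- The full family: a leading-coefficient vector `c ∈ (F^*)ⁿ`, together with a tuple whose degrees
are either `d` or `d` lowered by one in exactly one coordinate. -/
def fullFamily (d : RIdx r → ℕ) : Set ((Fin n → Fˣ) × (RIdx r → F[X])) :=
  {cf | cf.2 ∈ tuples F d ∪ ⋃ β, tuplesDrop F d β}

variable {F}

/-- `c_(s)^(ω) = ∏_j c_j ^ ((ℓ(s) / s_j) ω_j mod ℓ(s))`. -/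
def leadCoeff (c : Fin n → Fˣ) (p : SOmega r) : F :=
  ∏ j, (c j : F) ^ (p.ell / p.s j * p.ω j % p.ell)

/-- `F_(s)^(ω)(X) = c_(s)^(ω) ∏_α f_α ^ (∑_j (ℓ(s) / s_j) ω_j α_j mod ℓ(s))`. -/
noncomputable def FPoly (c : Fin n → Fˣ) (f : RIdx r → F[X]) (p : SOmega r) : F[X] :=
  C (leadCoeff c p) * ∏ α : RIdx r, f α ^ ((p.pairing fun j => (α.1 j : ℕ)) % p.ell)

/-- `deg F_j = ∑_α α_j deg f_α`. -/
noncomputable def degF (f : RIdx r → F[X]) (j : Fin n) : ℕ :=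
  ∑ α : RIdx r, (α.1 j : ℕ) * (f α).natDegree

open Classical in
/-- The value of `F_(s)^(ω)` at a point of the projective line. At infinity it is `c_(s)^(ω)` if
`∑_j (ℓ(s) / s_j) ω_j deg F_j ≡ 0 mod ℓ(s)`, and `0` otherwise. -/
noncomputable def valueAt (c : Fin n → Fˣ) (f : RIdx r → F[X]) (p : SOmega r) : OnePoint F → F
  | some x => (FPoly c f p).eval x
  | none => if p.ell ∣ p.pairing (degF f) then leadCoeff c p else 0

/-- The family `ε` of prescribed values at one point is admissible if it is attained by some member
of the full family at some point of the projective line. -/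
def IsAdmissible (χ : ℕ → MulChar F ℂ) (d : RIdx r → ℕ) (ε : SOmega r → ℂ) : Prop :=
  ∃ cf ∈ fullFamily F d, ∃ x : OnePoint F, ∀ p, ε p = χ p.ell (valueAt cf.1 cf.2 p x)

/-- `[β]`-admissibility: an admissible family that vanishes exactly outside `A_β`. -/
def IsBetaAdmissible (χ : ℕ → MulChar F ℂ) (d : RIdx r → ℕ) (β : RPrime r)
    (ε : SOmega r → ℂ) : Prop :=
  IsAdmissible χ d ε ∧ ∀ p, ε p = 0 ↔ p ∉ ASet β

/-- `m_[β]`, the number of points of the projective line at which the prescription is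
`[β]`-admissible. -/
noncomputable def mult (χ : ℕ → MulChar F ℂ) (d : RIdx r → ℕ) (ε : OnePoint F → SOmega r → ℂ)
    (b : RTilde r) : ℕ :=
  {x : OnePoint F | IsBetaAdmissible χ d b.rep (ε x)}.ncard

/-- The members of the full family that attain the prescription at all points of the projective
line, including infinity. -/
def attaining (χ : ℕ → MulChar F ℂ) (d : RIdx r → ℕ) (ε : OnePoint F → SOmega r → ℂ) :
    Set ((Fin n → Fˣ) × (RIdx r → F[X])) :=
  {cf ∈ fullFamily F d | ∀ (x : OnePoint F) (p : SOmega r),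
    χ p.ell (valueAt cf.1 cf.2 p x) = ε x p}

/-- `∏_{[β] ≠ [0]} (φ(e(β)²) / (|G| (q + |G| - 1))) ^ m_[β] · (q / (|G| (q + |G| - 1))) ^ m_[0]`. -/
noncomputable def density [Fintype F] (χ : ℕ → MulChar F ℂ) (d : RIdx r → ℕ)
    (ε : OnePoint F → SOmega r → ℂ) : ℝ :=
  (∏ b ∈ ({zeroClass r}ᶜ : Finset (RTilde r)),
    ((Nat.totient (ramIndex r (fun j => (b.rep j : ℕ)) ^ 2) : ℝ) /
      (groupOrder r * (Fintype.card F + groupOrder r - 1))) ^ mult χ d ε b) *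
  ((Fintype.card F : ℝ) / (groupOrder r * (Fintype.card F + groupOrder r - 1))) ^
    mult χ d ε (zeroClass r)

end Families

section Constants

variable (F : Type*) [Field F] [Fintype F]

/-- The norm `|f| = q ^ deg f`. -/
noncomputable def polyNorm (f : F[X]) : ℝ := (Fintype.card F : ℝ) ^ f.natDegree

/-- The zeta function `ζ_q(s) = ∑ |f| ^ (-s)` of `F[X]`, the sum being over the monic `f`. -/
noncomputable def zetaF (s : ℝ) : ℝ := ∑' f : {f : F[X] // f.Monic}, polyNorm F f.1 ^ (-s)

/-- `L_m = ∏_{j=1}^m ∏_P (1 - j / ((|P| + 1) (|P| + j)))`, with `P` over the monic irreducibles. -/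
noncomputable def LConst (m : ℕ) : ℝ :=
  ∏ j ∈ Finset.Icc 1 m, ∏' P : {P : F[X] // P.Monic ∧ Irreducible P},
    (1 - (j : ℝ) / ((polyNorm F P.1 + 1) * (polyNorm F P.1 + j)))

/-- `((q - 1)ⁿ (q + |G| - 1) / q) · L_{|G| - 2} q ^ (∑ d(α)) / ζ_q(2) ^ (|G| - 1)`.
For the trivial group `L_{|G| - 2}` is the empty product. -/
noncomputable def mainSize {n : ℕ} {r : Fin n → ℕ} [∀ j, NeZero (r j)] (d : RIdx r → ℕ) : ℝ :=
  ((Fintype.card F : ℝ) - 1) ^ n * (Fintype.card F + groupOrder r - 1) / Fintype.card F *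
    (LConst F (groupOrder r - 2) * (Fintype.card F : ℝ) ^ (∑ α, d α) /
      zetaF F 2 ^ (groupOrder r - 1))

end Constants

end AbelianCovers

open Filter Topology

namespace AbelianCovers

/-! ### Euler products over finitely supported exponent vectors. -/

section EulerProduct

variable {J V : Type*} [AddCommMonoid V]

/-! A member of the family splits into local data on the projective line and a part without rational
roots. A finite point `x` gets the ramification vector `α` if `f_α` vanishes at `x`, and `0` if none
does; infinity gets `β` if the degree of `f_β` is the lowered one, and `0` otherwise. Removing the
linear factors leaves rootless, squarefree, pairwise coprime polynomials, whose values at the finite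
points are units. With this convention `d(α)` is the degree of the rootless part plus the number of
points of the projective line with vector `α`, so infinity counts like any other point
(`assemble_image`).

The characters see little of these data. At each point the family of values depends only on the
ramification vector and on the discrete logarithm in `R'` of one vector of units; at infinity this
uses the congruences on `∑ α_j d(α)` (`apply_valueAt_assemble`). The pairs `(s, ω)` realize all
characters of `R'`, so two such states give the same values exactly when their ramification vectors
generate the same cyclic subgroup and their logarithms agree modulo it (`stateValue_eq_iff`). If
that subgroup has order `e`, a prescription allows `φ(e)` ramification vectors and, for each, `e` of
the `|G|` logarithms, and `e φ(e) = φ(e²)`.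

The analytic input is that, for fixed local data, the number of rootless tuples is asymptotically
independent of the prescribed unit values and loses a factor `q` for each ramified point
(`exists_abs_ncard_fiber_sub_le`). Lagrange interpolation counts monic polynomials with given
nonzero values up to an error of `1` (`primeSystem`). A sieve by squares gives the squarefree ones
with a square-root error. Pairwise coprimality is imposed by convolving with the coefficients of `(1
+ ∑ t_i) / ∏ (1 + t_i)`; these vanish on vectors with exactly one nonzero entry, which is why the
resulting sums converge (`exists_abs_ncard_sqfreeTuples_sub_le`).

Summing the weights over the local data gives a product over the points (`sum_ramWeight`). The
unrestricted local factor is `1 + (|G| - 1)/q`; dividing the restricted factors by it gives `Δ`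
(`density_eq`), and the total is identified with the stated main term by Euler products
(`mainSize_eq`). Since `Δ` is bounded below in terms of `q` and `r` alone, errors relative to the
main term are also relative to its product with `Δ` (`relative_error_bounds`). -/

theorem sum_finsupp_prod_apply {R : Type*} [CommSemiring R] (a : J → V → R) (T : Finset J)
    (W : J → Finset V) :
    ∑ D ∈ T.finsupp W, ∏ P ∈ T, a P (D P) = ∏ P ∈ T, ∑ d ∈ W P, a P d := by
  classical
  rw [Finset.prod_sum, Finset.finsupp, Finset.sum_map]
  refine Finset.sum_congr rfl fun x _ => ?_
  change ∏ P ∈ T, a P (Finsupp.indicator T x P) = _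
  rw [← Finset.prod_attach T]
  refine Finset.prod_congr rfl fun P _ => ?_
  simp [Finsupp.indicator_of_mem P.2]

theorem sum_finsupp_prod_eq_prod_sum {R : Type*} [CommSemiring R] {a : J → V → R}
    (ha : ∀ P, a P 0 = 1) (T : Finset J) (W : J → Finset V) :
    ∑ D ∈ T.finsupp W, D.prod a = ∏ P ∈ T, ∑ d ∈ W P, a P d := by
  rw [← sum_finsupp_prod_apply]
  exact Finset.sum_congr rfl fun D hD => Finsupp.prod_of_support_subset _
    (Finset.mem_finsupp_iff.1 hD).1 _ fun i _ => ha i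

/-- If a two-parameter net converges and so do its inner limits, the inner limits converge to the
same limit. -/
theorem tendsto_of_tendsto_prod_of_tendsto {α β : Type*} {l : Filter α} {m : Filter β} [m.NeBot]
    {f : α → β → ℝ} {g : α → ℝ} {S : ℝ} (h : Tendsto (fun z : α × β => f z.1 z.2) (l ×ˢ m) (𝓝 S))
    (hg : ∀ a, Tendsto (f a) m (𝓝 (g a))) : Tendsto g l (𝓝 S) := by
  rw [Metric.nhds_basis_closedBall.tendsto_right_iff] at h ⊢
  intro ε hε
  filter_upwards [(h ε hε).curry] with a ha
  exact Metric.isClosed_closedBall.mem_of_tendsto (hg a) ha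

variable {a : J → V → ℝ}

/-- Any finite set of exponent vectors sits in a box, over which the sum of absolute values factors
as a product of terms `1 + x_P`; this is at most the exponential of the sum of the `x_P`. -/
theorem summable_finsupp_prod (ha : ∀ P, a P 0 = 1)
    (hs : Summable fun z : J × {d : V // d ≠ 0} => |a z.1 z.2|) :
    Summable fun D : J →₀ V => D.prod a := by
  classical
  rw [← summable_abs_iff]
  refine summable_of_sum_le (c := Real.exp (∑' z : J × {d : V // d ≠ 0}, |a z.1 z.2|))
    (fun _ => abs_nonneg _) fun u => ?_
  set T : Finset J := u.biUnion fun D => D.support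
  set W : Finset V := insert 0 (u.biUnion fun D => D.support.image D)
  have habs : ∀ D : J →₀ V, |D.prod a| = D.prod fun P d => |a P d| := fun D => by
    simp [Finsupp.prod, Finset.abs_prod]
  have hsub : u ⊆ T.finsupp fun _ => W := by
    intro D hD
    rw [Finset.mem_finsupp_iff]
    refine ⟨fun P hP => Finset.mem_biUnion.2 ⟨D, hD, hP⟩, fun P _ => ?_⟩
    by_cases h0 : D P = 0
    · rw [h0]; exact Finset.mem_insert_self _ _
    · exact Finset.mem_insert_of_mem (Finset.mem_biUnion.2 ⟨D, hD, Finset.mem_image.2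
        ⟨P, Finsupp.mem_support_iff.2 h0, rfl⟩⟩)
  simp only [habs]
  refine (Finset.sum_le_sum_of_subset_of_nonneg hsub fun D _ _ =>
    Finset.prod_nonneg fun _ _ => abs_nonneg _).trans ?_
  rw [sum_finsupp_prod_eq_prod_sum (a := fun P d => |a P d|) (by simp [ha])]
  have hW : ∀ P, ∑ d ∈ W, |a P d| = 1 + ∑ d ∈ W.subtype (· ≠ 0), |a P d.1| := fun P => by
    rw [← Finset.add_sum_erase W _ (Finset.mem_insert_self _ _), ha, abs_one]
    congr 1
    rw [Finset.sum_subtype_eq_sum_filter (s := W) (p := (· ≠ 0)) (f := fun d => |a P d|)]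
    refine Finset.sum_congr ?_ fun _ _ => rfl
    ext d; simp [and_comm]
  simp only [hW]
  refine (Real.prod_one_add_le_exp_sum T fun P => Finset.sum_nonneg fun _ _ =>
    abs_nonneg _).trans (Real.exp_le_exp.2 ?_)
  rw [← Finset.sum_product' T (W.subtype (· ≠ 0)) fun P d => |a P d.1|]
  exact hs.sum_le_tsum (T ×ˢ W.subtype (· ≠ 0)) fun _ _ => abs_nonneg _

/-- Euler product: the sum of a multiplicative function over finitely supported exponent vectors is
the product of the local sums. -/
theorem hasProd_tsum_finsupp_prod (ha : ∀ P, a P 0 = 1)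
    (hs : Summable fun z : J × {d : V // d ≠ 0} => |a z.1 z.2|) :
    HasProd (fun P => ∑' d, a P d) (∑' D : J →₀ V, D.prod a) := by
  classical
  have hsum := (summable_finsupp_prod ha hs).hasSum
  have hloc : ∀ P, Summable (a P) := fun P => by
    have h1 : Summable fun d : {d : V // d ≠ 0} => a P d :=
      Summable.of_abs (hs.comp_injective (Prod.mk_right_injective P))
    exact (Finset.summable_compl_iff {(0 : V)}).1
      ((Equiv.subtypeEquivRight (by simp)).summable_iff.1 h1)
  -- The boxes with support in `T` and entries in `W ∪ {0}` are cofinal among finite sets. Sums over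
  -- them factor; letting `W` grow first turns each factor into the full local sum.
  have hmono : Tendsto (fun z : Finset J × Finset V => z.1.finsupp fun _ => insert 0 z.2)
      atTop atTop := by
    refine tendsto_atTop_finset_of_monotone (fun z w hzw D hD => ?_) fun D => ?_
    · rw [Finset.mem_finsupp_iff] at hD ⊢
      refine ⟨hD.1.trans hzw.1, fun P _ => ?_⟩
      by_cases h0 : D P = 0
      · rw [h0]; exact Finset.mem_insert_self _ _
      · exact Finset.insert_subset_insert _ hzw.2 (hD.2 P (hD.1 (Finsupp.mem_support_iff.2 h0)))
    · refine ⟨(D.support, D.support.image D), Finset.mem_finsupp_iff.2 ⟨subset_rfl, fun P hP => ?_⟩⟩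
      exact Finset.mem_insert_of_mem (Finset.mem_image_of_mem _ hP)
  have h1 := hsum.comp hmono
  simp only [Function.comp_def, sum_finsupp_prod_eq_prod_sum ha] at h1
  rw [← prod_atTop_atTop_eq] at h1
  refine tendsto_of_tendsto_prod_of_tendsto (f := fun T W => ∏ P ∈ T, ∑ d ∈ insert 0 W, a P d) h1
    fun T => tendsto_finsetProd _ fun P _ => ?_
  exact (hloc P).hasSum.comp (tendsto_atTop_finset_of_monotone
    (fun _ _ h => Finset.insert_subset_insert _ h)
    fun x => ⟨{x}, Finset.mem_insert_of_mem (Finset.mem_singleton_self x)⟩)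

end EulerProduct

/-! ### Products of absolutely convergent series over a finite index set. -/

section Pi

variable {ι V : Type*} [Fintype ι] {a : ι → V → ℝ}

theorem summable_pi_prod (hs : ∀ i, Summable (a i)) :
    Summable fun d : ι → V => ∏ i, a i (d i) := by
  classical
  rw [← summable_abs_iff]
  refine summable_of_sum_le (c := ∏ i, ∑' d, |a i d|) (fun _ => abs_nonneg _) fun u => ?_
  simp only [Finset.abs_prod]
  set W : ι → Finset V := fun i => u.image fun d => d i
  have hsub : u ⊆ Fintype.piFinset W := fun d hd =>
    Fintype.mem_piFinset.2 fun i => Finset.mem_image_of_mem _ hd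
  refine (Finset.sum_le_sum_of_subset_of_nonneg hsub fun D _ _ =>
    Finset.prod_nonneg fun _ _ => abs_nonneg _).trans ?_
  rw [← Finset.prod_univ_sum W fun i d => |a i d|]
  exact Finset.prod_le_prod (fun i _ => Finset.sum_nonneg fun _ _ => abs_nonneg _)
    fun i _ => (hs i).abs.sum_le_tsum _ fun _ _ => abs_nonneg _

theorem tsum_pi_prod (hs : ∀ i, Summable (a i)) :
    ∑' d : ι → V, ∏ i, a i (d i) = ∏ i, ∑' d, a i d := by
  classical
  have h1 : Tendsto (fun W : ι → Finset V => Fintype.piFinset W) atTop atTop := by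
    refine tendsto_atTop_finset_of_monotone (fun z w hzw =>
      Fintype.piFinset_subset _ _ hzw) fun D => ⟨fun i => {D i}, by simp⟩
  have h2 := (summable_pi_prod hs).hasSum.comp h1
  simp only [Function.comp_def, ← Finset.prod_univ_sum] at h2
  refine tendsto_nhds_unique h2 (tendsto_finsetProd _ fun i _ => ?_)
  exact (hs i).hasSum.comp (tendsto_atTop_atTop.2 fun b =>
    ⟨fun _ => b, fun c hc => hc i⟩)

end Pi

end AbelianCovers
namespace AbelianCovers

/-! ### From local to global convolution identities. -/

section Convolution

variable {J V : Type*} [AddCommMonoid V] [PartialOrder V] [CanonicallyOrderedAdd V] [Sub V]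
  [OrderedSub V] [LocallyFiniteOrderBot V]
  {b s h : V → ℝ}

/-- A local convolution identity `b * s = h` gives the global one. -/
theorem sum_le_prod_mul_prod_sub (b0 : b 0 = 1) (s0 : s 0 = 1)
    (hloc : ∀ v, ∑ d ∈ Finset.Iic v, b d * s (v - d) = h v) (g : J →₀ V) :
    ∑ D ∈ g.support.finsupp fun P => Finset.Iic (g P),
      (D.prod fun _ d => b d) * ((g - D).prod fun _ d => s d) = g.prod fun _ v => h v := by
  rw [Finsupp.prod, ← Finset.prod_congr rfl fun P _ => hloc (g P), ← sum_finsupp_prod_apply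
    (fun P d => b d * s (g P - d))]
  refine Finset.sum_congr rfl fun D hD => ?_
  rw [Finset.mem_finsupp_iff] at hD
  rw [Finsupp.prod_of_support_subset _ hD.1 _ fun _ _ => b0,
    Finsupp.prod_of_support_subset (s := g.support) _ ?_ _ fun _ _ => s0,
    ← Finset.prod_mul_distrib]
  · simp
  · intro P hP
    rw [Finsupp.mem_support_iff] at hP ⊢
    intro h0
    simp [h0] at hP

/-- Summing the convolution over a finite set of exponent vectors. -/
theorem sum_prod_eq_sum_sum [AddLeftReflectLE V] [AddLeftMono V] (b0 : b 0 = 1) (s0 : s 0 = 1)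
    (hloc : ∀ v, ∑ d ∈ Finset.Iic v, b d * s (v - d) = h v) (U B : Finset (J →₀ V))
    (hB : ∀ D E, D + E ∈ U → D ∈ B) [DecidableEq (J →₀ V)] :
    ∑ g ∈ U, (g.prod fun _ v => h v) =
      ∑ D ∈ B, (D.prod fun _ d => b d) * ∑ E ∈ B with D + E ∈ U, E.prod fun _ d => s d := by
  have hle : ∀ g D : J →₀ V, D ∈ (g.support.finsupp fun P => Finset.Iic (g P)) ↔ D ≤ g := by
    intro g D
    rw [Finset.mem_finsupp_iff]
    refine ⟨fun ⟨h1, h2⟩ P => ?_, fun h => ⟨Finsupp.support_mono h, fun P _ =>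
      Finset.mem_Iic.2 (h P)⟩⟩
    by_cases hP : P ∈ g.support
    · exact Finset.mem_Iic.1 (h2 P hP)
    · have : D P = 0 := by
        by_contra h0
        exact hP (h1 (Finsupp.mem_support_iff.2 h0))
      simp [this]
  simp only [← sum_le_prod_mul_prod_sub b0 s0 hloc, Finset.mul_sum]
  rw [Finset.sum_sigma', Finset.sum_sigma']
  -- Pairs of a vector `g` and a divisor `D ≤ g` correspond to pairs `(D, E)` through `g = D + E`.
  refine Finset.sum_bij' (fun x _ => ⟨x.2, x.1 - x.2⟩) (fun x _ => ⟨x.1 + x.2, x.1⟩)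
    ?_ ?_ ?_ ?_ ?_
  · rintro ⟨g, D⟩ hx
    simp only [Finset.mem_sigma, hle] at hx
    have h1 : D + (g - D) = g := add_tsub_cancel_of_le hx.2
    simp only [Finset.mem_sigma, Finset.mem_filter, h1]
    exact ⟨hB D (g - D) (by rw [h1]; exact hx.1),
      hB (g - D) D (by rw [add_comm, h1]; exact hx.1), hx.1⟩
  · rintro ⟨D, E⟩ hx
    simp only [Finset.mem_sigma, Finset.mem_filter] at hx
    simp only [Finset.mem_sigma, hle]
    exact ⟨hx.2.2, le_self_add⟩
  · rintro ⟨g, D⟩ hx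
    simp only [Finset.mem_sigma, hle] at hx
    have h1 : D + (g - D) = g := add_tsub_cancel_of_le hx.2
    simp [h1]
  · rintro ⟨D, E⟩ hx
    simp
  · rintro ⟨g, D⟩ hx
    rfl

end Convolution

/-! ### Local coefficients of the two sieves. -/

section LocalCoefficients

/-- The coefficients of `1 - t²`. -/
def sqCoeff (n : ℕ) : ℝ := if n = 0 then 1 else if n = 2 then -1 else 0

/-- The indicator function of exponents at most one. -/
def sqfreeInd (n : ℕ) : ℝ := if n ≤ 1 then 1 else 0

/-- The identity of power series `(1 - t²) · 1/(1 - t) = 1 + t`. -/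
theorem sum_sqCoeff (v : ℕ) : ∑ d ∈ Finset.Iic v, sqCoeff d * 1 = sqfreeInd v := by
  rw [← Nat.range_succ_eq_Iic]
  match v with
  | 0 => simp [sqCoeff, sqfreeInd]
  | 1 => simp [sqCoeff, sqfreeInd, Finset.sum_range_succ]
  | n + 2 =>
    have : ∀ m, ∑ d ∈ Finset.range (m + 3), sqCoeff d * 1 = 0 := by
      intro m
      induction m with
      | zero => simp [sqCoeff, Finset.sum_range_succ]
      | succ m ih => rw [Finset.sum_range_succ, ih]; simp [sqCoeff]
    rw [this n]; simp [sqfreeInd]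

variable {ι : Type*} [DecidableEq ι]

/-- The coefficients of `t / (1 + t)` for `j = i` and of `1 / (1 + t)` for `j ≠ i`. -/
def crossFactor (i j : ι) (n : ℕ) : ℝ :=
  if j = i then (if n = 0 then 0 else -(-1) ^ n) else (-1) ^ n

theorem sum_crossFactor_mul_sqfreeInd (i : ι) (v : ℕ) :
    ∑ d ∈ Finset.Iic v, crossFactor i i d * sqfreeInd (v - d) = if v = 1 then 1 else 0 := by
  rw [← Nat.range_succ_eq_Iic]
  match v with
  | 0 => simp [crossFactor]
  | 1 => simp [crossFactor, sqfreeInd, Finset.sum_range_succ]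
  | n + 2 =>
    rw [Finset.sum_range_succ, Finset.sum_range_succ, Finset.sum_eq_zero]
    · simp [sqfreeInd, crossFactor, pow_succ]
    · intro x hx
      rw [Finset.mem_range] at hx
      simp [sqfreeInd, show ¬ n + 2 - x ≤ 1 by omega]

variable [Fintype ι]

/-- The coefficients of `(1 + ∑ t_i) / ∏ (1 + t_i)`. -/
def crossCoeff (d : ι → ℕ) : ℝ := ∏ j, (-1) ^ d j + ∑ i, ∏ j, crossFactor i j (d j)

/-- The `i`-th summand is `t_i ∏ 1/(1 + t_j)`, whose coefficient is that of `∏ 1/(1 + t_j)` with the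
sign changed when `d i ≠ 0`, and `0` otherwise. This closed form gives both the uniform bound and
the vanishing used for convergence. -/
theorem crossCoeff_eq (d : ι → ℕ) :
    crossCoeff d = (∏ j, (-1) ^ d j) * (1 - (Finset.univ.filter fun i => d i ≠ 0).card) := by
  have h : ∀ i, ∏ j, crossFactor i j (d j) = if d i ≠ 0 then -∏ j, (-1 : ℝ) ^ d j else 0 := by
    intro i
    rw [← Finset.mul_prod_erase _ _ (Finset.mem_univ i),
      ← Finset.mul_prod_erase _ (fun j => (-1 : ℝ) ^ d j) (Finset.mem_univ i)]
    rw [Finset.prod_congr rfl (g := fun j => (-1 : ℝ) ^ d j) fun j hj => by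
      simp [crossFactor, Finset.ne_of_mem_erase hj]]
    by_cases h0 : d i = 0 <;> simp [crossFactor, h0]
  rw [crossCoeff, Finset.sum_congr rfl fun i _ => h i, ← Finset.sum_filter]
  simp
  ring

theorem crossCoeff_zero : crossCoeff (0 : ι → ℕ) = 1 := by
  simp [crossCoeff_eq]

theorem abs_crossCoeff_le (d : ι → ℕ) : |crossCoeff d| ≤ Fintype.card ι + 1 := by
  rw [crossCoeff_eq, abs_mul, Finset.abs_prod]
  simp only [abs_pow, abs_neg, abs_one, one_pow, Finset.prod_const_one, one_mul]
  have : (((Finset.univ.filter fun i => d i ≠ 0).card : ℕ) : ℝ) ≤ Fintype.card ι := by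
    exact_mod_cast Finset.card_le_univ _
  rw [abs_le]
  constructor <;> linarith [Nat.cast_nonneg (α := ℝ) (Finset.univ.filter fun i => d i ≠ 0).card,
    Nat.cast_nonneg (α := ℝ) (Fintype.card ι)]

/-- With all variables but one set to zero, `(1 + ∑ t_i) / ∏ (1 + t_i)` is the constant `1`.
Coprimality is a condition between two different indices, so correction terms start with two nonzero
exponents. -/
theorem crossCoeff_eq_zero {d : ι → ℕ} {i : ι} (hi : d i ≠ 0) (h : ∀ j, j ≠ i → d j = 0) :
    crossCoeff d = 0 := by
  have : (Finset.univ.filter fun i => d i ≠ 0) = {i} := by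
    ext j
    simp only [Finset.mem_filter, Finset.mem_univ, true_and, Finset.mem_singleton]
    exact ⟨fun hj => by_contra fun h' => hj (h j h'), fun hj => hj ▸ hi⟩
  simp [crossCoeff_eq, this]

theorem sum_neg_one_pow_mul_sqfreeInd (v : ℕ) :
    ∑ d ∈ Finset.Iic v, (-1) ^ d * sqfreeInd (v - d) = if v = 0 then 1 else 0 := by
  rw [← Nat.range_succ_eq_Iic]
  match v with
  | 0 => simp [sqfreeInd]
  | n + 1 =>
    rw [Finset.sum_range_succ, Finset.sum_range_succ, Finset.sum_eq_zero]
    · simp [sqfreeInd, pow_succ]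
    · intro x hx
      rw [Finset.mem_range] at hx
      simp [sqfreeInd, show ¬ n + 1 - x ≤ 1 by omega]

/-- Multiplying `(1 + ∑ t_i) / ∏ (1 + t_i)` by `∏ (1 + t_i)` leaves `1 + ∑ t_i`, which encodes that
a prime occurs at most once in at most one member of the tuple. -/
theorem sum_crossCoeff (v : ι → ℕ) :
    ∑ d ∈ Finset.Iic v, crossCoeff d * ∏ i, sqfreeInd ((v - d) i) =
      if ∑ i, v i ≤ 1 then 1 else 0 := by
  have hI : Finset.Iic v = Fintype.piFinset fun i => Finset.Iic (v i) := by
    ext d; simp [Pi.le_def]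
  have key : ∀ a : ι → ℕ → ℝ, ∑ d ∈ Finset.Iic v, (∏ j, a j (d j)) * ∏ i, sqfreeInd ((v - d) i) =
      ∏ j, ∑ d ∈ Finset.Iic (v j), a j d * sqfreeInd (v j - d) := by
    intro a
    rw [hI, Finset.prod_univ_sum]
    exact Finset.sum_congr rfl fun d _ => by simp [Finset.prod_mul_distrib]
  simp only [crossCoeff, add_mul, Finset.sum_mul, Finset.sum_add_distrib]
  rw [Finset.sum_comm, key fun _ d => (-1) ^ d]
  simp only [key]
  simp only [sum_neg_one_pow_mul_sqfreeInd]
  have h2 : ∀ i, ∏ j, ∑ d ∈ Finset.Iic (v j), crossFactor i j d * sqfreeInd (v j - d) =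
      if v = Pi.single i 1 then 1 else 0 := by
    intro i
    have : ∀ j, ∑ d ∈ Finset.Iic (v j), crossFactor i j d * sqfreeInd (v j - d) =
        if v j = Pi.single (M := fun _ => ℕ) i 1 j then 1 else 0 := by
      intro j
      by_cases hj : j = i
      · subst hj; rw [sum_crossFactor_mul_sqfreeInd]; simp
      · simp only [crossFactor, hj, if_false, sum_neg_one_pow_mul_sqfreeInd]; simp [hj]
    simp only [this]
    rw [Finset.prod_ite_zero]
    simp [funext_iff]
  simp only [h2]
  rw [Finset.prod_ite_zero]
  simp only [Finset.mem_univ, true_imp_iff, Finset.prod_const_one]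
  by_cases hv : ∃ i, v = Pi.single i 1
  · obtain ⟨i, rfl⟩ := hv
    have h3 : ¬ ∀ j, Pi.single (M := fun _ => ℕ) i 1 j = 0 := fun h => by simpa using h i
    have h4 : ∀ j, (Pi.single (M := fun _ => ℕ) i 1 = Pi.single j 1) ↔ i = j := fun j => by
      refine ⟨fun h => by_contra fun hne => ?_, fun h => h ▸ rfl⟩
      have := congrFun h i
      simp [hne] at this
    simp [h3, h4]
  · have h3 : ∀ i, ¬ v = Pi.single i 1 := fun i h => hv ⟨i, h⟩
    simp only [h3, if_false, Finset.sum_const_zero, add_zero]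
    congr 1
    rw [eq_iff_iff]
    refine ⟨fun h => by simp [h], fun h => ?_⟩
    by_contra hne
    push Not at hne
    obtain ⟨i, hi⟩ := hne
    refine h3 i (funext fun j => ?_)
    have hs := Finset.add_sum_erase Finset.univ v (Finset.mem_univ i)
    by_cases hj : j = i
    · subst hj; simp; omega
    · have := Finset.single_le_sum (f := v) (fun _ _ => Nat.zero_le _)
        (Finset.mem_erase.2 ⟨hj, Finset.mem_univ j⟩)
      simp [hj]; omega

/-- The local Euler factor of `crossCoeff`. -/
theorem tsum_crossCoeff {x : ℝ} (h0 : 0 ≤ x) (h1 : x < 1) :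
    ∑' d : ι → ℕ, crossCoeff d * ∏ i, x ^ d i =
      (1 + Fintype.card ι * x) / (1 + x) ^ Fintype.card ι := by
  have hx : |(-x)| < 1 := by rw [abs_neg, abs_of_nonneg h0]; exact h1
  have hg := hasSum_geometric_of_abs_lt_one hx
  have hs1 : HasSum (fun n : ℕ => (-1) ^ n * x ^ n) (1 + x)⁻¹ := by
    convert hg using 1
    · ext n; rw [← mul_pow]; ring
    · rw [sub_neg_eq_add]
  have hs2 : ∀ i j : ι, HasSum (fun n : ℕ => crossFactor i j n * x ^ n)
      (if j = i then x / (1 + x) else (1 + x)⁻¹) := by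
    intro i j
    by_cases hj : j = i
    · simp only [hj, if_true]
      have h2 := ((hasSum_ite_eq (0 : ℕ) (1 : ℝ)).sub hs1)
      have e : (fun n : ℕ => crossFactor i i n * x ^ n) =
          fun n => (if n = 0 then 1 else 0) - (-1) ^ n * x ^ n := by
        ext n
        by_cases hn : n = 0 <;> simp [crossFactor, hn]
      rw [e, show x / (1 + x) = 1 - (1 + x)⁻¹ by field_simp; ring]
      exact h2
    · simpa only [crossFactor, hj, if_false] using hs1
  have e1 : ∀ d : ι → ℕ, crossCoeff d * ∏ i, x ^ d i = (∏ j, (-1) ^ d j * x ^ d j) +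
      ∑ i, ∏ j, (crossFactor i j (d j) * x ^ d j) := by
    intro d
    simp only [crossCoeff, add_mul, Finset.sum_mul, Finset.prod_mul_distrib]
  simp only [e1]
  have S1 := summable_pi_prod (ι := ι) (a := fun _ n => (-1) ^ n * x ^ n) fun _ => hs1.summable
  have S2 := fun i => summable_pi_prod (ι := ι) (a := fun j n => crossFactor i j n * x ^ n)
    fun j => (hs2 i j).summable
  rw [Summable.tsum_add S1 (summable_sum fun i _ => S2 i), Summable.tsum_finsetSum fun i _ => S2 i,
    tsum_pi_prod (a := fun _ n => (-1) ^ n * x ^ n) fun _ => hs1.summable]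
  have e2 : ∀ i, ∑' d : ι → ℕ, ∏ j, (crossFactor i j (d j) * x ^ d j) =
      x / (1 + x) ^ Fintype.card ι := by
    intro i
    rw [tsum_pi_prod (a := fun j n => crossFactor i j n * x ^ n) fun j => (hs2 i j).summable]
    simp only [(hs2 i _).tsum_eq]
    rw [← Finset.mul_prod_erase _ _ (Finset.mem_univ i), if_pos rfl,
      Finset.prod_congr rfl (g := fun _ => (1 + x)⁻¹) fun j hj => by
        simp [Finset.ne_of_mem_erase hj]]
    rw [Finset.prod_const, Finset.card_erase_of_mem (Finset.mem_univ i), Finset.card_univ]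
    have hc : Fintype.card ι = Fintype.card ι - 1 + 1 :=
      (Nat.succ_pred_eq_of_pos (Fintype.card_pos_iff.2 ⟨i⟩)).symm
    conv_rhs => rw [hc]
    have : (1 + x) ≠ 0 := by positivity
    rw [pow_succ, inv_pow]
    field_simp
  simp only [e2, hs1.tsum_eq]
  simp
  field_simp

end LocalCoefficients

end AbelianCovers
namespace AbelianCovers

/-! ### Abstract primes with degrees and classes. -/

section PrimeSystem

variable {J Γ : Type*} [CommGroup Γ]

/-- The degree of an exponent vector, given the degrees of the primes. -/
def expDeg (deg : J → ℕ) (φ : J →₀ ℕ) : ℕ := φ.sum fun P n => n * deg P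

/-- The class of an exponent vector, given the classes of the primes. -/
def expCls (cl : J → Γ) (φ : J →₀ ℕ) : Γ := φ.prod fun P n => cl P ^ n

theorem expDeg_add (deg : J → ℕ) (φ ψ : J →₀ ℕ) :
    expDeg deg (φ + ψ) = expDeg deg φ + expDeg deg ψ := by
  classical
  exact Finsupp.sum_add_index' (by simp) fun P m n => add_mul m n (deg P)

theorem expCls_add (cl : J → Γ) (φ ψ : J →₀ ℕ) :
    expCls cl (φ + ψ) = expCls cl φ * expCls cl ψ := by
  classical
  exact Finsupp.prod_add_index' (by simp) fun P m n => pow_add (cl P) m n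

theorem pow_expDeg {R : Type*} [CommMonoid R] (deg : J → ℕ) (y : R) (φ : J →₀ ℕ) :
    y ^ expDeg deg φ = φ.prod fun P n => (y ^ deg P) ^ n := by
  rw [expDeg, Finsupp.sum, ← Finset.prod_pow_eq_pow_sum]
  exact Finset.prod_congr rfl fun P _ => by dsimp only; rw [← pow_mul, mul_comm]

/-- A system of primes with degrees and classes such that the exponent vectors of given degree are
equidistributed over the classes up to a bounded error. -/
structure PrimeSystem (deg : J → ℕ) (cl : J → Γ) (q c : ℝ) : Prop where
  two_le_q : 2 ≤ q
  two_le_deg : ∀ P, 2 ≤ deg P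
  finite : ∀ e γ, {φ : J →₀ ℕ | expDeg deg φ = e ∧ expCls cl φ = γ}.Finite
  c_nonneg : 0 ≤ c
  c_le_one : c ≤ 1
  count : ∀ e γ, |({φ : J →₀ ℕ | expDeg deg φ = e ∧ expCls cl φ = γ}.ncard : ℝ) - c * q ^ e| ≤ 1

namespace PrimeSystem

variable {deg : J → ℕ} {cl : J → Γ} {q c : ℝ}

theorem sqrt_sq (H : PrimeSystem deg cl q c) : √q ^ 2 = q :=
  Real.sq_sqrt (by linarith [H.two_le_q])

theorem sqrt_pow (H : PrimeSystem deg cl q c) (m : ℕ) : √q ^ (2 * m) = q ^ m := by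
  rw [pow_mul, H.sqrt_sq]

theorem one_lt_sqrt (H : PrimeSystem deg cl q c) : 1 < √q := by
  rw [Real.lt_sqrt one_pos.le]; linarith [H.two_le_q]

theorem ncard_le (H : PrimeSystem deg cl q c) (e : ℕ) (γ : Γ) :
    ({φ : J →₀ ℕ | expDeg deg φ = e ∧ expCls cl φ = γ}.ncard : ℝ) ≤ 2 * q ^ e := by
  have h1 := (abs_le.1 (H.count e γ)).2
  have h2 : 1 ≤ q ^ e := one_le_pow₀ (by linarith [H.two_le_q])
  nlinarith [H.c_le_one]

/-- These weights bound the error of the sieve by squares: a square `2E` with `deg E = m` costs at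
most `1` while `2m ≤ e`, and its missing main term `q ^ (e - 2m)` afterwards. Splitting at `m = e /
2` leaves two geometric sums, each at most `2 √q ^ e`. -/
theorem sum_square_weights (H : PrimeSystem deg cl q c) (e : ℕ) :
    (Summable fun m : ℕ => q ^ m * min 1 (q ^ e / q ^ (2 * m))) ∧
      ∑' m : ℕ, q ^ m * min 1 (q ^ e / q ^ (2 * m)) ≤ 4 * √q ^ e := by
  have hq := H.two_le_q
  have hq0 : 0 < q := by linarith
  have h1 := H.one_lt_sqrt
  have hgeo : HasSum (fun m : ℕ => (1 / q) ^ m) (1 - 1 / q)⁻¹ :=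
    hasSum_geometric_of_lt_one (by positivity) (by rw [div_lt_one hq0]; linarith)
  have hbound : ∀ m : ℕ, q ^ m * min 1 (q ^ e / q ^ (2 * m)) ≤ q ^ e * (1 / q) ^ m := fun m => by
    refine (mul_le_mul_of_nonneg_left (min_le_right _ _) (by positivity)).trans (le_of_eq ?_)
    rw [one_div, inv_pow, two_mul, pow_add]
    field_simp
  have hs : Summable fun m : ℕ => q ^ m * min 1 (q ^ e / q ^ (2 * m)) :=
    Summable.of_nonneg_of_le (fun m => by positivity) hbound (hgeo.summable.mul_left _)
  refine ⟨hs, ?_⟩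
  set M := e / 2
  have hM1 : 2 * M ≤ e := Nat.mul_div_le e 2
  have hM2 : e < 2 * (M + 1) := by omega
  rw [← hs.sum_add_tsum_nat_add (M + 1)]
  have ha : ∑ m ∈ Finset.range (M + 1), q ^ m * min 1 (q ^ e / q ^ (2 * m)) ≤ 2 * √q ^ e := by
    refine (Finset.sum_le_sum (g := fun m => q ^ m) fun m _ => ?_).trans ?_
    · exact (mul_le_mul_of_nonneg_left (min_le_left _ _) (by positivity)).trans (mul_one _).le
    · have hind : ∀ n : ℕ, ∑ m ∈ Finset.range (n + 1), q ^ m ≤ 2 * q ^ n := by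
        intro n
        induction n with
        | zero => simp
        | succ n ih =>
          rw [Finset.sum_range_succ, pow_succ]
          nlinarith [pow_pos hq0 n]
      refine (hind M).trans ?_
      rw [← H.sqrt_pow]
      gcongr
      exact h1.le
  have hb : ∑' m : ℕ, q ^ (m + (M + 1)) * min 1 (q ^ e / q ^ (2 * (m + (M + 1)))) ≤
      2 * √q ^ e := by
    have hle : ∀ m : ℕ, q ^ (m + (M + 1)) * min 1 (q ^ e / q ^ (2 * (m + (M + 1)))) ≤
        √q ^ e * (1 / q) ^ m := fun m => by
      refine (hbound _).trans ?_
      rw [pow_add, mul_comm ((1 / q) ^ m), ← mul_assoc]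
      refine mul_le_mul_of_nonneg_right ?_ (by positivity)
      rw [one_div, inv_pow, ← div_eq_mul_inv, div_le_iff₀ (by positivity), ← H.sqrt_pow,
        ← H.sqrt_pow, ← pow_add]
      exact pow_le_pow_right₀ h1.le (by omega)
    refine (Summable.tsum_le_tsum hle ((summable_nat_add_iff _).2 hs)
      (hgeo.summable.mul_left _)).trans ?_
    rw [tsum_mul_left, hgeo.tsum_eq, mul_comm]
    refine mul_le_mul_of_nonneg_right ?_ (by positivity)
    rw [inv_le_comm₀ (by rw [sub_pos, div_lt_one hq0]; linarith) two_pos]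
    have : 1 / q ≤ 1 / 2 := one_div_le_one_div_of_le two_pos hq
    linarith
  linarith

variable [Fintype Γ]

theorem finite_deg_eq (H : PrimeSystem deg cl q c) (e : ℕ) :
    {φ : J →₀ ℕ | expDeg deg φ = e}.Finite := by
  refine (Set.finite_iUnion fun γ => H.finite e γ).subset fun φ hφ => ?_
  exact Set.mem_iUnion.2 ⟨expCls cl φ, hφ, rfl⟩

theorem finite_deg_le (H : PrimeSystem deg cl q c) (e : ℕ) :
    {φ : J →₀ ℕ | expDeg deg φ ≤ e}.Finite := by
  refine ((Set.finite_Iic e).biUnion fun m _ => H.finite_deg_eq m).subset fun φ hφ => ?_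
  exact Set.mem_biUnion (Set.mem_Iic.2 hφ) rfl

theorem ncard_deg_eq_le (H : PrimeSystem deg cl q c) (e : ℕ) :
    ({φ : J →₀ ℕ | expDeg deg φ = e}.ncard : ℝ) ≤ 2 * Fintype.card Γ * q ^ e := by
  classical
  have h : {φ : J →₀ ℕ | expDeg deg φ = e} =
      ⋃ γ ∈ (Finset.univ : Finset Γ), {φ | expDeg deg φ = e ∧ expCls cl φ = γ} := by
    ext φ; simp
  have h2 := Finset.set_ncard_biUnion_le (Finset.univ : Finset Γ)
    fun γ => {φ : J →₀ ℕ | expDeg deg φ = e ∧ expCls cl φ = γ}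
  rw [h]
  refine (Nat.cast_le.2 h2).trans ?_
  push_cast
  refine (Finset.sum_le_sum fun γ _ => H.ncard_le e γ).trans ?_
  simp; linarith

/-- Grouping by degree suffices, since at most `2 |Γ| q ^ m` exponent vectors have degree `m`. -/
theorem sum_deg_le (H : PrimeSystem deg cl q c) {w : ℕ → ℝ} (hw : ∀ m, 0 ≤ w m)
    (hs : Summable fun m => q ^ m * w m) (u : Finset (J →₀ ℕ)) :
    ∑ φ ∈ u, w (expDeg deg φ) ≤ 2 * Fintype.card Γ * ∑' m, q ^ m * w m := by
  classical
  have h0 : 0 ≤ q := by linarith [H.two_le_q]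
  rw [← Finset.sum_fiberwise_of_maps_to (t := u.image (expDeg deg)) (g := expDeg deg)
    fun φ hφ => Finset.mem_image_of_mem _ hφ]
  rw [← tsum_mul_left]
  refine (Finset.sum_le_sum (g := fun m => 2 * Fintype.card Γ * (q ^ m * w m)) fun m _ => ?_).trans
    ((hs.mul_left _).sum_le_tsum _ fun m _ => ?_)
  · rw [Finset.sum_congr rfl (g := fun _ => w m) fun φ hφ => by rw [(Finset.mem_filter.1 hφ).2],
      Finset.sum_const, nsmul_eq_mul, ← mul_assoc]
    refine mul_le_mul_of_nonneg_right ?_ (hw m)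
    refine le_trans ?_ (H.ncard_deg_eq_le m)
    rw [← Set.ncard_coe_finset]
    refine Nat.cast_le.2 (Set.ncard_le_ncard (fun φ hφ => ?_) (H.finite_deg_eq m))
    exact (Finset.mem_filter.1 hφ).2
  · have := hw m; positivity

theorem summable_deg (H : PrimeSystem deg cl q c) {w : ℕ → ℝ} (hw : ∀ m, 0 ≤ w m)
    (hs : Summable fun m => q ^ m * w m) : Summable fun φ : J →₀ ℕ => w (expDeg deg φ) :=
  summable_of_sum_le (fun _ => hw _) (H.sum_deg_le hw hs)

theorem tsum_deg_le (H : PrimeSystem deg cl q c) {w : ℕ → ℝ} (hw : ∀ m, 0 ≤ w m)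
    (hs : Summable fun m => q ^ m * w m) :
    ∑' φ : J →₀ ℕ, w (expDeg deg φ) ≤ 2 * Fintype.card Γ * ∑' m, q ^ m * w m :=
  (H.summable_deg hw hs).tsum_le_of_sum_le (H.sum_deg_le hw hs)

/-- The exponent `3/2` exceeds `1`, so the sum converges even over all exponent vectors, and the
primes embed among them as single exponents. All later convergence statements are compared with this
series. -/
theorem summable_primes (H : PrimeSystem deg cl q c) :
    Summable fun P => ((√q)⁻¹ ^ 3) ^ deg P := by
  have h1 := H.one_lt_sqrt
  have h2 : (√q)⁻¹ < 1 := inv_lt_one_of_one_lt₀ h1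
  have h3 : Summable fun φ : J →₀ ℕ => ((√q)⁻¹ ^ 3) ^ expDeg deg φ := by
    refine H.summable_deg (w := fun m => ((√q)⁻¹ ^ 3) ^ m) (fun m => by positivity) ?_
    refine (summable_geometric_of_lt_one (inv_nonneg.2 (Real.sqrt_nonneg q)) h2).congr fun m => ?_
    rw [← mul_pow]
    congr 1
    conv_rhs => rw [← H.sqrt_sq, Real.sqrt_sq (Real.sqrt_nonneg q)]
    field_simp
  have h4 : Function.Injective fun P : J => Finsupp.single P 1 := fun P Q h =>
    (Finsupp.single_eq_single_iff _ _ _ _).1 h |>.elim (·.1) (by simp)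
  refine (h3.comp_injective h4).congr fun P => ?_
  simp [expDeg]

end PrimeSystem

end PrimeSystem

end AbelianCovers
-- Squarefree exponent vectors of given degree and class.
namespace AbelianCovers
namespace PrimeSystem

variable {J Γ : Type*} [CommGroup Γ] {deg : J → ℕ} {cl : J → Γ} {q c : ℝ}

theorem prod_sqCoeff_two_nsmul {D : J →₀ ℕ} (hD : (D.prod fun _ d => sqCoeff d) ≠ 0) :
    ∃ E : J →₀ ℕ, 2 • E = D := by
  refine ⟨D.mapRange (· / 2) (by simp), Finsupp.ext fun P => ?_⟩
  simp only [Finsupp.smul_apply, Finsupp.mapRange_apply, smul_eq_mul]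
  by_cases h0 : P ∈ D.support
  · have h1 := Finset.prod_ne_zero_iff.1 hD P h0
    simp only [sqCoeff] at h1
    rw [Finsupp.mem_support_iff] at h0
    by_cases h2 : D P = 2
    · omega
    · simp [h0, h2] at h1
  · rw [Finsupp.notMem_support_iff] at h0; omega

theorem abs_prod_sqCoeff_le (D : J →₀ ℕ) : |D.prod fun _ d => sqCoeff d| ≤ 1 := by
  rw [Finsupp.prod, Finset.abs_prod]
  refine Finset.prod_le_one (fun _ _ => abs_nonneg _) fun P _ => ?_
  unfold sqCoeff
  split_ifs <;> simp

/-- Only `d = 2` contributes, and `q ^ (-2 deg P) ≤ q ^ (-3/2 deg P)`. The factor `4` in the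
comparison cancels `(1/2)²`. -/
theorem summable_sqCoeff_primes [Fintype Γ] (H : PrimeSystem deg cl q c) :
    Summable fun z : J × {d : ℕ // d ≠ 0} => |sqCoeff z.2.1 * ((q ^ deg z.1)⁻¹) ^ z.2.1| := by
  have hq := H.two_le_q
  have h2 : Summable fun d : {d : ℕ // d ≠ 0} => (1 / 2 : ℝ) ^ d.1 :=
    summable_geometric_two.comp_injective Subtype.val_injective
  have h3 := (H.summable_primes.mul_left 4).mul_of_nonneg h2
    (fun P => by positivity) (fun d => by positivity)
  refine Summable.of_nonneg_of_le (fun _ => abs_nonneg _) (fun z => ?_) h3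
  obtain ⟨P, d, hd⟩ := z
  dsimp only
  by_cases hd2 : d = 2
  · subst hd2
    have hp : 1 ≤ √q ^ deg P := one_le_pow₀ H.one_lt_sqrt.le
    have e1 : (q ^ deg P)⁻¹ ^ 2 = ((√q)⁻¹ ^ 3) ^ deg P * (√q ^ deg P)⁻¹ := by
      rw [← H.sqrt_pow, ← inv_pow, ← inv_pow, ← pow_mul, ← pow_mul, ← pow_add]
      congr 1; ring
    rw [e1]
    have : (0:ℝ) ≤ ((√q)⁻¹ ^ 3) ^ deg P := by positivity
    simp only [sqCoeff, show ¬ (2 = 0) by decide, if_true, if_false]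
    rw [abs_mul, abs_neg, abs_one, one_mul, abs_of_nonneg (by positivity)]
    have h4 := inv_le_one_of_one_le₀ hp
    nlinarith
  · simp only [sqCoeff, hd, hd2, if_false, zero_mul, abs_zero]
    positivity

/-- The density of the squarefree exponent vectors. -/
noncomputable def sqfreeDensity (deg : J → ℕ) (q : ℝ) : ℝ :=
  ∑' D : J →₀ ℕ, D.prod fun P d => sqCoeff d * ((q ^ deg P)⁻¹) ^ d

theorem hasProd_sqfreeDensity [Fintype Γ] (H : PrimeSystem deg cl q c) :
    HasProd (fun P => 1 - ((q ^ deg P)⁻¹) ^ 2) (sqfreeDensity deg q) := by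
  have h : HasProd _ (sqfreeDensity deg q) :=
    hasProd_tsum_finsupp_prod (a := fun P d => sqCoeff d * ((q ^ deg P)⁻¹) ^ d)
      (by simp [sqCoeff]) H.summable_sqCoeff_primes
  convert h using 2 with P
  rw [tsum_eq_sum (s := {0, 2}) fun d hd => ?_]
  · simp [sqCoeff]; ring
  · simp only [Finset.mem_insert, Finset.mem_singleton, not_or] at hd
    simp [sqCoeff, hd.1, hd.2]

theorem prod_sqCoeff_mul (deg : J → ℕ) (q : ℝ) (D : J →₀ ℕ) :
    (D.prod fun P d => sqCoeff d * ((q ^ deg P)⁻¹) ^ d) =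
      (D.prod fun _ d => sqCoeff d) * (q ^ expDeg deg D)⁻¹ := by
  rw [← inv_pow, pow_expDeg, ← Finsupp.prod_mul]
  simp only [inv_pow]

/-- The squarefree exponent vectors of given degree and class. -/
def sqfreeSet (deg : J → ℕ) (cl : J → Γ) (e : ℕ) (γ : Γ) : Set (J →₀ ℕ) :=
  {φ | (∀ P, φ P ≤ 1) ∧ expDeg deg φ = e ∧ expCls cl φ = γ}

theorem prod_sqfreeInd (φ : J →₀ ℕ) [Decidable (∀ P, φ P ≤ 1)] :
    (φ.prod fun _ d => sqfreeInd d) = if ∀ P, φ P ≤ 1 then 1 else 0 := by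
  by_cases h : ∀ P, φ P ≤ 1
  · rw [if_pos h]
    exact Finset.prod_eq_one fun P _ => by simp [sqfreeInd, h P]
  · rw [if_neg h]
    push Not at h
    obtain ⟨P, hP⟩ := h
    exact Finset.prod_eq_zero (Finsupp.mem_support_iff.2 (by omega)) (i := P)
      (by simp [sqfreeInd, hP])

theorem ncard_sqfreeSet_eq (H : PrimeSystem deg cl q c) (e : ℕ) (γ : Γ) :
    ((sqfreeSet deg cl e γ).ncard : ℝ) =
      ∑ φ ∈ (H.finite e γ).toFinset, φ.prod fun _ d => sqfreeInd d := by
  classical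
  simp only [prod_sqfreeInd]
  rw [Finset.sum_boole, ← Set.ncard_coe_finset]
  congr 2
  ext φ
  simp [sqfreeSet, and_comm]

theorem ncard_sqfreeSet_le (H : PrimeSystem deg cl q c) (e : ℕ) (γ : Γ) :
    ((sqfreeSet deg cl e γ).ncard : ℝ) ≤ 2 * q ^ e :=
  le_trans (Nat.cast_le.2 (Set.ncard_le_ncard (fun _ h => h.2) (H.finite e γ))) (H.ncard_le e γ)

/-- The squarefree exponent vectors are equidistributed with a square-root error. -/
theorem abs_ncard_sqfreeSet_sub_le [Fintype Γ] (H : PrimeSystem deg cl q c) (e : ℕ) (γ : Γ) :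
    |((sqfreeSet deg cl e γ).ncard : ℝ) - c * sqfreeDensity deg q * q ^ e| ≤
      8 * Fintype.card Γ * √q ^ e := by
  classical
  have hq := H.two_le_q
  have hq0 : 0 < q := by linarith
  set U := (H.finite e γ).toFinset
  set B := (H.finite_deg_le e).toFinset
  have hB : ∀ D E, D + E ∈ U → D ∈ B := by
    intro D E h
    simp only [U, B, Set.Finite.mem_toFinset, Set.mem_ofPred_eq, expDeg_add] at h ⊢
    omega
  -- `N D` counts the cofactors of `D`. Setting it to `0` once `D` is too large lets the sum run
  -- over all `D`; the main term is then itself smaller than the allowed error.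
  set N : (J →₀ ℕ) → ℝ := fun D => if expDeg deg D ≤ e then
    (({φ : J →₀ ℕ | expDeg deg φ = e - expDeg deg D ∧
      expCls cl φ = γ * (expCls cl D)⁻¹}.ncard : ℕ) : ℝ) else 0
  have hN : ∀ D, |N D - c * (q ^ e / q ^ expDeg deg D)| ≤ min 1 (q ^ e / q ^ expDeg deg D) := by
    intro D
    by_cases hD : expDeg deg D ≤ e
    · have e1 : q ^ e / q ^ expDeg deg D = q ^ (e - expDeg deg D) := by
        rw [pow_sub₀ _ hq0.ne' hD, div_eq_mul_inv]
      simp only [N, if_pos hD, e1]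
      rw [min_eq_left (one_le_pow₀ (by linarith))]
      exact H.count _ _
    · simp only [N, if_neg hD, zero_sub, abs_neg]
      have h1 : q ^ e / q ^ expDeg deg D ≤ 1 := by
        rw [div_le_one (by positivity)]
        exact pow_le_pow_right₀ (by linarith) (by omega)
      rw [min_eq_right h1, abs_of_nonneg (mul_nonneg H.c_nonneg (by positivity))]
      exact mul_le_of_le_one_left (by positivity) H.c_le_one
  have hS : ((sqfreeSet deg cl e γ).ncard : ℝ) =
      ∑' D : J →₀ ℕ, (D.prod fun _ d => sqCoeff d) * N D := by
    rw [H.ncard_sqfreeSet_eq, sum_prod_eq_sum_sum (b := sqCoeff) (s := fun _ => 1)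
      (by simp [sqCoeff]) rfl sum_sqCoeff U B hB, tsum_eq_sum (s := B) fun D hD => ?_]
    · refine Finset.sum_congr rfl fun D hD => ?_
      congr 1
      have hD' : expDeg deg D ≤ e := by simpa [B] using hD
      simp only [N, if_pos hD']
      simp only [Finsupp.prod, Finset.prod_const_one, Finset.sum_const, nsmul_eq_mul, mul_one]
      rw [← Set.ncard_coe_finset]
      congr 2
      ext E
      simp only [U, B, Finset.coe_filter, Set.Finite.mem_toFinset, Set.mem_ofPred_eq, expDeg_add,
        expCls_add, eq_mul_inv_iff_mul_eq, mul_comm (expCls cl E)]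
      constructor
      · rintro ⟨h1, h2, h3⟩; exact ⟨by omega, h3⟩
      · rintro ⟨h1, h3⟩; exact ⟨by omega, by omega, h3⟩
    · have hD' : ¬ expDeg deg D ≤ e := by simpa [B] using hD
      simp [N, hD']
  set w : ℕ → ℝ := fun m => min 1 (q ^ e / q ^ m)
  have hw0 : ∀ m, 0 ≤ w m := fun m => by positivity
  obtain ⟨hs1, hs2⟩ := H.sum_square_weights e
  have hinj : Function.Injective fun E : J →₀ ℕ => 2 • E := fun E E' h => by
    ext P
    have := DFunLike.congr_fun h P
    simpa using this
  have hdeg2 : ∀ E : J →₀ ℕ, expDeg deg (2 • E) = 2 * expDeg deg E := fun E => by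
    rw [two_nsmul, expDeg_add, two_mul]
  -- The coefficient vanishes unless `D` is twice a vector `E`, so the error is a sum over `E` with
  -- degrees doubled. This produces the square-root saving.
  set ab : (J →₀ ℕ) → ℝ := fun D => |D.prod fun _ d => sqCoeff d| * w (expDeg deg D)
  have hsupp : Function.support ab ⊆ Set.range fun E : J →₀ ℕ => 2 • E := by
    intro D hD
    have : (D.prod fun _ d => sqCoeff d) ≠ 0 := fun h => hD (by simp [ab, h])
    obtain ⟨E, hE⟩ := prod_sqCoeff_two_nsmul this
    exact ⟨E, hE⟩
  have hcomp : ∀ E : J →₀ ℕ, ab (2 • E) ≤ w (2 * expDeg deg E) := fun E => by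
    simp only [ab, hdeg2]
    exact mul_le_of_le_one_left (hw0 _) (abs_prod_sqCoeff_le _)
  have hsw := H.summable_deg (w := fun m => w (2 * m)) (fun m => hw0 _) hs1
  have hsc : Summable fun E : J →₀ ℕ => ab (2 • E) :=
    Summable.of_nonneg_of_le (fun E => mul_nonneg (abs_nonneg _) (hw0 _)) hcomp hsw
  have hsab : Summable ab :=
    (hinj.summable_iff fun D hD => by_contra fun h => hD (hsupp h)).1 hsc
  have htab : ∑' D, ab D ≤ 8 * Fintype.card Γ * √q ^ e := by
    rw [← hinj.tsum_eq hsupp]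
    refine (hsc.tsum_le_tsum hcomp hsw).trans ?_
    refine (H.tsum_deg_le (w := fun m => w (2 * m)) (fun m => hw0 _) hs1).trans ?_
    calc 2 * (Fintype.card Γ : ℝ) * ∑' m : ℕ, q ^ m * w (2 * m)
        ≤ 2 * Fintype.card Γ * (4 * √q ^ e) := by gcongr
      _ = _ := by ring
  have hmain : Summable fun D : J →₀ ℕ =>
      (D.prod fun _ d => sqCoeff d) * (c * (q ^ e / q ^ expDeg deg D)) := by
    have := (summable_finsupp_prod (a := fun P d => sqCoeff d * ((q ^ deg P)⁻¹) ^ d)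
      (by simp [sqCoeff]) H.summable_sqCoeff_primes).mul_left (c * q ^ e)
    refine this.congr fun D => ?_
    rw [prod_sqCoeff_mul]; ring
  have hdiff : Summable fun D : J →₀ ℕ => (D.prod fun _ d => sqCoeff d) *
      (N D - c * (q ^ e / q ^ expDeg deg D)) := by
    refine Summable.of_norm_bounded hsab fun D => ?_
    rw [Real.norm_eq_abs, abs_mul]
    exact mul_le_mul_of_nonneg_left (hN D) (abs_nonneg _)
  have hNs : Summable fun D : J →₀ ℕ => (D.prod fun _ d => sqCoeff d) * N D :=
    (hdiff.add hmain).congr fun D => by ring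
  have hk : c * sqfreeDensity deg q * q ^ e =
      ∑' D : J →₀ ℕ, (D.prod fun _ d => sqCoeff d) * (c * (q ^ e / q ^ expDeg deg D)) := by
    rw [mul_right_comm, sqfreeDensity, ← tsum_mul_left]
    refine tsum_congr fun D => ?_
    rw [prod_sqCoeff_mul]; ring
  rw [hS, hk, ← hNs.tsum_sub hmain, ← Real.norm_eq_abs]
  refine (tsum_of_norm_bounded hsab.hasSum fun D => ?_).trans htab
  rw [← mul_sub, Real.norm_eq_abs, abs_mul]
  exact mul_le_mul_of_nonneg_left (hN D) (abs_nonneg _)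

end PrimeSystem
end AbelianCovers
-- Tuples of exponent vectors and the convergence of the coprimality sieve.
namespace AbelianCovers

/-- Replace the factors one at a time and bound the untouched ones by `M`. -/
theorem abs_prod_sub_prod_le {ι : Type*} [DecidableEq ι] (s : Finset ι) {x y M : ι → ℝ}
    (hx : ∀ i, |x i| ≤ M i) (hy : ∀ i, |y i| ≤ M i) :
    |∏ i ∈ s, x i - ∏ i ∈ s, y i| ≤ ∑ i ∈ s, |x i - y i| * ∏ j ∈ s.erase i, M j := by
  have hM : ∀ i, 0 ≤ M i := fun i => (abs_nonneg _).trans (hx i)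
  induction s using Finset.induction_on with
  | empty => simp
  | insert a s ha ih =>
    rw [Finset.prod_insert ha, Finset.prod_insert ha, Finset.sum_insert ha,
      Finset.erase_insert ha]
    have e1 : x a * ∏ i ∈ s, x i - y a * ∏ i ∈ s, y i =
        (x a - y a) * ∏ i ∈ s, x i + y a * (∏ i ∈ s, x i - ∏ i ∈ s, y i) := by ring
    rw [e1]
    refine (abs_add_le _ _).trans (add_le_add ?_ ?_)
    · rw [abs_mul, Finset.abs_prod]
      exact mul_le_mul_of_nonneg_left (Finset.prod_le_prod (fun _ _ => abs_nonneg _)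
        fun i _ => hx i) (abs_nonneg _)
    · rw [abs_mul]
      refine (mul_le_mul (hy a) ih (abs_nonneg _) (hM a)).trans (le_of_eq ?_)
      rw [Finset.mul_sum]
      refine Finset.sum_congr rfl fun i hi => ?_
      have hai : a ≠ i := fun h => ha (h ▸ hi)
      rw [Finset.erase_insert_of_ne hai, Finset.prod_insert (by simp [ha])]
      ring

section Tuples

variable {J ι : Type*} [Fintype ι]

/-- Exponent vectors with values in tuples are tuples of exponent vectors. -/
noncomputable def tupleEquiv (J ι : Type*) [Fintype ι] : (J →₀ (ι → ℕ)) ≃ (ι → J →₀ ℕ) where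
  toFun D i := D.mapRange (fun v => v i) rfl
  invFun φ := by
    classical
    exact Finsupp.onFinset (Finset.univ.biUnion fun i => (φ i).support) (fun P i => φ i P)
      fun P hP => by
        obtain ⟨i, hi⟩ := Function.ne_iff.1 hP
        exact Finset.mem_biUnion.2 ⟨i, Finset.mem_univ i, Finsupp.mem_support_iff.2 hi⟩
  left_inv D := by ext P i; simp
  right_inv φ := by ext i P; simp

@[simp]
theorem tupleEquiv_apply (D : J →₀ (ι → ℕ)) (i : ι) (P : J) : tupleEquiv J ι D i P = D P i := by
  simp [tupleEquiv]

theorem tupleEquiv_add (D E : J →₀ (ι → ℕ)) (i : ι) :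
    tupleEquiv J ι (D + E) i = tupleEquiv J ι D i + tupleEquiv J ι E i := by
  ext P; simp

theorem prod_tupleEquiv_prod {R : Type*} [CommMonoid R] {y : ι → J → ℕ → R}
    (hy : ∀ i P, y i P 0 = 1) (D : J →₀ (ι → ℕ)) :
    ∏ i, (tupleEquiv J ι D i).prod (y i) = D.prod fun P d => ∏ i, y i P (d i) := by
  rw [Finsupp.prod, Finset.prod_comm]
  refine Finset.prod_congr rfl fun i _ => ?_
  rw [Finsupp.prod_of_support_subset (s := D.support) _ ?_ _ fun P _ => hy i P]
  · simp
  · intro P hP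
    rw [Finsupp.mem_support_iff] at hP ⊢
    intro h
    simp [h] at hP

theorem prod_sum_ind (g : J →₀ (ι → ℕ)) [Decidable (∀ P, ∑ i, g P i ≤ 1)] :
    (g.prod fun _ v => if ∑ i, v i ≤ 1 then (1 : ℝ) else 0) =
      if ∀ P, ∑ i, g P i ≤ 1 then 1 else 0 := by
  by_cases h : ∀ P, ∑ i, g P i ≤ 1
  · rw [if_pos h]
    exact Finset.prod_eq_one fun P _ => by simp [h P]
  · rw [if_neg h]
    push Not at h
    obtain ⟨P, hP⟩ := h
    refine Finset.prod_eq_zero (Finsupp.mem_support_iff.2 fun h0 => ?_) (i := P)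
      (by simp [hP])
    simp [h0] at hP

theorem finite_tuples {A : ι → Set (J →₀ ℕ)} (hA : ∀ i, (A i).Finite) :
    {g : J →₀ (ι → ℕ) | ∀ i, tupleEquiv J ι g i ∈ A i}.Finite := by
  refine ((Set.Finite.pi' hA).preimage ((tupleEquiv J ι).injective.injOn)).subset fun g hg => hg

end Tuples

namespace PrimeSystem

variable {J Γ ι : Type*} [CommGroup Γ] [Fintype ι] [DecidableEq ι] {deg : J → ℕ} {cl : J → Γ}
  {q c : ℝ}

/-- By `crossCoeff_eq_zero` a contributing nonzero vector has two nonzero entries `i ≠ j`. One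
factor `w i P` and one factor `w j P` are kept and give convergence over the primes; the remaining
powers are bounded by powers of `1/2` and give convergence over `d`. -/
theorem summable_crossCoeff_primes [Fintype Γ] (H : PrimeSystem deg cl q c) {w : ι → J → ℝ}
    (h0 : ∀ i P, 0 ≤ w i P) (h1 : ∀ i P, w i P ≤ 1 / 2)
    (h2 : ∀ i j P, i ≠ j → w i P * w j P ≤ ((√q)⁻¹ ^ 3) ^ deg P) :
    Summable fun z : J × {d : ι → ℕ // d ≠ 0} =>
      |crossCoeff z.2.1 * ∏ i, w i z.1 ^ z.2.1 i| := by
  have s2 : Summable fun d : {d : ι → ℕ // d ≠ 0} => ∏ i, (1 / 2 : ℝ) ^ d.1 i :=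
    (summable_pi_prod (ι := ι) (a := fun _ n => (1 / 2 : ℝ) ^ n)
      fun _ => summable_geometric_two).comp_injective Subtype.val_injective
  have s3 := (H.summable_primes.mul_left (4 * ((Fintype.card ι : ℝ) + 1))).mul_of_nonneg s2
    (fun P => by positivity) (fun d => by positivity)
  refine Summable.of_nonneg_of_le (fun _ => abs_nonneg _) (fun z => ?_) s3
  obtain ⟨P, d, hd⟩ := z
  dsimp only
  obtain ⟨i, hi⟩ := Function.ne_iff.1 hd
  replace hi : d i ≠ 0 := hi
  by_cases hj : ∀ j, j ≠ i → d j = 0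
  · rw [crossCoeff_eq_zero hi hj, zero_mul, abs_zero]
    positivity
  · push Not at hj
    obtain ⟨j, hji, hj⟩ := hj
    have hf : ∀ l, w l P ^ d l ≤ (if d l = 0 then 1 else 2 * w l P) * (1 / 2) ^ d l := by
      intro l
      by_cases hl : d l = 0
      · simp [hl]
      · obtain ⟨m, hm⟩ := Nat.exists_eq_succ_of_ne_zero hl
        rw [if_neg hl, hm, Nat.succ_eq_add_one, pow_succ, pow_succ]
        have := pow_le_pow_left₀ (h0 l P) (h1 l P) m
        nlinarith [h0 l P]
    have hp : ∏ l, w l P ^ d l ≤ 4 * ((√q)⁻¹ ^ 3) ^ deg P * ∏ l, (1 / 2 : ℝ) ^ d l := by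
      refine (Finset.prod_le_prod (fun l _ => pow_nonneg (h0 l P) _) fun l _ => hf l).trans ?_
      rw [Finset.prod_mul_distrib]
      refine mul_le_mul_of_nonneg_right ?_ (by positivity)
      rw [← Finset.mul_prod_erase _ _ (Finset.mem_univ i),
        ← Finset.mul_prod_erase _ _ (Finset.mem_erase.2 ⟨hji, Finset.mem_univ j⟩),
        if_neg hi, if_neg hj]
      have hr : ∏ l ∈ (Finset.univ.erase i).erase j, (if d l = 0 then 1 else 2 * w l P) ≤ 1 := by
        refine Finset.prod_le_one (fun l _ => ?_) fun l _ => ?_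
        · split_ifs
          · exact zero_le_one
          · exact mul_nonneg zero_le_two (h0 l P)
        · split_ifs
          · exact le_rfl
          · linarith [h1 l P]
      have h3 := h2 i j P hji.symm
      have h4 := mul_nonneg (h0 i P) (h0 j P)
      calc 2 * w i P * (2 * w j P * ∏ l ∈ (Finset.univ.erase i).erase j,
            (if d l = 0 then 1 else 2 * w l P))
          = 4 * (w i P * w j P) * ∏ l ∈ (Finset.univ.erase i).erase j,
            (if d l = 0 then 1 else 2 * w l P) := by ring
        _ ≤ 4 * (w i P * w j P) * 1 := mul_le_mul_of_nonneg_left hr (by positivity)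
        _ ≤ _ := by linarith
    rw [abs_mul, abs_of_nonneg (Finset.prod_nonneg fun l _ => pow_nonneg (h0 l P) _)]
    refine (mul_le_mul (abs_crossCoeff_le d) hp
      (Finset.prod_nonneg fun l _ => pow_nonneg (h0 l P) _) (by positivity)).trans (le_of_eq ?_)
    ring

theorem inv_sqrt_pow_deg_le [Fintype Γ] (H : PrimeSystem deg cl q c) (P : J) :
    ((√q)⁻¹) ^ deg P ≤ 1 / 2 := by
  have h1 : ((√q)⁻¹) ^ deg P ≤ ((√q)⁻¹) ^ 2 :=
    pow_le_pow_of_le_one (by positivity) (inv_le_one_of_one_le₀ H.one_lt_sqrt.le) (H.two_le_deg P)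
  refine h1.trans ?_
  rw [inv_pow, H.sqrt_sq, one_div]
  exact inv_anti₀ two_pos H.two_le_q

theorem inv_pow_deg_eq (H : PrimeSystem deg cl q c) (m : ℕ) :
    (q ^ m)⁻¹ = ((√q)⁻¹ ^ m) ^ 2 := by
  rw [← H.sqrt_pow, ← inv_pow, ← pow_mul, mul_comm]

theorem summable_crossCoeff_main [Fintype Γ] (H : PrimeSystem deg cl q c) :
    Summable fun z : J × {d : ι → ℕ // d ≠ 0} =>
      |crossCoeff z.2.1 * ∏ i, (q ^ deg z.1)⁻¹ ^ z.2.1 i| := by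
  have hq := H.two_le_q
  refine H.summable_crossCoeff_primes (w := fun _ P => (q ^ deg P)⁻¹) (fun _ P => by positivity)
    (fun _ P => ?_) (fun _ _ P _ => ?_)
  · have h1 := H.inv_sqrt_pow_deg_le P
    have h2 : 0 ≤ (√q)⁻¹ ^ deg P := by positivity
    rw [H.inv_pow_deg_eq]
    nlinarith
  · rw [H.inv_pow_deg_eq, ← pow_mul, ← pow_mul, ← pow_add]
    exact pow_le_pow_of_le_one (by positivity) (inv_le_one_of_one_le₀ H.one_lt_sqrt.le) (by omega)

/-- The weight of the error term attached to the index `i`. -/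
noncomputable def errWeight (q : ℝ) (deg : J → ℕ) (i j : ι) (P : J) : ℝ :=
  if j = i then (√q)⁻¹ ^ deg P else (q ^ deg P)⁻¹

/-- Replacing the `i`-th count by its main term weakens only the `i`-th weight to `q ^ (-deg P /
2)`. Paired with a full weight at a second index this still yields `q ^ (-3/2 deg P)`. -/
theorem summable_crossCoeff_err [Fintype Γ] (H : PrimeSystem deg cl q c) (i : ι) :
    Summable fun z : J × {d : ι → ℕ // d ≠ 0} =>
      |crossCoeff z.2.1 * ∏ j, errWeight q deg i j z.1 ^ z.2.1 j| := by
  have hq := H.two_le_q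
  have hle : ∀ P, (q ^ deg P)⁻¹ ≤ (√q)⁻¹ ^ deg P := fun P => by
    have h1 := H.inv_sqrt_pow_deg_le P
    have h2 : 0 ≤ (√q)⁻¹ ^ deg P := by positivity
    rw [H.inv_pow_deg_eq]
    nlinarith
  refine H.summable_crossCoeff_primes (fun j P => ?_) (fun j P => ?_) (fun j l P hjl => ?_)
  · unfold errWeight; split_ifs <;> positivity
  · unfold errWeight
    split_ifs
    · exact H.inv_sqrt_pow_deg_le P
    · exact (hle P).trans (H.inv_sqrt_pow_deg_le P)
  · have hA : (√q)⁻¹ ^ deg P * (q ^ deg P)⁻¹ = ((√q)⁻¹ ^ 3) ^ deg P := by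
      rw [H.inv_pow_deg_eq, ← pow_mul, ← pow_mul, ← pow_add]; congr 1; ring
    unfold errWeight
    by_cases h1 : j = i
    · have h2 : l ≠ i := fun h => hjl (h1.trans h.symm)
      rw [if_pos h1, if_neg h2, hA]
    · rw [if_neg h1]
      rw [← hA, mul_comm]
      refine mul_le_mul_of_nonneg_right ?_ (by positivity)
      split_ifs
      · exact le_rfl
      · exact hle P

/-- The tuples of exponent vectors whose sum is squarefree, of given degrees and classes. -/
def sqfreeTuples (deg : J → ℕ) (cl : J → Γ) (e : ι → ℕ) (a : ι → Γ) : Set (J →₀ (ι → ℕ)) :=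
  {g | (∀ P, ∑ i, g P i ≤ 1) ∧ ∀ i, expDeg deg (tupleEquiv J ι g i) = e i ∧
    expCls cl (tupleEquiv J ι g i) = a i}

/-- Counting pairwise coprime squarefree tuples by a convolution with squarefree counts. -/
theorem ncard_sqfreeTuples_eq [Fintype Γ] (H : PrimeSystem deg cl q c) (e : ι → ℕ) (a : ι → Γ) :
    ((sqfreeTuples deg cl e a).ncard : ℝ) = ∑' D : J →₀ (ι → ℕ), (D.prod fun _ d => crossCoeff d) *
      ∏ i, if expDeg deg (tupleEquiv J ι D i) ≤ e i then
        ((sqfreeSet deg cl (e i - expDeg deg (tupleEquiv J ι D i))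
          (a i * (expCls cl (tupleEquiv J ι D i))⁻¹)).ncard : ℝ) else 0 := by
  classical
  have hUf : {g : J →₀ (ι → ℕ) | ∀ i, expDeg deg (tupleEquiv J ι g i) = e i ∧
      expCls cl (tupleEquiv J ι g i) = a i}.Finite := finite_tuples fun i => H.finite (e i) (a i)
  have hBf : {g : J →₀ (ι → ℕ) | ∀ i, expDeg deg (tupleEquiv J ι g i) ≤ e i}.Finite :=
    finite_tuples fun i => H.finite_deg_le (e i)
  set U := hUf.toFinset
  set B := hBf.toFinset
  have hU : ∀ g, g ∈ U ↔ ∀ i, expDeg deg (tupleEquiv J ι g i) = e i ∧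
      expCls cl (tupleEquiv J ι g i) = a i := fun g => by simp [U]
  have hB' : ∀ g, g ∈ B ↔ ∀ i, expDeg deg (tupleEquiv J ι g i) ≤ e i := fun g => by simp [B]
  have hB : ∀ D E, D + E ∈ U → D ∈ B := by
    intro D E h
    rw [hU] at h
    rw [hB']
    intro i
    have := (h i).1
    rw [tupleEquiv_add, expDeg_add] at this
    omega
  have h1 : ((sqfreeTuples deg cl e a).ncard : ℝ) =
      ∑ g ∈ U, g.prod fun _ v => if ∑ i, v i ≤ 1 then (1 : ℝ) else 0 := by
    simp only [prod_sum_ind]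
    rw [Finset.sum_boole, ← Set.ncard_coe_finset]
    congr 2
    ext g
    simp [sqfreeTuples, hU, and_comm]
  rw [h1, sum_prod_eq_sum_sum (b := crossCoeff) (s := fun v => ∏ i, sqfreeInd (v i))
    crossCoeff_zero (by simp [sqfreeInd]) sum_crossCoeff U B hB,
    tsum_eq_sum (s := B) fun D hD => ?_]
  · refine Finset.sum_congr rfl fun D hD => ?_
    congr 1
    rw [hB'] at hD
    rw [Finset.prod_congr rfl fun i _ => by rw [if_pos (hD i), H.ncard_sqfreeSet_eq],
      Finset.prod_univ_sum]
    refine Finset.sum_equiv (tupleEquiv J ι) (fun E => ?_) fun E _ => ?_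
    · simp only [Finset.mem_filter, hB', hU, tupleEquiv_add, expDeg_add, expCls_add,
        Fintype.mem_piFinset, Set.Finite.mem_toFinset, Set.mem_ofPred_eq, eq_mul_inv_iff_mul_eq]
      constructor
      · rintro ⟨_, h⟩ i
        refine ⟨by have := (h i).1; omega, by rw [mul_comm]; exact (h i).2⟩
      · intro h
        refine ⟨fun i => by have := (h i).1; omega, fun i => ⟨by have := (h i).1; have := hD i; omega,
          by rw [mul_comm]; exact (h i).2⟩⟩
    · exact (prod_tupleEquiv_prod (y := fun _ _ n => sqfreeInd n) (by simp [sqfreeInd]) E).symm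
  · rw [hB'] at hD
    push Not at hD
    obtain ⟨i, hi⟩ := hD
    rw [Finset.prod_eq_zero (Finset.mem_univ i), mul_zero]
    rw [if_neg (by omega)]

end PrimeSystem
end AbelianCovers
-- Equidistribution of pairwise coprime squarefree tuples.
namespace AbelianCovers
namespace PrimeSystem

variable {J Γ ι : Type*} [CommGroup Γ] [Fintype ι] [DecidableEq ι] {deg : J → ℕ} {cl : J → Γ}
  {q c : ℝ}

theorem prod_crossCoeff_mul (w : ι → J → ℝ) (D : J →₀ (ι → ℕ)) :
    (D.prod fun P d => crossCoeff d * ∏ i, w i P ^ d i) =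
      (D.prod fun _ d => crossCoeff d) * ∏ i, (tupleEquiv J ι D i).prod fun P n => w i P ^ n := by
  rw [prod_tupleEquiv_prod (by simp), ← Finsupp.prod_mul]

variable [Fintype Γ]

/-- The density of the pairwise coprime squarefree tuples. -/
theorem hasProd_tuple_density (H : PrimeSystem deg cl q c) :
    HasProd (fun P => (1 - (q ^ deg P)⁻¹) ^ Fintype.card ι * (1 + Fintype.card ι * (q ^ deg P)⁻¹))
      (sqfreeDensity deg q ^ Fintype.card ι *
        ∑' D : J →₀ (ι → ℕ), D.prod fun P d => crossCoeff d * ∏ i, (q ^ deg P)⁻¹ ^ d i) := by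
  have hq := H.two_le_q
  have h1 := H.hasProd_sqfreeDensity.map (powMonoidHom (Fintype.card ι))
    (continuous_pow (Fintype.card ι))
  have h2 := hasProd_tsum_finsupp_prod
    (a := fun P (d : ι → ℕ) => crossCoeff d * ∏ i, (q ^ deg P)⁻¹ ^ d i)
    (by simp [crossCoeff_zero]) H.summable_crossCoeff_main
  convert! h1.mul h2 using 1
  ext P
  have hx : (q ^ deg P)⁻¹ < 1 := by
    have h1 := H.inv_sqrt_pow_deg_le P
    have h2 : 0 ≤ (√q)⁻¹ ^ deg P := by positivity
    rw [H.inv_pow_deg_eq]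
    nlinarith
  have hx0 : 0 ≤ (q ^ deg P)⁻¹ := by positivity
  rw [tsum_crossCoeff hx0 hx]
  simp only [Function.comp_apply, powMonoidHom_apply]
  set x := (q ^ deg P)⁻¹
  have : 0 < 1 + x := by linarith
  -- The factor `(1 + x) ^ k` of the squarefree density cancels the denominator of
  -- `tsum_crossCoeff`.
  rw [show 1 - x ^ 2 = (1 - x) * (1 + x) by ring, mul_pow]
  field_simp

/-- Pairwise coprime squarefree tuples are equidistributed over the classes, with a square-root
error in the smallest degree. -/
theorem exists_abs_ncard_sqfreeTuples_sub_le (H : PrimeSystem deg cl q c) (ι : Type*) [Fintype ι] :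
    ∃ Λ : ℝ, HasProd (fun P => (1 - (q ^ deg P)⁻¹) ^ Fintype.card ι *
        (1 + Fintype.card ι * (q ^ deg P)⁻¹)) Λ ∧
      ∃ C : ℝ, 0 ≤ C ∧ ∀ (e : ι → ℕ) (a : ι → Γ),
        |((sqfreeTuples deg cl e a).ncard : ℝ) - c ^ Fintype.card ι * Λ * q ^ ∑ i, e i| ≤
          C * (q ^ ∑ i, e i) * ∑ i, (√q)⁻¹ ^ e i := by
  classical
  refine ⟨_, H.hasProd_tuple_density (ι := ι), ?_⟩
  have hq := H.two_le_q
  have hq0 : 0 < q := by linarith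
  have hr1 := H.one_lt_sqrt
  have hr0 : 0 < √q := by linarith
  have sq2 : ∀ m : ℕ, (√q ^ m) ^ 2 = q ^ m := fun m => by rw [← pow_mul, mul_comm, H.sqrt_pow]
  set k := Fintype.card ι
  set c' := c * sqfreeDensity deg q
  set B := 2 + |c'|
  -- The first summand is the squarefree error constant; the second covers `D` of degree beyond `e
  -- i`, where the count is replaced by `0` and the main term is the error.
  set C0 := 8 * (Fintype.card Γ : ℝ) + |c'|
  have hB1 : 1 ≤ B := by have := abs_nonneg c'; simp only [B]; linarith
  have hC0 : 0 ≤ C0 := by positivity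
  set R : ι → (J →₀ (ι → ℕ)) → ℝ := fun i D =>
    |D.prod fun P d => crossCoeff d * ∏ j, errWeight q deg i j P ^ d j|
  have hR : ∀ i, Summable (R i) := fun i => (summable_finsupp_prod
    (a := fun P d => crossCoeff d * ∏ j, errWeight q deg i j P ^ d j)
    (by simp [crossCoeff_zero]) (H.summable_crossCoeff_err i)).abs
  have hR0 : ∀ i D, 0 ≤ R i D := fun i D => abs_nonneg _
  have hT0 : ∀ i, 0 ≤ ∑' D, R i D := fun i => tsum_nonneg (hR0 i)
  refine ⟨C0 * B ^ k * ∑ i, ∑' D, R i D,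
    mul_nonneg (by positivity) (Finset.sum_nonneg fun i _ => hT0 i), fun e a => ?_⟩
  set Y : (J →₀ (ι → ℕ)) → ι → ℝ := fun D i => (√q)⁻¹ ^ expDeg deg (tupleEquiv J ι D i)
  have hY : ∀ D i, 0 < Y D i := fun D i => by positivity
  have hRY : ∀ i D, R i D = |D.prod fun _ d => crossCoeff d| *
      (Y D i * ∏ j ∈ Finset.univ.erase i, Y D j ^ 2) := by
    intro i D
    simp only [R]
    rw [prod_crossCoeff_mul, abs_mul]
    congr 1
    rw [← Finset.mul_prod_erase _ _ (Finset.mem_univ i)]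
    have e1 : ((tupleEquiv J ι D i).prod fun P n => errWeight q deg i i P ^ n) = Y D i := by
      simp only [Y, pow_expDeg, errWeight, if_true]
    have e2 : ∀ j ∈ Finset.univ.erase i,
        ((tupleEquiv J ι D j).prod fun P n => errWeight q deg i j P ^ n) = Y D j ^ 2 := by
      intro j hj
      simp only [Y]
      rw [← H.inv_pow_deg_eq, ← inv_pow, pow_expDeg]
      simp only [errWeight, if_neg (Finset.ne_of_mem_erase hj), inv_pow]
    rw [e1, Finset.prod_congr rfl e2, abs_of_nonneg]
    exact mul_nonneg (hY D i).le (Finset.prod_nonneg fun j _ => sq_nonneg _)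
  set S : (J →₀ (ι → ℕ)) → ι → ℝ := fun D i =>
    if expDeg deg (tupleEquiv J ι D i) ≤ e i then
      ((sqfreeSet deg cl (e i - expDeg deg (tupleEquiv J ι D i))
        (a i * (expCls cl (tupleEquiv J ι D i))⁻¹)).ncard : ℝ) else 0
  have hcount := H.ncard_sqfreeTuples_eq e a
  -- Here `z²` is the size of the main term of the `i`-th count after removing `D`, and `z` the size
  -- of its error. Since `z ≤ 1` when `D` is too large, the same bounds hold for every `D`.
  set z : (J →₀ (ι → ℕ)) → ι → ℝ := fun D i => √q ^ e i * Y D i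
  have hz : ∀ D i, 0 < z D i := fun D i => mul_pos (pow_pos hr0 _) (hY D i)
  have hzle : ∀ D i, expDeg deg (tupleEquiv J ι D i) ≤ e i →
      z D i = √q ^ (e i - expDeg deg (tupleEquiv J ι D i)) := fun D i h => by
    simp only [z, Y]
    rw [pow_sub₀ _ hr0.ne' h, inv_pow]
  have hzgt : ∀ D i, ¬ expDeg deg (tupleEquiv J ι D i) ≤ e i → z D i ≤ 1 := fun D i h => by
    simp only [z, Y]
    rw [inv_pow, ← div_eq_mul_inv, div_le_one (by positivity)]
    exact pow_le_pow_right₀ hr1.le (by omega)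
  have hS1 : ∀ D i, |S D i - c' * z D i ^ 2| ≤ C0 * z D i := by
    intro D i
    by_cases h : expDeg deg (tupleEquiv J ι D i) ≤ e i
    · simp only [S, if_pos h]
      rw [hzle D i h, ← pow_mul, mul_comm _ 2, H.sqrt_pow]
      refine (H.abs_ncard_sqfreeSet_sub_le _ _).trans ?_
      refine mul_le_mul_of_nonneg_right ?_ (by positivity)
      simp only [C0]; linarith [abs_nonneg c']
    · simp only [S, if_neg h]
      have h1 := hzgt D i h
      have h2 := hz D i
      rw [zero_sub, abs_neg, abs_mul, abs_of_nonneg (sq_nonneg (z D i))]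
      have h3 : z D i ^ 2 ≤ z D i := by nlinarith
      have h4 : |c'| ≤ C0 := by
        simp only [C0]
        have : (0:ℝ) ≤ Fintype.card Γ := Nat.cast_nonneg _
        linarith
      exact mul_le_mul h4 h3 (sq_nonneg _) hC0
  have hS2 : ∀ D i, |S D i| ≤ B * z D i ^ 2 := by
    intro D i
    by_cases h : expDeg deg (tupleEquiv J ι D i) ≤ e i
    · simp only [S, if_pos h]
      rw [hzle D i h, ← pow_mul, mul_comm _ 2, H.sqrt_pow, abs_of_nonneg (Nat.cast_nonneg _)]
      refine (H.ncard_sqfreeSet_le _ _).trans ?_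
      refine mul_le_mul_of_nonneg_right ?_ (by positivity)
      simp only [B]; linarith [abs_nonneg c']
    · simp only [S, if_neg h, abs_zero]
      positivity
  have hS3 : ∀ D i, |c' * z D i ^ 2| ≤ B * z D i ^ 2 := by
    intro D i
    rw [abs_mul, abs_of_nonneg (sq_nonneg (z D i))]
    refine mul_le_mul_of_nonneg_right ?_ (sq_nonneg _)
    simp only [B]; linarith
  have hprod : ∀ D, |∏ i, S D i - ∏ i, c' * z D i ^ 2| ≤
      ∑ i, C0 * B ^ k * (q ^ (∑ i, e i) * (√q)⁻¹ ^ e i) *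
        (Y D i * ∏ j ∈ Finset.univ.erase i, Y D j ^ 2) := by
    intro D
    refine (abs_prod_sub_prod_le Finset.univ (hS2 D) (hS3 D)).trans
      (Finset.sum_le_sum fun i _ => ?_)
    have h1 : ∏ j ∈ Finset.univ.erase i, B * z D j ^ 2 ≤
        B ^ k * ∏ j ∈ Finset.univ.erase i, z D j ^ 2 := by
      rw [Finset.prod_mul_distrib, Finset.prod_const]
      refine mul_le_mul_of_nonneg_right (pow_le_pow_right₀ hB1 ?_)
        (Finset.prod_nonneg fun j _ => sq_nonneg _)
      exact Finset.card_le_univ _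
    have h2 : z D i * ∏ j ∈ Finset.univ.erase i, z D j ^ 2 =
        (q ^ (∑ i, e i) * (√q)⁻¹ ^ e i) * (Y D i * ∏ j ∈ Finset.univ.erase i, Y D j ^ 2) := by
      simp only [z, mul_pow, Finset.prod_mul_distrib]
      have e1 : q ^ (∑ i, e i) * (√q)⁻¹ ^ e i =
          √q ^ e i * ∏ j ∈ Finset.univ.erase i, (√q ^ e j) ^ 2 := by
        rw [← Finset.add_sum_erase _ _ (Finset.mem_univ i), pow_add, ← Finset.prod_pow_eq_pow_sum]
        simp only [sq2]
        rw [← sq2 (e i), inv_pow]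
        field_simp
      rw [e1]; ring
    calc |S D i - c' * z D i ^ 2| * ∏ j ∈ Finset.univ.erase i, B * z D j ^ 2
        ≤ (C0 * z D i) * (B ^ k * ∏ j ∈ Finset.univ.erase i, z D j ^ 2) :=
          mul_le_mul (hS1 D i) h1 (Finset.prod_nonneg fun j _ => by positivity)
            (mul_nonneg hC0 (hz D i).le)
      _ = C0 * B ^ k * (z D i * ∏ j ∈ Finset.univ.erase i, z D j ^ 2) := by ring
      _ = _ := by rw [h2]; ring
  set G : (J →₀ (ι → ℕ)) → ℝ := fun D =>
    ∑ i, C0 * B ^ k * (q ^ (∑ i, e i) * (√q)⁻¹ ^ e i) * R i D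
  have hG : Summable G := summable_sum fun i _ => (hR i).mul_left _
  have hdiffle : ∀ D : J →₀ (ι → ℕ), ‖(D.prod fun _ d => crossCoeff d) *
      (∏ i, S D i - ∏ i, c' * z D i ^ 2)‖ ≤ G D := by
    intro D
    rw [Real.norm_eq_abs, abs_mul]
    refine (mul_le_mul_of_nonneg_left (hprod D) (abs_nonneg _)).trans (le_of_eq ?_)
    rw [Finset.mul_sum]
    refine Finset.sum_congr rfl fun i _ => ?_
    rw [hRY]; ring
  have hdiff := Summable.of_norm_bounded hG hdiffle
  have hmainterm : ∀ D : J →₀ (ι → ℕ), (D.prod fun _ d => crossCoeff d) * ∏ i, c' * z D i ^ 2 =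
      c' ^ k * q ^ (∑ i, e i) *
        D.prod fun P d => crossCoeff d * ∏ i, (q ^ deg P)⁻¹ ^ d i := by
    intro D
    rw [prod_crossCoeff_mul]
    have e1 : ∀ i, ((tupleEquiv J ι D i).prod fun P n => (q ^ deg P)⁻¹ ^ n) = Y D i ^ 2 := by
      intro i
      simp only [Y]
      rw [← H.inv_pow_deg_eq, ← inv_pow, pow_expDeg]
      simp only [inv_pow]
    simp only [e1, z, mul_pow, Finset.prod_mul_distrib, Finset.prod_const]
    rw [← Finset.prod_pow_eq_pow_sum]
    simp only [Finset.card_univ, sq2]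
    ring
  have hmain : Summable fun D : J →₀ (ι → ℕ) =>
      (D.prod fun _ d => crossCoeff d) * ∏ i, c' * z D i ^ 2 := by
    simp only [hmainterm]
    exact (summable_finsupp_prod (a := fun P (d : ι → ℕ) => crossCoeff d * ∏ i, (q ^ deg P)⁻¹ ^ d i)
      (by simp [crossCoeff_zero]) H.summable_crossCoeff_main).mul_left _
  have hSs : Summable fun D : J →₀ (ι → ℕ) => (D.prod fun _ d => crossCoeff d) * ∏ i, S D i :=
    (hdiff.add hmain).congr fun D => by ring
  have hk : c ^ k * (sqfreeDensity deg q ^ k *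
        ∑' D : J →₀ (ι → ℕ), D.prod fun P d => crossCoeff d * ∏ i, (q ^ deg P)⁻¹ ^ d i) *
      q ^ ∑ i, e i =
      ∑' D : J →₀ (ι → ℕ), (D.prod fun _ d => crossCoeff d) * ∏ i, c' * z D i ^ 2 := by
    simp only [hmainterm, tsum_mul_left, c', mul_pow]
    ring
  rw [hcount, hk, ← hSs.tsum_sub hmain, ← Real.norm_eq_abs]
  refine (tsum_of_norm_bounded hG.hasSum fun D => ?_).trans ?_
  · rw [← mul_sub]; exact hdiffle D
  · simp only [G]
    rw [Summable.tsum_finsetSum fun i _ => (hR i).mul_left _]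
    simp only [tsum_mul_left]
    rw [Finset.mul_sum]
    refine Finset.sum_le_sum fun i _ => ?_
    have := Finset.single_le_sum (f := fun i => ∑' D, R i D) (fun i _ => hT0 i) (Finset.mem_univ i)
    calc C0 * B ^ k * (q ^ (∑ i, e i) * (√q)⁻¹ ^ e i) * ∑' D, R i D
        ≤ C0 * B ^ k * (q ^ (∑ i, e i) * (√q)⁻¹ ^ e i) * ∑ i, ∑' D, R i D :=
          mul_le_mul_of_nonneg_left this (by positivity)
      _ = _ := by ring

end PrimeSystem
end AbelianCovers
namespace AbelianCovers

/-! ### Monic polynomials as exponent vectors. -/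

section Factorization

variable {F J : Type*} [Field F]

/-- The monic polynomial with given exponents at the monic irreducibles `v P`. -/
noncomputable def polyOf (v : J → F[X]) (φ : J →₀ ℕ) : F[X] := φ.prod fun P n => v P ^ n

variable {v : J → F[X]}

theorem polyOf_add (φ ψ : J →₀ ℕ) : polyOf v (φ + ψ) = polyOf v φ * polyOf v ψ := by
  classical
  exact Finsupp.prod_add_index' (by simp) fun P m n => pow_add (v P) m n

theorem polyOf_monic (hm : ∀ P, (v P).Monic) (φ : J →₀ ℕ) : (polyOf v φ).Monic :=
  monic_prod_of_monic _ _ fun P _ => (hm P).pow _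

theorem natDegree_polyOf (hm : ∀ P, (v P).Monic) (φ : J →₀ ℕ) :
    (polyOf v φ).natDegree = expDeg (fun P => (v P).natDegree) φ := by
  rw [polyOf, Finsupp.prod, natDegree_prod_of_monic _ _ fun P _ => (hm P).pow _]
  exact Finset.sum_congr rfl fun P _ => (hm P).natDegree_pow _

theorem polyOf_eq_multiset_prod (φ : J →₀ ℕ) :
    polyOf v φ = (φ.toMultiset.map v).prod := by
  rw [Finsupp.toMultiset_map, Finsupp.prod_toMultiset, Finsupp.prod_mapDomain_index (by simp)
    fun _ m n => pow_add _ m n, polyOf]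

open Classical in
theorem normalizedFactors_polyOf (hm : ∀ P, (v P).Monic) (hi : ∀ P, Irreducible (v P))
    (φ : J →₀ ℕ) :
    UniqueFactorizationMonoid.normalizedFactors (polyOf v φ) = φ.toMultiset.map v := by
  rw [polyOf_eq_multiset_prod, UniqueFactorizationMonoid.normalizedFactors_prod_eq, Multiset.map_map]
  · exact Multiset.map_congr rfl fun P _ => (hm P).normalize_eq_self
  · intro a ha
    obtain ⟨P, _, rfl⟩ := Multiset.mem_map.1 ha
    exact hi P

theorem polyOf_injective (hv : Function.Injective v) (hm : ∀ P, (v P).Monic)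
    (hi : ∀ P, Irreducible (v P)) : Function.Injective (polyOf v) := by
  classical
  intro φ ψ h
  have h1 := congrArg UniqueFactorizationMonoid.normalizedFactors h
  rw [normalizedFactors_polyOf hm hi, normalizedFactors_polyOf hm hi] at h1
  exact Multiset.toFinsupp.symm.injective (Multiset.map_injective hv h1)

theorem squarefree_polyOf_iff (hv : Function.Injective v) (hm : ∀ P, (v P).Monic)
    (hi : ∀ P, Irreducible (v P)) (φ : J →₀ ℕ) :
    Squarefree (polyOf v φ) ↔ ∀ P, φ P ≤ 1 := by
  classical
  rw [UniqueFactorizationMonoid.squarefree_iff_nodup_normalizedFactors (polyOf_monic hm φ).ne_zero,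
    normalizedFactors_polyOf hm hi, Multiset.nodup_map_iff_of_injective hv,
    Multiset.nodup_iff_count_le_one]
  simp only [Finsupp.count_toMultiset]

theorem exists_polyOf_eq {f : F[X]} (hf : f.Monic)
    (h : ∀ P : F[X], P.Monic → Irreducible P → P ∣ f → ∃ Q, v Q = P) :
    ∃ φ, polyOf v φ = f := by
  classical
  have h1 : ∀ P ∈ UniqueFactorizationMonoid.normalizedFactors f, ∃ Q, v Q = P := fun P hP => by
    have hP' := UniqueFactorizationMonoid.irreducible_of_normalized_factor P hP
    refine h P ?_ hP' (UniqueFactorizationMonoid.dvd_of_mem_normalizedFactors hP)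
    rw [← UniqueFactorizationMonoid.normalize_normalized_factor P hP]
    exact monic_normalize hP'.ne_zero
  obtain ⟨m, hm⟩ : ∃ m : Multiset J, m.map v = UniqueFactorizationMonoid.normalizedFactors f := by
    choose u hu using h1
    refine ⟨(UniqueFactorizationMonoid.normalizedFactors f).attach.map fun P => u P.1 P.2, ?_⟩
    rw [Multiset.map_map]
    exact (Multiset.map_congr rfl fun P _ => hu P.1 P.2).trans (Multiset.attach_map_val _)
  refine ⟨Multiset.toFinsupp m, ?_⟩
  rw [polyOf_eq_multiset_prod, Multiset.toFinsupp_toMultiset, hm]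
  have h2 := UniqueFactorizationMonoid.prod_normalizedFactors hf.ne_zero
  refine eq_of_monic_of_associated ?_ hf h2
  rw [← hm]
  refine monic_multiset_prod_of_monic _ _ fun Q hQ => ?_
  have hQ' : v Q ∈ UniqueFactorizationMonoid.normalizedFactors f :=
    hm ▸ Multiset.mem_map_of_mem v hQ
  rw [← UniqueFactorizationMonoid.normalize_normalized_factor _ hQ']
  exact monic_normalize (UniqueFactorizationMonoid.irreducible_of_normalized_factor _ hQ').ne_zero

end Factorization

/-! ### Irreducible polynomials without roots and their values. -/

section RootlessPrimes

variable (F : Type*) [Field F]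

/-- The monic irreducible polynomials without a root in `F`. -/
abbrev RootlessPrime : Type _ := {P : F[X] // P.Monic ∧ Irreducible P ∧ ∀ x, P.eval x ≠ 0}

variable {F}

/-- The values of a polynomial without roots, as units. -/
def RootlessPrime.values (P : RootlessPrime F) : F → Fˣ := fun x => Units.mk0 _ (P.2.2.2 x)

theorem RootlessPrime.injective_val : Function.Injective (Subtype.val : RootlessPrime F → F[X]) :=
  Subtype.val_injective

/-- The polynomial attached to an exponent vector at the rootless primes. -/
noncomputable abbrev rootlessPoly (φ : RootlessPrime F →₀ ℕ) : F[X] :=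
  polyOf (fun P : RootlessPrime F => P.1) φ

theorem rootlessPoly_monic (φ : RootlessPrime F →₀ ℕ) : (rootlessPoly φ).Monic :=
  polyOf_monic (fun P => P.2.1) φ

theorem eval_rootlessPoly (φ : RootlessPrime F →₀ ℕ) (x : F) :
    (rootlessPoly φ).eval x = expCls RootlessPrime.values φ x := by
  rw [rootlessPoly, polyOf, expCls, Finsupp.prod, Finsupp.prod, eval_prod, Finset.prod_apply, Units.coe_prod]
  exact Finset.prod_congr rfl fun P _ => by simp [RootlessPrime.values]

theorem exists_rootlessPoly_eq {f : F[X]} (hf : f.Monic) (h : ∀ x, f.eval x ≠ 0) :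
    ∃ φ, rootlessPoly φ = f := by
  refine exists_polyOf_eq hf fun P hP hPi hPf => ⟨⟨P, hP, hPi, fun x hx => h x ?_⟩, rfl⟩
  exact eval_eq_zero_of_dvd_of_eval_eq_zero hPf hx

end RootlessPrimes

/-! ### Counting monic polynomials with prescribed values. -/

section Counting

variable (F : Type*) [Field F] [Fintype F]

theorem ncard_monic (m : ℕ) :
    {f : F[X] | f.Monic ∧ f.natDegree = m}.ncard = Fintype.card F ^ m := by
  rw [← Nat.card_coe_set_eq]
  have e := (monicEquivDegreeLT (R := F) m).trans (degreeLTEquiv F m).toEquiv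
  exact (Nat.card_congr e).trans (by simp)

theorem finite_monic (m : ℕ) : {f : F[X] | f.Monic ∧ f.natDegree = m}.Finite := by
  refine Set.finite_of_ncard_pos ?_
  rw [ncard_monic]
  exact pow_pos Fintype.card_pos m

variable {F}

/-- With `M = ∏ (X - x)` and `R` the interpolating polynomial of degree less than `q`, the solutions
are `M h + R` for `h` monic of degree `e - q`. -/
theorem ncard_monic_eval (e : ℕ) (γ : F → F) (he : Fintype.card F ≤ e) :
    {f : F[X] | f.Monic ∧ f.natDegree = e ∧ ∀ x, f.eval x = γ x}.ncard =
      Fintype.card F ^ (e - Fintype.card F) := by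
  classical
  set M : F[X] := Lagrange.nodal Finset.univ id
  have hM : M.Monic := Lagrange.nodal_monic
  have hMd : M.natDegree = Fintype.card F := by
    rw [Lagrange.natDegree_nodal, Finset.card_univ]
  have hMe : ∀ x, M.eval x = 0 := fun x =>
    Lagrange.eval_nodal_at_node (v := id) (Finset.mem_univ x)
  set R : F[X] := Lagrange.interpolate Finset.univ id γ
  have hinj : Set.InjOn (id : F → F) (Finset.univ : Finset F) := Function.injective_id.injOn
  have hRe : ∀ x, R.eval x = γ x := fun x =>
    Lagrange.eval_interpolate_at_node γ hinj (Finset.mem_univ x)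
  have hRd : R.degree < M.degree := by
    have := Lagrange.degree_interpolate_lt γ hinj
    rwa [Lagrange.degree_nodal]
  rw [← ncard_monic F (e - Fintype.card F)]
  symm
  refine Set.ncard_congr (fun h _ => M * h + R) ?_ ?_ ?_
  · rintro h ⟨hm, hd⟩
    have hMh : (M * h).Monic := hM.mul hm
    have hdeg : R.degree < (M * h).degree := by
      refine hRd.trans_le ?_
      rw [degree_mul]
      exact le_add_of_nonneg_right (zero_le_degree_iff.2 hm.ne_zero)
    refine ⟨hMh.add_of_left hdeg, ?_, fun x => by simp [hMe, hRe]⟩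
    rw [natDegree_add_eq_left_of_degree_lt hdeg, hM.natDegree_mul hm, hMd, hd]
    omega
  · intro h h' _ _ heq
    exact mul_left_cancel₀ hM.ne_zero (add_right_cancel heq)
  · rintro f ⟨hm, hd, hev⟩
    have hmod := modByMonic_add_div f M
    have hR : f %ₘ M = R := by
      refine Lagrange.eq_interpolate_of_eval_eq γ hinj ?_ fun x _ => ?_
      · have := degree_modByMonic_lt f hM
        rwa [Lagrange.degree_nodal] at this
      · have := congrArg (eval x) hmod
        simp only [eval_add, eval_mul, hMe, zero_mul, add_zero] at this
        rw [id, this, hev]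
    refine ⟨f /ₘ M, ⟨?_, ?_⟩, ?_⟩
    · rw [Monic, leadingCoeff_divByMonic_of_monic hM, hm.leadingCoeff]
      rw [degree_eq_natDegree hM.ne_zero, degree_eq_natDegree hm.ne_zero, hMd, hd]
      exact_mod_cast he
    · rw [natDegree_divByMonic f hM, hMd, hd]
    · rw [← hR, add_comm]; exact hmod

theorem ncard_monic_eval_le_one (e : ℕ) (γ : F → F) (he : e ≤ Fintype.card F) :
    {f : F[X] | f.Monic ∧ f.natDegree = e ∧ ∀ x, f.eval x = γ x}.ncard ≤ 1 := by
  classical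
  refine (Set.ncard_le_one ((finite_monic F e).subset fun f hf => ⟨hf.1, hf.2.1⟩)).2 ?_
  rintro f ⟨hf, hfd, hfe⟩ g ⟨hg, hgd, hge⟩
  refine eq_of_degree_sub_lt_of_eval_finset_eq (s := Finset.univ) ?_ fun x _ => by rw [hfe, hge]
  have : (f - g).degree < f.degree := degree_sub_lt_left (by
    rw [degree_eq_natDegree hf.ne_zero, degree_eq_natDegree hg.ne_zero, hfd, hgd]) hf.ne_zero
      (by rw [hf.leadingCoeff, hg.leadingCoeff])
  refine this.trans_le ?_
  rw [degree_eq_natDegree hf.ne_zero, hfd, Finset.card_univ]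
  exact_mod_cast he

/-- For `e ≥ q` the count is exactly the main term; for `e ≤ q` both lie in `[0, 1]`. -/
theorem abs_ncard_monic_eval_sub_le (e : ℕ) (γ : F → F) :
    |({f : F[X] | f.Monic ∧ f.natDegree = e ∧ ∀ x, f.eval x = γ x}.ncard : ℝ) -
      ((Fintype.card F : ℝ) ^ Fintype.card F)⁻¹ * (Fintype.card F : ℝ) ^ e| ≤ 1 := by
  have hq : (1:ℝ) ≤ Fintype.card F := by exact_mod_cast Fintype.card_pos
  have hq0 : (0:ℝ) < Fintype.card F := by linarith
  rcases le_total (Fintype.card F) e with he | he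
  · rw [ncard_monic_eval e γ he]
    push_cast
    rw [pow_sub₀ _ hq0.ne' he, mul_comm, sub_self, abs_zero]
    exact zero_le_one
  · have h1 : ({f : F[X] | f.Monic ∧ f.natDegree = e ∧ ∀ x, f.eval x = γ x}.ncard : ℝ) ≤ 1 := by
      exact_mod_cast ncard_monic_eval_le_one e γ he
    have h2 : ((Fintype.card F : ℝ) ^ Fintype.card F)⁻¹ * (Fintype.card F : ℝ) ^ e ≤ 1 := by
      rw [inv_mul_le_one₀ (by positivity)]
      exact pow_le_pow_right₀ hq he
    have h3 : 0 ≤ ((Fintype.card F : ℝ) ^ Fintype.card F)⁻¹ * (Fintype.card F : ℝ) ^ e := by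
      positivity
    rw [abs_le]
    constructor <;> linarith [Nat.cast_nonneg (α := ℝ)
      ({f : F[X] | f.Monic ∧ f.natDegree = e ∧ ∀ x, f.eval x = γ x}.ncard)]

/-- The class of a rootless polynomial is its vector of values in `F → Fˣ`. By unique factorization
exponent vectors correspond to monic polynomials with the given nonzero values. Primes have degree
at least two because a linear polynomial has a root. -/
theorem primeSystem : PrimeSystem (fun P : RootlessPrime F => P.1.natDegree) RootlessPrime.values
    (Fintype.card F) ((Fintype.card F : ℝ) ^ Fintype.card F)⁻¹ := by
  have hq : (1:ℝ) ≤ Fintype.card F := by exact_mod_cast Fintype.card_pos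
  have hset : ∀ e (γ : F → Fˣ), Set.BijOn rootlessPoly
      {φ | expDeg (fun P : RootlessPrime F => P.1.natDegree) φ = e ∧
        expCls RootlessPrime.values φ = γ}
      {f : F[X] | f.Monic ∧ f.natDegree = e ∧ ∀ x, f.eval x = γ x} := by
    intro e γ
    refine ⟨?_, (polyOf_injective RootlessPrime.injective_val (fun P => P.2.1)
      fun P => P.2.2.1).injOn, ?_⟩
    · rintro φ ⟨h1, h2⟩
      refine ⟨rootlessPoly_monic φ, ?_, fun x => by rw [eval_rootlessPoly, h2]⟩
      rw [natDegree_polyOf fun P => P.2.1, h1]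
    · rintro f ⟨h1, h2, h3⟩
      obtain ⟨φ, rfl⟩ := exists_rootlessPoly_eq h1 fun x => by rw [h3]; exact (γ x).ne_zero
      refine ⟨φ, ⟨?_, funext fun x => Units.ext ?_⟩, rfl⟩
      · rw [← h2, natDegree_polyOf fun P => P.2.1]
      · rw [← eval_rootlessPoly, h3]
  refine ⟨by exact_mod_cast Fintype.one_lt_card, fun P => ?_, fun e γ => ?_, by positivity,
    inv_le_one_of_one_le₀ (one_le_pow₀ hq), fun e γ => ?_⟩
  · by_contra h
    have h0 := P.2.2.1.natDegree_pos
    obtain ⟨x, hx⟩ := exists_root_of_degree_eq_one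
      ((degree_eq_iff_natDegree_eq_of_pos one_pos).2 (show P.1.natDegree = 1 by omega))
    exact P.2.2.2 x hx
  · refine Set.Finite.of_finite_image ?_ (hset e γ).injOn
    rw [(hset e γ).image_eq]
    exact (finite_monic F e).subset fun f hf => ⟨hf.1, hf.2.1⟩
  · have h1 := (hset e γ).injOn.ncard_image
    rw [(hset e γ).image_eq] at h1
    rw [← h1]
    exact abs_ncard_monic_eval_sub_le e fun x => (γ x : F)

end Counting

end AbelianCovers
namespace AbelianCovers

theorem multipliable_and_tprod_pos {I : Type*} {f : I → ℝ} (hf : Summable f)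
    (h : ∀ i, 0 < 1 + f i) : (Multipliable fun i => 1 + f i) ∧ 0 < ∏' i, (1 + f i) := by
  refine ⟨Real.multipliable_one_add_of_summable hf, ?_⟩
  rw [← Real.rexp_tsum_eq_tprod h (Real.summable_log_one_add_of_summable hf)]
  exact Real.exp_pos _

/-! ### The zeta value, the constant `L`, and the local densities. -/

section Constants

variable (F : Type*) [Field F]

/-- The monic irreducible polynomials. -/
abbrev MonicPrime : Type _ := {P : F[X] // P.Monic ∧ Irreducible P}

/-- A monic irreducible polynomial is linear or has no roots. -/
noncomputable def sumEquivMonicPrime : F ⊕ RootlessPrime F ≃ MonicPrime F :=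
  Equiv.ofBijective (Sum.elim (fun x => ⟨X - C x, monic_X_sub_C x, irreducible_X_sub_C x⟩)
    fun P => ⟨P.1, P.2.1, P.2.2.1⟩) (by
    constructor
    · rintro (x | P) (y | Q) h <;> simp only [Sum.elim_inl, Sum.elim_inr, Subtype.mk.injEq] at h
      · rw [C_injective (sub_right_injective h)]
      · exact absurd (by rw [← h]; simp) (Q.2.2.2 x)
      · exact absurd (by rw [h]; simp) (P.2.2.2 y)
      · rw [Subtype.ext h]
    · rintro ⟨P, hm, hi⟩
      by_cases h : ∃ x, P.eval x = 0
      · obtain ⟨x, hx⟩ := h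
        refine ⟨Sum.inl x, Subtype.ext ?_⟩
        exact eq_of_monic_of_associated (monic_X_sub_C x) hm
          ((irreducible_X_sub_C x).associated_of_dvd hi (dvd_iff_isRoot.2 hx))
      · push Not at h
        exact ⟨Sum.inr ⟨P, hm, hi, h⟩, rfl⟩)

variable [Fintype F]

theorem polyNorm_two_le (P : MonicPrime F) : 2 ≤ polyNorm F P.1 := by
  have h : (2:ℝ) ≤ Fintype.card F := by exact_mod_cast Fintype.one_lt_card
  refine h.trans ?_
  conv_lhs => rw [← pow_one (Fintype.card F : ℝ)]
  exact pow_le_pow_right₀ (by linarith) P.2.2.natDegree_pos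

theorem summable_inv_polyNorm_sq :
    Summable fun P : MonicPrime F => (polyNorm F P.1)⁻¹ ^ 2 := by
  classical
  have hp := primeSystem (F := F)
  rw [← (sumEquivMonicPrime F).summable_iff]
  have h1 : Summable fun P : RootlessPrime F => (polyNorm F P.1)⁻¹ ^ 2 := by
    refine Summable.of_nonneg_of_le (fun P => by positivity) (fun P => ?_) hp.summable_primes
    rw [polyNorm, hp.inv_pow_deg_eq, ← pow_mul, ← pow_mul, ← pow_mul]
    exact pow_le_pow_of_le_one (by positivity) (inv_le_one_of_one_le₀ hp.one_lt_sqrt.le) (by omega)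
  exact (HasSum.sum (hasSum_fintype _) h1.hasSum).summable

/-- Unique factorization matches monic polynomials with exponent vectors, so this is the Euler
product for the terms `|P| ^ (-2d)`, with geometric local sums. -/
theorem hasProd_zetaF :
    HasProd (fun P : MonicPrime F => (1 - (polyNorm F P.1)⁻¹ ^ 2)⁻¹) (zetaF F 2) := by
  set x : MonicPrime F → ℝ := fun P => (polyNorm F P.1)⁻¹ ^ 2
  have hx0 : ∀ P, 0 ≤ x P := fun P => sq_nonneg _
  have hx1 : ∀ P, x P ≤ 1 / 2 := fun P => by
    have h := polyNorm_two_le F P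
    have h1 : (polyNorm F P.1)⁻¹ ≤ 2⁻¹ := inv_anti₀ two_pos h
    have h2 : 0 ≤ (polyNorm F P.1)⁻¹ := by positivity
    simp only [x]; nlinarith
  have hs : Summable fun z : MonicPrime F × {d : ℕ // d ≠ 0} => |x z.1 ^ z.2.1| := by
    have h2 : Summable fun d : {d : ℕ // d ≠ 0} => (1 / 2 : ℝ) ^ d.1 :=
      summable_geometric_two.comp_injective Subtype.val_injective
    have h3 := ((summable_inv_polyNorm_sq F).mul_left 2).mul_of_nonneg h2
      (fun P => by positivity) (fun d => by positivity)
    refine Summable.of_nonneg_of_le (fun _ => abs_nonneg _) (fun z => ?_) h3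
    obtain ⟨P, d, hd⟩ := z
    obtain ⟨m, rfl⟩ := Nat.exists_eq_succ_of_ne_zero hd
    dsimp only
    rw [abs_of_nonneg (pow_nonneg (hx0 P) _), Nat.succ_eq_add_one, pow_succ (x P),
      pow_succ (1 / 2 : ℝ)]
    have := pow_le_pow_left₀ (hx0 P) (hx1 P) m
    change _ ≤ 2 * x P * _
    nlinarith [hx0 P]
  have h := hasProd_tsum_finsupp_prod (a := fun P d => x P ^ d) (by simp) hs
  have e1 : ∀ P, ∑' d, x P ^ d = (1 - x P)⁻¹ := fun P =>
    tsum_geometric_of_lt_one (hx0 P) (by linarith [hx1 P])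
  simp only [e1] at h
  convert! h using 1
  have hbij : Function.Bijective (fun φ : MonicPrime F →₀ ℕ =>
      (⟨polyOf (fun P : MonicPrime F => P.1) φ, polyOf_monic (fun P => P.2.1) φ⟩ :
        {f : F[X] // f.Monic})) := by
    constructor
    · intro φ ψ hφ
      exact polyOf_injective Subtype.val_injective (fun P : MonicPrime F => P.2.1)
        (fun P => P.2.2) (congrArg Subtype.val hφ)
    · rintro ⟨f, hf⟩
      obtain ⟨φ, hφ⟩ := exists_polyOf_eq (v := fun P : MonicPrime F => P.1) hf
        fun P h1 h2 _ => ⟨⟨P, h1, h2⟩, rfl⟩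
      exact ⟨φ, Subtype.ext hφ⟩
  rw [zetaF, ← (Equiv.ofBijective _ hbij).tsum_eq]
  refine tsum_congr fun φ => ?_
  have hq : (0:ℝ) < Fintype.card F := by exact_mod_cast Fintype.card_pos
  simp only [Equiv.ofBijective_apply, polyNorm, x]
  rw [natDegree_polyOf fun P : MonicPrime F => P.2.1, Real.rpow_neg (by positivity)]
  rw [show (2:ℝ) = ((2:ℕ):ℝ) by norm_num, Real.rpow_natCast, ← inv_pow, ← inv_pow, pow_right_comm,
    pow_expDeg]
  exact Finset.prod_congr rfl fun P _ => by
    dsimp only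
    simp only [← inv_pow, ← pow_mul]
    congr 1
    ring

theorem zetaF_pos : 0 < zetaF F 2 := by
  rw [← (hasProd_zetaF F).tprod_eq]
  have h1 : ∀ P : MonicPrime F, (polyNorm F P.1)⁻¹ ^ 2 ≤ 1 / 2 := fun P => by
    have h1 : (polyNorm F P.1)⁻¹ ≤ 2⁻¹ := inv_anti₀ two_pos (polyNorm_two_le F P)
    have h2 : 0 ≤ (polyNorm F P.1)⁻¹ := inv_nonneg.2 (by linarith [polyNorm_two_le F P])
    nlinarith
  have h := multipliable_and_tprod_pos (f := fun P : MonicPrime F => -(polyNorm F P.1)⁻¹ ^ 2)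
    (summable_inv_polyNorm_sq F).neg fun P => by linarith [h1 P]
  have h2 := h.1.hasProd.inv₀ h.2.ne'
  simp only [← sub_eq_add_neg] at h2 h
  rw [h2.tprod_eq]
  exact inv_pos.2 h.2

theorem multipliable_LConst_factor (j : ℕ) :
    (Multipliable fun P : MonicPrime F =>
      (1 - (j : ℝ) / ((polyNorm F P.1 + 1) * (polyNorm F P.1 + j)))) ∧
    0 < ∏' P : MonicPrime F, (1 - (j : ℝ) / ((polyNorm F P.1 + 1) * (polyNorm F P.1 + j))) := by
  simp only [sub_eq_add_neg]
  have hj : (0:ℝ) ≤ j := Nat.cast_nonneg j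
  refine multipliable_and_tprod_pos (Summable.neg ?_) fun P => ?_
  · refine Summable.of_nonneg_of_le (fun P => ?_) (fun P => ?_)
      ((summable_inv_polyNorm_sq F).mul_left (j : ℝ))
    · have := polyNorm_two_le F P; positivity
    · have hp := polyNorm_two_le F P
      have hp0 : 0 < polyNorm F P.1 := by linarith
      rw [inv_pow, ← div_eq_mul_inv]
      refine div_le_div_of_nonneg_left hj (by positivity) ?_
      nlinarith
  · have hp := polyNorm_two_le F P
    rw [← sub_eq_add_neg, sub_pos, div_lt_one (by positivity)]
    nlinarith

theorem LConst_pos (m : ℕ) : 0 < LConst F m :=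
  Finset.prod_pos fun j _ => (multipliable_LConst_factor F j).2

/-- Each factor equals `p (p + j + 1) / ((p + 1)(p + j))`, so the product telescopes. -/
theorem prod_LConst_factor {p : ℝ} (hp : 0 < p) (m : ℕ) :
    ∏ j ∈ Finset.Icc 1 m, (1 - (j : ℝ) / ((p + 1) * (p + j))) =
      p ^ m * (p + (m + 1)) / (p + 1) ^ (m + 1) := by
  induction m with
  | zero => simp; field_simp
  | succ m ih =>
    rw [Finset.prod_Icc_succ_top (by omega), ih]
    push_cast
    have h1 : p + (m + 1) ≠ 0 := by positivity
    have h2 : p + 1 ≠ 0 := by positivity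
    field_simp
    ring

/-- The product of the local densities over all primes. -/
theorem hasProd_local_density (k : ℕ) :
    HasProd (fun P : MonicPrime F => (1 - (polyNorm F P.1)⁻¹) ^ k * (1 + k * (polyNorm F P.1)⁻¹))
      (LConst F (k - 1) / zetaF F 2 ^ k) := by
  have h1 := ((hasProd_zetaF F).inv₀ (zetaF_pos F).ne').map (powMonoidHom k) (continuous_pow k)
  have h2 : HasProd (fun P : MonicPrime F => ∏ j ∈ Finset.Icc 1 (k - 1),
      (1 - (j : ℝ) / ((polyNorm F P.1 + 1) * (polyNorm F P.1 + j)))) (LConst F (k - 1)) :=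
    hasProd_prod fun j _ => (multipliable_LConst_factor F j).1.hasProd
  have h3 := h2.mul h1
  simp only [powMonoidHom_apply, inv_pow, ← div_eq_mul_inv] at h3
  convert h3 using 2 with P
  have hp := polyNorm_two_le F P
  set p := polyNorm F P.1
  have hp0 : 0 < p := by linarith
  simp only [Function.comp_apply, powMonoidHom_apply, inv_inv]
  rcases Nat.eq_zero_or_pos k with rfl | hk
  · simp
  · obtain ⟨m, rfl⟩ := Nat.exists_eq_add_of_lt hk
    simp only [zero_add, Nat.add_sub_cancel]
    rw [prod_LConst_factor hp0]
    have e : 1 - (p ^ 2)⁻¹ = (1 - p⁻¹) * ((p + 1) / p) := by field_simp; ring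
    rw [e, mul_pow, div_pow]
    push_cast
    generalize (1 - p⁻¹) ^ (m + 1) = A
    field_simp
    ring

/-- The same product, with the factors at the linear primes split off. -/
theorem local_density_eq (k : ℕ) {Λ : ℝ}
    (hΛ : HasProd (fun P : RootlessPrime F => (1 - ((Fintype.card F : ℝ) ^ P.1.natDegree)⁻¹) ^ k *
      (1 + k * ((Fintype.card F : ℝ) ^ P.1.natDegree)⁻¹)) Λ) :
    ((1 - (Fintype.card F : ℝ)⁻¹) ^ k * (1 + k * (Fintype.card F : ℝ)⁻¹)) ^ Fintype.card F * Λ =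
      LConst F (k - 1) / zetaF F 2 ^ k := by
  have h := (sumEquivMonicPrime F).hasProd_iff.2 (hasProd_local_density F k)
  refine HasProd.unique ?_ h
  refine HasProd.sum ?_ hΛ
  have h2 := hasProd_fintype (fun _ : F =>
    (1 - (Fintype.card F : ℝ)⁻¹) ^ k * (1 + k * (Fintype.card F : ℝ)⁻¹))
  rw [Finset.prod_const, Finset.card_univ] at h2
  convert h2 using 2 with x
  have hx : ((sumEquivMonicPrime F (Sum.inl x)).1).natDegree = 1 := natDegree_X_sub_C x
  simp only [Function.comp_apply, polyNorm, hx, pow_one]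

end Constants

end AbelianCovers
namespace AbelianCovers

/-! ### The group `R'`, its characters and its cyclic subgroups. -/

section GroupTheory

theorem fin_val_nsmul {m : ℕ} [NeZero m] (k : ℕ) (y : Fin m) :
    ((k • y : Fin m) : ℕ) = k * y % m := by
  induction k with
  | zero => simp
  | succ k ih => rw [succ_nsmul, Fin.val_add, ih, Nat.mod_add_mod, add_mul, one_mul]

/-- This is the origin of `φ(e²)` in the density: `φ(e)` generators of a cyclic group, times the `e`
elements of that group. -/
theorem totient_sq {e : ℕ} (he : 0 < e) : Nat.totient (e ^ 2) = Nat.totient e * e := by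
  have h := Nat.totient_gcd_mul_totient_mul e e
  rw [Nat.gcd_self, ← sq, mul_assoc] at h
  exact Nat.eq_of_mul_eq_mul_left (Nat.totient_pos.2 he) h

theorem card_generators_zmultiples {G : Type*} [AddCommGroup G] [Fintype G] (β : G) :
    {γ : G | AddSubgroup.zmultiples γ = AddSubgroup.zmultiples β}.ncard =
      Nat.totient (addOrderOf β) := by
  classical
  set H := AddSubgroup.zmultiples β
  have hcard : Fintype.card H = addOrderOf β := Fintype.card_zmultiples
  have h1 := IsAddCyclic.card_addOrderOf_eq_totient (α := H) (d := addOrderOf β) (by rw [hcard])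
  rw [← h1, ← Set.ncard_coe_finset, ← Set.ncard_image_of_injective _ Subtype.val_injective]
  congr 1
  ext γ
  simp only [Set.mem_ofPred_eq, Set.mem_image, Finset.coe_filter, Finset.mem_univ, true_and,
    Subtype.exists, exists_and_right, exists_eq_right]
  constructor
  · intro h
    refine ⟨h ▸ AddSubgroup.mem_zmultiples γ, ?_⟩
    rw [← AddSubgroup.addOrderOf_coe, ← Nat.card_zmultiples, h, Nat.card_zmultiples]
  · rintro ⟨hm, ho⟩
    refine AddSubgroup.eq_of_le_of_card_ge ((AddSubgroup.zmultiples_le).2 hm) ?_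
    rw [← AddSubgroup.addOrderOf_coe] at ho
    rw [Nat.card_zmultiples, Nat.card_zmultiples, ho]

theorem div_gcd_dvd_iff {m b k : ℕ} (hm : 0 < m) : m / Nat.gcd m b ∣ k ↔ m ∣ k * b := by
  rw [Nat.div_dvd_iff_dvd_mul (Nat.gcd_dvd_left m b) (Nat.gcd_pos_of_pos_left b hm)]
  constructor
  · intro h
    rw [mul_comm k]
    exact h.trans (Nat.mul_dvd_mul_right (Nat.gcd_dvd_right m b) k)
  · intro h
    rw [← Nat.gcd_mul_right]
    exact Nat.dvd_gcd (dvd_mul_right m k) (by rwa [mul_comm])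

variable {n : ℕ} {r : Fin n → ℕ}

theorem card_RPrime : Fintype.card (RPrime r) = groupOrder r := by
  simp [groupOrder]

theorem SOmega.s_dvd_ell (p : SOmega r) (j : Fin n) : p.s j ∣ p.ell :=
  Finset.dvd_lcm (Finset.mem_univ j)

theorem SOmega.ell_dvd (p : SOmega r) : p.ell ∣ Finset.univ.lcm r :=
  Finset.lcm_dvd fun j _ => (p.2.1 j).trans (Finset.dvd_lcm (Finset.mem_univ j))

theorem SOmega.ell_pos (p : SOmega r) : 0 < p.ell := by
  refine Nat.pos_of_ne_zero fun h => ?_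
  rw [SOmega.ell, Finset.lcm_eq_zero_iff] at h
  obtain ⟨j, _, hj⟩ := h
  have h1 := (p.2.2 j).1
  have h2 := (p.2.2 j).2.1
  change p.1.1 j = 0 at hj
  omega

theorem SOmega.cast_pairing (p : SOmega r) (v : Fin n → ℕ) :
    (p.pairing v : ZMod p.ell) = ∑ j, ((p.ell / p.s j * p.ω j : ℕ) : ZMod p.ell) * v j := by
  simp [SOmega.pairing]

/-- Since `s_j ∣ r_j`, the `j`-th coefficient of the pairing is killed by `r_j`, so the pairing
depends on its argument only modulo `r`. -/
theorem SOmega.cast_mul_r (p : SOmega r) (j : Fin n) :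
    ((p.ell / p.s j * p.ω j : ℕ) : ZMod p.ell) * (r j : ℕ) = 0 := by
  rw [← Nat.cast_mul, ZMod.natCast_eq_zero_iff, mul_right_comm]
  refine Dvd.dvd.mul_right ?_ _
  obtain ⟨t, ht⟩ := p.2.1 j
  change r j = p.s j * t at ht
  rw [ht, ← mul_assoc, Nat.div_mul_cancel (p.s_dvd_ell j)]
  exact dvd_mul_right _ _

theorem SOmega.cast_pairing_mod (p : SOmega r) (v : Fin n → ℕ) :
    (p.pairing (fun j => v j % r j) : ZMod p.ell) = p.pairing v := by
  rw [p.cast_pairing, p.cast_pairing]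
  refine Finset.sum_congr rfl fun j _ => ?_
  conv_rhs => rw [← Nat.mod_add_div (v j) (r j), Nat.cast_add, mul_add, Nat.cast_mul (r j),
    ← mul_assoc, p.cast_mul_r, zero_mul, add_zero]

variable [∀ j, NeZero (r j)]

/-- Each `r_j / gcd(r_j, β_j)` is the order of `β_j` modulo `r_j`, and orders in a product combine
by least common multiples. -/
theorem ramIndex_eq_addOrderOf (β : RPrime r) :
    ramIndex r (fun j => (β j : ℕ)) = addOrderOf β := by
  have key : ∀ k, ramIndex r (fun j => (β j : ℕ)) ∣ k ↔ addOrderOf β ∣ k := by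
    intro k
    rw [ramIndex, Finset.lcm_dvd_iff, addOrderOf_dvd_iff_nsmul_eq_zero, funext_iff]
    refine ⟨fun h j => ?_, fun h j _ => ?_⟩
    · refine Fin.ext ?_
      rw [Pi.smul_apply, fin_val_nsmul]
      exact Nat.mod_eq_zero_of_dvd
        ((div_gcd_dvd_iff (Nat.pos_of_neZero (r j))).1 (h j (Finset.mem_univ j)))
    · have h1 := congrArg Fin.val (h j)
      rw [Pi.smul_apply, fin_val_nsmul] at h1
      exact (div_gcd_dvd_iff (Nat.pos_of_neZero (r j))).2 (Nat.dvd_of_mod_eq_zero h1)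
  exact Nat.dvd_antisymm ((key _).2 dvd_rfl) ((key _).1 dvd_rfl)

theorem card_RIdx : Fintype.card (RIdx r) + 1 = groupOrder r := by
  classical
  have h : Fintype.card (RIdx r) = Fintype.card (RPrime r) - 1 := by
    have := Fintype.card_subtype_compl (fun α : RPrime r => α = 0)
    rw [Fintype.card_subtype_eq] at this
    exact this ▸ Fintype.card_congr (Equiv.refl _)
  rw [h, ← card_RPrime]
  have : 0 < Fintype.card (RPrime r) := Fintype.card_pos
  omega

/-- The pairing with `(s, ω)` as a character of the group `R'`. -/
def pairingHom (p : SOmega r) : RPrime r →+ ZMod p.ell where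
  toFun y := (p.pairing fun j => (y j : ℕ) : ℕ)
  map_zero' := by simp [SOmega.pairing]
  map_add' y z := by
    have h : (fun j => ((y + z) j : ℕ)) = fun j => ((y j : ℕ) + (z j : ℕ)) % r j :=
      funext fun j => Fin.val_add _ _
    rw [h, p.cast_pairing_mod, p.cast_pairing, p.cast_pairing, p.cast_pairing,
      ← Finset.sum_add_distrib]
    exact Finset.sum_congr rfl fun j _ => by push_cast; ring

theorem mem_ASet_iff (p : SOmega r) (β : RPrime r) : p ∈ ASet β ↔ pairingHom p β = 0 :=
  (ZMod.natCast_eq_zero_iff _ _).symm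

theorem RPrime.eq_sum_nsmul (y : RPrime r) :
    y = ∑ j, (y j : ℕ) • (Pi.single j 1 : RPrime r) := by
  ext i
  rw [Finset.sum_apply, Finset.sum_eq_single i]
  · rw [Pi.smul_apply, Pi.single_eq_same, fin_val_nsmul, Fin.val_one', Nat.mul_mod_mod, mul_one,
      Nat.mod_eq_of_lt (y i).2]
  · intro j _ hj
    rw [Pi.smul_apply, Pi.single_eq_of_ne hj.symm, smul_zero]
  · simp

/-- The pairs `(s, ω)` realize all characters of `R'`, so they separate points from cyclic
subgroups. -/
theorem mem_zmultiples_of_forall_pairing {β y : RPrime r}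
    (h : ∀ p : SOmega r, pairingHom p β = 0 → pairingHom p y = 0) :
    y ∈ AddSubgroup.zmultiples β := by
  by_contra hy
  set H := AddSubgroup.zmultiples β
  have hy' : (QuotientAddGroup.mk y : RPrime r ⧸ H) ≠ 0 := fun h0 =>
    hy ((QuotientAddGroup.eq_zero_iff y).1 h0)
  -- A character trivial on the subgroup generated by `β` but not at `y`. The orders of its values
  -- at the basis vectors supply `s`, and their exponents with respect to a common root of unity
  -- supply `ω`.
  obtain ⟨ψ, hψ⟩ := AddChar.exists_apply_ne_zero.2 hy'
  set Ψ : RPrime r → ℂ := fun z => ψ (QuotientAddGroup.mk z)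
  have hΨadd : ∀ a b, Ψ (a + b) = Ψ a * Ψ b := fun a b =>
    (congrArg ψ (QuotientAddGroup.mk_add H a b)).trans (ψ.map_add_eq_mul _ _)
  have hΨ0 : Ψ 0 = 1 := ψ.map_zero_eq_one
  have hΨn : ∀ (k : ℕ) a, Ψ (k • a) = Ψ a ^ k := fun k a => by
    induction k with
    | zero => simp [hΨ0]
    | succ k ih => rw [succ_nsmul, hΨadd, ih, pow_succ]
  have hΨs : ∀ (T : Finset (Fin n)) (a : Fin n → RPrime r), Ψ (∑ j ∈ T, a j) = ∏ j ∈ T, Ψ (a j) := by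
    intro T a
    induction T using Finset.induction_on with
    | empty => simp [hΨ0]
    | insert j T hj ih => rw [Finset.sum_insert hj, Finset.prod_insert hj, hΨadd, ih]
  set z : Fin n → ℂ := fun j => Ψ (Pi.single j 1)
  have hz : ∀ j, z j ^ r j = 1 := fun j => by
    simp only [z]
    have h1 : r j • (Pi.single j 1 : RPrime r) = 0 := by
      ext i
      by_cases hi : i = j
      · subst hi
        rw [Pi.smul_apply, fin_val_nsmul, Nat.mul_mod_right]
        rfl
      · rw [Pi.smul_apply, Pi.single_eq_of_ne hi, smul_zero, Pi.zero_apply]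
    rw [← hΨn, h1, hΨ0]
  have hs : ∀ j, orderOf (z j) ∣ r j := fun j => orderOf_dvd_of_pow_eq_one (hz j)
  have hs0 : ∀ j, 0 < orderOf (z j) := fun j => Nat.pos_of_dvd_of_pos (hs j) (Nat.pos_of_neZero _)
  set ell := Finset.univ.lcm fun j => orderOf (z j)
  have hell0 : ell ≠ 0 := by
    simp only [ell, Ne, Finset.lcm_eq_zero_iff]
    rintro ⟨j, _, hj⟩
    exact (hs0 j).ne' hj
  obtain ⟨ζ, hζ⟩ : ∃ ζ : ℂ, IsPrimitiveRoot ζ ell := ⟨_, Complex.isPrimitiveRoot_exp ell hell0⟩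
  have hdvd : ∀ j, orderOf (z j) ∣ ell := fun j => Finset.dvd_lcm (Finset.mem_univ j)
  have hω : ∀ j, ∃ w : ℕ, (1 ≤ w ∧ w ≤ orderOf (z j) ∧ w.Coprime (orderOf (z j))) ∧
      ζ ^ (ell / orderOf (z j) * w) = z j := by
    intro j
    have : NeZero (orderOf (z j)) := ⟨(hs0 j).ne'⟩
    have h1 : IsPrimitiveRoot (ζ ^ (ell / orderOf (z j))) (orderOf (z j)) :=
      hζ.pow (Nat.pos_of_ne_zero hell0) (Nat.div_mul_cancel (hdvd j)).symm
    obtain ⟨i, hi, hc, hi2⟩ := h1.isPrimitiveRoot_iff.1 (IsPrimitiveRoot.orderOf (z j))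
    rcases Nat.eq_zero_or_pos i with rfl | hpos
    -- Exponent `0` occurs only for order `1`; as `ω` must be at least `1`, it is replaced by `1`.
    · rw [Nat.coprime_zero_left] at hc
      refine ⟨1, ⟨le_rfl, hs0 j, Nat.coprime_one_left _⟩, ?_⟩
      rw [hc] at h1 ⊢
      rw [mul_one, IsPrimitiveRoot.one_right_iff.1 h1]
      exact (pow_zero _).symm.trans hi2
    · exact ⟨i, ⟨hpos, hi.le, hc⟩, by rw [pow_mul]; exact hi2⟩
  choose w hw hwz using hω
  let p : SOmega r := ⟨(fun j => orderOf (z j), w), hs, hw⟩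
  have hp : ∀ a : RPrime r, Ψ a = ζ ^ p.pairing fun j => (a j : ℕ) := by
    intro a
    conv_lhs => rw [RPrime.eq_sum_nsmul a]
    rw [hΨs, SOmega.pairing, ← Finset.prod_pow_eq_pow_sum]
    refine Finset.prod_congr rfl fun j _ => ?_
    rw [hΨn, pow_mul]
    congr 1
    exact (hwz j).symm
  have hpz : ∀ a : RPrime r, Ψ a = 1 ↔ pairingHom p a = 0 := fun a => by
    rw [hp, hζ.pow_eq_one_iff_dvd]
    exact (ZMod.natCast_eq_zero_iff _ _).symm
  have hβ : Ψ β = 1 := by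
    have : (QuotientAddGroup.mk β : RPrime r ⧸ H) = 0 :=
      (QuotientAddGroup.eq_zero_iff β).2 (AddSubgroup.mem_zmultiples β)
    simp only [Ψ, this, ψ.map_zero_eq_one]
  exact hψ ((hpz y).2 (h p ((hpz β).1 hβ)))

/-- `A_β` is the annihilator of the cyclic group of `β`, and by duality annihilators determine
subgroups. The classes `[β]` are thus the sets of generators of the cyclic subgroups. -/
theorem ASet_eq_iff (β β' : RPrime r) :
    ASet β = ASet β' ↔ AddSubgroup.zmultiples β = AddSubgroup.zmultiples β' := by
  have key : ∀ β β' : RPrime r, ASet β ⊆ ASet β' ↔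
      AddSubgroup.zmultiples β' ≤ AddSubgroup.zmultiples β := by
    intro β β'
    rw [AddSubgroup.zmultiples_le]
    constructor
    · intro h
      exact mem_zmultiples_of_forall_pairing fun p hp =>
        (mem_ASet_iff p β').1 (h ((mem_ASet_iff p β).2 hp))
    · intro h p hp
      obtain ⟨k, rfl⟩ := AddSubgroup.mem_zmultiples_iff.1 h
      rw [mem_ASet_iff] at hp ⊢
      rw [map_zsmul, hp, smul_zero]
  rw [Set.Subset.antisymm_iff, key, key, le_antisymm_iff, and_comm]

end GroupTheory

end AbelianCovers
namespace AbelianCovers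

/-! ### Discrete logarithms and the value families seen by the characters. -/

section Characters

variable (F : Type*) [Field F] [Fintype F]

/-- A generator of the multiplicative group of `F`. -/
noncomputable def unitGen : Fˣ := (IsCyclic.exists_generator (α := Fˣ)).choose

variable {F}

theorem exists_pow_unitGen (u : Fˣ) : ∃ k : ℕ, unitGen F ^ k = u :=
  mem_powers_iff_mem_zpowers.2 ((IsCyclic.exists_generator (α := Fˣ)).choose_spec u)

/-- A discrete logarithm. -/
noncomputable def dlog (u : Fˣ) : ℕ := (exists_pow_unitGen u).choose

theorem unitGen_pow_dlog (u : Fˣ) : unitGen F ^ dlog u = u := (exists_pow_unitGen u).choose_spec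

theorem orderOf_unitGen : orderOf (unitGen F) = Fintype.card F - 1 := by
  classical
  rw [unitGen, orderOf_eq_card_of_forall_mem_zpowers (IsCyclic.exists_generator (α := Fˣ)).choose_spec,
    Nat.card_eq_fintype_card, Fintype.card_units]

theorem dlog_modEq_iff (u : Fˣ) (k : ℕ) :
    unitGen F ^ k = u ↔ dlog u ≡ k [MOD Fintype.card F - 1] := by
  rw [← orderOf_unitGen, ← pow_eq_pow_iff_modEq, unitGen_pow_dlog, eq_comm]

theorem dlog_mul (u w : Fˣ) : dlog (u * w) ≡ dlog u + dlog w [MOD Fintype.card F - 1] := by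
  rw [← dlog_modEq_iff, pow_add, unitGen_pow_dlog, unitGen_pow_dlog]

theorem isPrimitiveRoot_apply_unitGen (χ : MulChar F ℂ) :
    IsPrimitiveRoot (χ (unitGen F : F)) (orderOf χ) := by
  have h : ∀ k, χ (unitGen F : F) ^ k = 1 ↔ χ ^ k = 1 := by
    intro k
    rw [← MulChar.pow_apply_coe]
    refine ⟨fun h => MulChar.ext fun u => ?_, fun h => by rw [h, MulChar.one_apply_coe]⟩
    rw [← unitGen_pow_dlog u, Units.val_pow_eq_pow_val, map_pow, map_pow, h, one_pow,
      MulChar.one_apply_coe, one_pow]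
  exact ⟨(h _).2 (pow_orderOf_eq_one χ), fun k hk => orderOf_dvd_of_pow_eq_one ((h k).1 hk)⟩

variable {n : ℕ} {r : Fin n → ℕ}

theorem card_sub_one_dvd (hq : ∀ j, Fintype.card F ≡ 1 [MOD r j]) (j : Fin n) :
    r j ∣ Fintype.card F - 1 :=
  (Nat.modEq_iff_dvd' Fintype.card_pos).1 (hq j).symm

theorem apply_prod_pow (χ : MulChar F ℂ) (p : SOmega r) (u : Fin n → Fˣ) :
    χ (∏ j, (u j : F) ^ (p.ell / p.s j * p.ω j)) =
      χ (unitGen F : F) ^ p.pairing fun j => dlog (u j) := by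
  rw [map_prod, SOmega.pairing, ← Finset.prod_pow_eq_pow_sum]
  refine Finset.prod_congr rfl fun j _ => ?_
  conv_lhs => rw [← unitGen_pow_dlog (u j)]
  rw [Units.val_pow_eq_pow_val, map_pow, map_pow, ← pow_mul, mul_comm]

open Classical in
/-- The family of character values attached to a ramification vector `β` and a vector of units. -/
noncomputable def stateValue (χ : ℕ → MulChar F ℂ) (β : RPrime r) (u : Fin n → Fˣ) (p : SOmega r) :
    ℂ :=
  if p ∈ ASet β then χ p.ell (∏ j, (u j : F) ^ (p.ell / p.s j * p.ω j)) else 0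

theorem stateValue_eq_zero_iff (χ : ℕ → MulChar F ℂ) (β : RPrime r) (u : Fin n → Fˣ)
    (p : SOmega r) : stateValue χ β u p = 0 ↔ p ∉ ASet β := by
  by_cases h : p ∈ ASet β
  · simp only [stateValue, h, if_true, apply_prod_pow, not_true, iff_false]
    refine pow_ne_zero _ ?_
    rw [← MulChar.coe_toUnitHom]
    exact Units.ne_zero _
  · simp [stateValue, h]

variable [∀ j, NeZero (r j)]

/-- The vector of discrete logarithms, in `R'`. -/
noncomputable def logVec (r : Fin n → ℕ) [∀ j, NeZero (r j)] (u : Fin n → Fˣ) : RPrime r :=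
  fun j => Fin.ofNat (r j) (dlog (u j))

theorem logVec_mul (hq : ∀ j, Fintype.card F ≡ 1 [MOD r j]) (u w : Fin n → Fˣ) :
    logVec r (u * w) = logVec r u + logVec r w := by
  ext j
  simp only [logVec, Pi.add_apply, Fin.val_add, Fin.val_ofNat, Pi.mul_apply, Nat.add_mod_mod,
    Nat.mod_add_mod]
  exact (dlog_mul (u j) (w j)).of_dvd (card_sub_one_dvd hq j)

theorem logVec_pow_unitGen (hq : ∀ j, Fintype.card F ≡ 1 [MOD r j]) (y : RPrime r) :
    logVec r (fun j => unitGen F ^ (y j : ℕ)) = y := by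
  ext j
  simp only [logVec, Fin.val_ofNat]
  have h := ((dlog_modEq_iff _ _).1 (rfl : unitGen F ^ (y j : ℕ) = _)).of_dvd
    (card_sub_one_dvd hq j)
  exact Eq.trans h (Nat.mod_eq_of_lt (y j).2)

/-- The discrete logarithm `(F^*)ⁿ → R'` as a homomorphism. -/
noncomputable def logHom (hq : ∀ j, Fintype.card F ≡ 1 [MOD r j]) :
    (Fin n → Fˣ) →* Multiplicative (RPrime r) :=
  MonoidHom.mk' (fun u => Multiplicative.ofAdd (logVec r u)) fun u w => by
    rw [logVec_mul hq, ofAdd_add]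

theorem logHom_surjective (hq : ∀ j, Fintype.card F ≡ 1 [MOD r j]) :
    Function.Surjective (logHom hq) := fun y =>
  ⟨_, congrArg Multiplicative.ofAdd (logVec_pow_unitGen hq (Multiplicative.toAdd y))⟩

theorem pairingHom_logVec (p : SOmega r) (u : Fin n → Fˣ) :
    pairingHom p (logVec r u) = (p.pairing fun j => dlog (u j) : ℕ) := by
  rw [← p.cast_pairing_mod]
  rfl

/-- The zeros recover `A_β`, hence the cyclic subgroup. The nonzero values recover the logarithm
paired with all characters trivial on that subgroup, hence the logarithm modulo it. -/
theorem stateValue_eq_iff {χ : ℕ → MulChar F ℂ}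
    (hχ : ∀ m, m ∣ Finset.univ.lcm r → orderOf (χ m) = m) (β β' : RPrime r) (u u' : Fin n → Fˣ) :
    stateValue χ β u = stateValue χ β' u' ↔
      AddSubgroup.zmultiples β = AddSubgroup.zmultiples β' ∧
        logVec r u - logVec r u' ∈ AddSubgroup.zmultiples β := by
  have key : ∀ p : SOmega r, χ p.ell (∏ j, (u j : F) ^ (p.ell / p.s j * p.ω j)) =
      χ p.ell (∏ j, (u' j : F) ^ (p.ell / p.s j * p.ω j)) ↔
        pairingHom p (logVec r u - logVec r u') = 0 := by
    intro p
    have hp := isPrimitiveRoot_apply_unitGen (χ p.ell)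
    rw [hχ _ p.ell_dvd] at hp
    rw [apply_prod_pow, apply_prod_pow, map_sub, sub_eq_zero, pairingHom_logVec, pairingHom_logVec,
      ZMod.natCast_eq_natCast_iff]
    have hfin : IsOfFinOrder (χ p.ell (unitGen F : F)) :=
      isOfFinOrder_iff_pow_eq_one.2 ⟨p.ell, p.ell_pos, hp.pow_eq_one⟩
    rw [hfin.pow_eq_pow_iff_modEq, ← hp.eq_orderOf]
  rw [← ASet_eq_iff]
  constructor
  · intro h
    have hA : ASet β = ASet β' := by
      ext p
      rw [← not_iff_not, ← stateValue_eq_zero_iff χ β u, ← stateValue_eq_zero_iff χ β' u', h]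
    refine ⟨hA, mem_zmultiples_of_forall_pairing fun p hp => ?_⟩
    rw [← mem_ASet_iff] at hp
    have h1 := congrFun h p
    simp only [stateValue, ← hA, hp, if_true] at h1
    exact (key p).1 h1
  · rintro ⟨hA, hm⟩
    ext p
    by_cases hp : p ∈ ASet β
    · simp only [stateValue, ← hA, hp, if_true]
      rw [key]
      obtain ⟨k, hk⟩ := AddSubgroup.mem_zmultiples_iff.1 hm
      rw [← hk, map_zsmul, (mem_ASet_iff p β).1 hp, smul_zero]
    · rw [(stateValue_eq_zero_iff χ β u p).2 hp, (stateValue_eq_zero_iff χ β' u' p).2 (hA ▸ hp)]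

end Characters

end AbelianCovers
namespace AbelianCovers

/-! ### Splitting off the linear factors. -/

section Parametrization

variable {F : Type*} [Field F]

theorem squarefree_prod_iff {ι : Type*} [Fintype ι] (f : ι → F[X]) :
    Squarefree (∏ i, f i) ↔
      (∀ i, Squarefree (f i)) ∧ ∀ i j, i ≠ j → IsCoprime (f i) (f j) := by
  classical
  constructor
  · intro h
    refine ⟨fun i => h.squarefree_of_dvd (Finset.dvd_prod_of_mem f (Finset.mem_univ i)),
      fun i j hij => ?_⟩
    have h1 : f i * f j ∣ ∏ l, f l := by
      rw [← Finset.mul_prod_erase _ _ (Finset.mem_univ i)]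
      exact mul_dvd_mul_left _ (Finset.dvd_prod_of_mem f
        (Finset.mem_erase.2 ⟨hij.symm, Finset.mem_univ j⟩))
    exact (squarefree_mul_iff.1 (h.squarefree_of_dvd h1)).1.isCoprime
  · rintro ⟨h1, h2⟩
    exact Finset.squarefree_prod_of_pairwise_isCoprime
      (fun i _ j _ hij => (h2 i j hij).isRelPrime) fun i _ => h1 i

theorem eval_rootlessPoly_ne_zero (φ : RootlessPrime F →₀ ℕ) (x : F) :
    (rootlessPoly φ).eval x ≠ 0 := by
  rw [eval_rootlessPoly]; exact Units.ne_zero _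

variable {n : ℕ} {r : Fin n → ℕ} [∀ j, NeZero (r j)]

/-- The vector `b` is the ramification at infinity: `b = 0` matches no index of `R` and stands for
undiminished degrees, while `b = β` lowers the degree at `β`. This puts infinity on the same footing
as the finite points. -/
theorem mem_fullFamily_iff (d : RIdx r → ℕ) (cf : (Fin n → Fˣ) × (RIdx r → F[X])) :
    cf ∈ fullFamily F d ↔ (∀ α, (cf.2 α).Monic) ∧ Squarefree (∏ α, cf.2 α) ∧
      ∃ b : RPrime r, ∀ α : RIdx r, (cf.2 α).natDegree + (if b = α.1 then 1 else 0) = d α := by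
  obtain ⟨c, f⟩ := cf
  rw [squarefree_prod_iff]
  simp only [fullFamily, Set.mem_ofPred_eq, Set.mem_union, Set.mem_iUnion, tuples, tuplesDrop]
  constructor
  · rintro (⟨h1, h2⟩ | ⟨β, h1, h2, h3, h4⟩)
    · refine ⟨fun α => (h1 α).1, ⟨fun α => (h1 α).2.1, h2⟩, 0, fun α => ?_⟩
      rw [if_neg (Ne.symm α.2), (h1 α).2.2, add_zero]
    · refine ⟨fun α => (h1 α).1, ⟨fun α => (h1 α).2, h4⟩, β.1, fun α => ?_⟩
      by_cases h : α = β
      · rw [h, if_pos rfl, h2]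
      · rw [if_neg fun h' => h (Subtype.ext h'.symm), h3 α h, add_zero]
  · rintro ⟨h1, ⟨h2, h3⟩, b, h4⟩
    by_cases hb : b = 0
    · left
      refine ⟨fun α => ⟨h1 α, h2 α, ?_⟩, h3⟩
      have := h4 α
      rwa [if_neg fun h => α.2 (h.symm.trans hb), add_zero] at this
    · right
      refine ⟨⟨b, hb⟩, fun α => ⟨h1 α, h2 α⟩, ?_, fun α hα => ?_, h3⟩
      · simpa using h4 ⟨b, hb⟩
      · have := h4 α
        rwa [if_neg fun h => hα (Subtype.ext h.symm), add_zero] at this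

variable [Fintype F]

/-- The product of the linear factors assigned to `α` by the ramification data `b`. -/
noncomputable def linPart (b : F → RPrime r) (α : RIdx r) : F[X] :=
  ∏ x, if b x = α.1 then X - C x else 1

theorem linPart_monic (b : F → RPrime r) (α : RIdx r) : (linPart b α).Monic :=
  monic_prod_of_monic _ _ fun x _ => by split_ifs; exacts [monic_X_sub_C x, monic_one]

theorem natDegree_linPart (b : F → RPrime r) (α : RIdx r) :
    (linPart b α).natDegree = ∑ x, if b x = α.1 then 1 else 0 := by
  rw [linPart, natDegree_prod_of_monic]
  · exact Finset.sum_congr rfl fun x _ => by split_ifs <;> simp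
  · exact fun x _ => by split_ifs; exacts [monic_X_sub_C x, monic_one]

/-- The value of `linPart b α` at `x` with the factor `X - x` removed, as a unit. -/
noncomputable def linUnit (b : F → RPrime r) (α : RIdx r) (x : F) : Fˣ := by
  classical
  exact ∏ y, if h : b y = α.1 ∧ x ≠ y then Units.mk0 (x - y) (sub_ne_zero.2 h.2) else 1

theorem eval_linPart_eq_zero {b : F → RPrime r} {α : RIdx r} {x : F} (h : b x = α.1) :
    (linPart b α).eval x = 0 := by
  rw [linPart, eval_prod]
  exact Finset.prod_eq_zero (Finset.mem_univ x) (by simp [h])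

theorem eval_linPart {b : F → RPrime r} {α : RIdx r} {x : F} (h : b x ≠ α.1) :
    (linPart b α).eval x = linUnit b α x := by
  classical
  rw [linPart, linUnit, eval_prod, Units.coe_prod]
  refine Finset.prod_congr rfl fun y _ => ?_
  by_cases hy : b y = α.1
  · have hxy : x ≠ y := fun hxy => h (hxy ▸ hy)
    simp [hy, hxy]
  · simp [hy]

variable (F r) in
/-- Exponent vectors at the rootless primes with values in the tuples indexed by `R`. -/
abbrev RootlessTuple : Type _ := RootlessPrime F →₀ (RIdx r → ℕ)

/-- The part at `α` of a tuple of exponent vectors. -/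
noncomputable abbrev RootlessTuple.part (g : RootlessTuple F r) (α : RIdx r) :
    RootlessPrime F →₀ ℕ := tupleEquiv (RootlessPrime F) (RIdx r) g α

/-- The polynomials with given ramification data and given rootless parts. -/
noncomputable def mkPoly (b : F → RPrime r) (g : RootlessTuple F r) (α : RIdx r) : F[X] :=
  linPart b α * rootlessPoly (g.part α)

theorem mkPoly_monic (b : F → RPrime r) (g : RootlessTuple F r) (α : RIdx r) :
    (mkPoly b g α).Monic := (linPart_monic b α).mul (rootlessPoly_monic _)

theorem eval_mkPoly_eq_zero_iff (b : F → RPrime r) (g : RootlessTuple F r) (α : RIdx r) (x : F) :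
    (mkPoly b g α).eval x = 0 ↔ b x = α.1 := by
  rw [mkPoly, eval_mul, mul_eq_zero, or_iff_left (eval_rootlessPoly_ne_zero _ x)]
  refine ⟨fun h => by_contra fun h' => ?_, eval_linPart_eq_zero⟩
  rw [eval_linPart h'] at h
  exact Units.ne_zero _ h

theorem natDegree_mkPoly (b : F → RPrime r) (g : RootlessTuple F r) (α : RIdx r) :
    (mkPoly b g α).natDegree = (∑ x, if b x = α.1 then 1 else 0) +
      expDeg (fun P : RootlessPrime F => P.1.natDegree) (g.part α) := by
  rw [mkPoly, (linPart_monic b α).natDegree_mul (rootlessPoly_monic _), natDegree_linPart,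
    natDegree_polyOf fun P : RootlessPrime F => P.2.1]

theorem squarefree_prod_mkPoly_iff (b : F → RPrime r) (g : RootlessTuple F r) :
    Squarefree (∏ α, mkPoly b g α) ↔ ∀ P, ∑ α, g P α ≤ 1 := by
  classical
  simp only [mkPoly, Finset.prod_mul_distrib]
  have e1 : ∏ α, rootlessPoly (g.part α) = rootlessPoly (∑ α, g.part α) := by
    have : ∀ T : Finset (RIdx r), ∏ α ∈ T, rootlessPoly (g.part α) =
        rootlessPoly (∑ α ∈ T, g.part α) := by
      intro T
      induction T using Finset.induction_on with
      | empty => simp [polyOf]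
      | insert α T hα ih =>
        rw [Finset.prod_insert hα, Finset.sum_insert hα, ih]
        exact (polyOf_add _ _).symm
    exact this _
  have e2 : ∏ α, linPart b α = ∏ x, if b x = 0 then 1 else X - C x := by
    simp only [linPart]
    rw [Finset.prod_comm]
    refine Finset.prod_congr rfl fun x _ => ?_
    by_cases hx : b x = 0
    · rw [if_pos hx]
      exact Finset.prod_eq_one fun α _ => if_neg fun h => α.2 (h.symm.trans hx)
    · rw [if_neg hx, Finset.prod_eq_single ⟨b x, hx⟩]
      · simp
      · intro α _ hα
        exact if_neg fun h => hα (Subtype.ext h.symm)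
      · simp
  rw [e1, e2, squarefree_mul_iff]
  have h1 : IsRelPrime (∏ x, if b x = 0 then (1 : F[X]) else X - C x)
      (rootlessPoly (∑ α, g.part α)) := by
    refine (IsCoprime.prod_left fun x _ => ?_).isRelPrime
    split_ifs
    · exact isCoprime_one_left
    · rw [(irreducible_X_sub_C x).coprime_iff_not_dvd, dvd_iff_isRoot]
      exact eval_rootlessPoly_ne_zero _ x
  have h2 : Squarefree (∏ x, if b x = 0 then (1 : F[X]) else X - C x) := by
    refine (squarefree_prod_iff _).2 ⟨fun x => ?_, fun x y hxy => ?_⟩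
    · split_ifs
      · exact squarefree_one
      · exact (irreducible_X_sub_C x).squarefree
    · have := pairwise_coprime_X_sub_C (Function.injective_id (α := F)) hxy
      split_ifs
      · exact isCoprime_one_left
      · exact isCoprime_one_left
      · exact isCoprime_one_right
      · exact this
  rw [and_iff_right h1, and_iff_right h2, squarefree_polyOf_iff RootlessPrime.injective_val
    (fun P => P.2.1) fun P => P.2.2.1]
  simp [Finsupp.finsetSum_apply]

/-- Every tuple of the full family comes from ramification data and rootless parts. -/
theorem exists_mkPoly_eq {f : RIdx r → F[X]} (hm : ∀ α, (f α).Monic)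
    (hs : Squarefree (∏ α, f α)) : ∃ b : F → RPrime r, ∃ g, mkPoly b g = f := by
  classical
  obtain ⟨hs1, hs2⟩ := (squarefree_prod_iff f).1 hs
  have huniq : ∀ x α β, (f α).eval x = 0 → (f β).eval x = 0 → α = β := by
    intro x α β hα hβ
    by_contra h
    obtain ⟨u, v, huv⟩ := hs2 α β h
    have := congrArg (eval x) huv
    simp [hα, hβ] at this
  -- The value `0` marks an unramified point; coprimality makes the other choice unique.
  set b : F → RPrime r := fun x => if h : ∃ α, (f α).eval x = 0 then h.choose.1 else 0
  have hb : ∀ x α, b x = α.1 ↔ (f α).eval x = 0 := by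
    intro x α
    by_cases h : ∃ α, (f α).eval x = 0
    · simp only [b, dif_pos h]
      refine ⟨fun h' => Subtype.ext h' ▸ h.choose_spec, fun h' => ?_⟩
      rw [huniq x _ _ h.choose_spec h']
    · simp only [b, dif_neg h]
      exact ⟨fun h' => absurd h'.symm α.2, fun h' => absurd ⟨α, h'⟩ h⟩
  have hdvd : ∀ α, linPart b α ∣ f α := by
    intro α
    refine Finset.prod_dvd_of_coprime (fun x _ y _ hxy => ?_) fun x _ => ?_
    · have := pairwise_coprime_X_sub_C (Function.injective_id (α := F)) hxy
      simp only [Function.onFun] at this ⊢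
      split_ifs
      · exact this
      · exact isCoprime_one_right
      · exact isCoprime_one_left
      · exact isCoprime_one_left
    · split_ifs with h
      · exact dvd_iff_isRoot.2 ((hb x α).1 h)
      · exact one_dvd _
  choose G hG using hdvd
  have hGm : ∀ α, (G α).Monic := fun α => by
    have := hm α
    rw [hG α] at this
    exact (linPart_monic b α).of_mul_monic_left this
  -- A root of the cofactor would be a double root of the squarefree `f α`.
  have hGe : ∀ α x, (G α).eval x ≠ 0 := by
    intro α x hx
    have h1 : b x = α.1 := (hb x α).2 (by rw [hG α, eval_mul, hx, mul_zero])
    have h2 : (X - C x) * (X - C x) ∣ f α := by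
      rw [hG α]
      exact mul_dvd_mul (dvd_iff_isRoot.2 (eval_linPart_eq_zero h1)) (dvd_iff_isRoot.2 hx)
    exact (irreducible_X_sub_C x).not_isUnit (hs1 α _ h2)
  choose φ hφ using fun α => exists_rootlessPoly_eq (hGm α) (hGe α)
  refine ⟨b, (tupleEquiv (RootlessPrime F) (RIdx r)).symm φ, funext fun α => ?_⟩
  rw [mkPoly, RootlessTuple.part, Equiv.apply_symm_apply, hφ, ← hG]

theorem mkPoly_injective {b b' : F → RPrime r} {g g' : RootlessTuple F r}
    (h : mkPoly b g = mkPoly b' g') : b = b' ∧ g = g' := by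
  have hb : b = b' := by
    funext x
    have key : ∀ α : RIdx r, b x = α.1 ↔ b' x = α.1 := fun α => by
      rw [← eval_mkPoly_eq_zero_iff b g, h, eval_mkPoly_eq_zero_iff]
    by_cases h0 : b x = 0
    · by_contra hne
      have h1 : b' x ≠ 0 := fun h' => hne (h0.trans h'.symm)
      exact hne ((key ⟨b' x, h1⟩).2 rfl)
    · exact ((key ⟨b x, h0⟩).1 rfl).symm
  subst hb
  refine ⟨rfl, (tupleEquiv (RootlessPrime F) (RIdx r)).injective (funext fun α => ?_)⟩
  refine polyOf_injective RootlessPrime.injective_val (fun P => P.2.1) (fun P => P.2.2.1) ?_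
  exact mul_left_cancel₀ (linPart_monic b α).ne_zero (congrFun h α)

end Parametrization

end AbelianCovers
namespace AbelianCovers

/-! ### Values of the characters at finite points and at infinity. -/

section Values

variable {F : Type*} [Field F] {n : ℕ} {r : Fin n → ℕ}

theorem apply_pow_mod {χ : MulChar F ℂ} {m : ℕ} (hχ : orderOf χ = m) (u : Fˣ) (k : ℕ) :
    χ ((u : F) ^ (k % m)) = χ (u : F) ^ k := by
  have h1 : χ (u : F) ^ m = 1 := by
    rw [← MulChar.pow_apply_coe, ← hχ, pow_orderOf_eq_one, MulChar.one_apply_coe]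
  rw [map_pow, ← pow_eq_pow_mod k h1]

theorem apply_leadCoeff {χ : MulChar F ℂ} {p : SOmega r} (hχ : orderOf χ = p.ell)
    (c : Fin n → Fˣ) :
    χ (leadCoeff c p) = χ (∏ j, (c j : F) ^ (p.ell / p.s j * p.ω j)) := by
  rw [leadCoeff, map_prod, map_prod]
  exact Finset.prod_congr rfl fun j _ => by rw [apply_pow_mod hχ, map_pow]

variable [∀ j, NeZero (r j)] [Fintype F]

/-- The unit vector that governs the values at a point: at infinity it is the vector of leading
coefficients, and at a finite point it is built from the units `a x α`. -/
noncomputable def pointUnit (c : Fin n → Fˣ) (b : Option F → RPrime r) (a : F → RIdx r → Fˣ) :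
    Option F → Fin n → Fˣ
  | none => c
  | some x => fun j => c j * ∏ α : RIdx r, (linUnit (fun z => b (some z)) α x * a x α) ^ (α.1 j : ℕ)

/-- The number of points of the projective line with ramification vector `α`. -/
def ramCount (b : Option F → RPrime r) (α : RIdx r) : ℕ := ∑ y, if b y = α.1 then 1 else 0

/-- The exponent of the polynomial vanishing at `x`, if there is one, is the pairing with `b(x)`
reduced modulo `ℓ(s)`. If it is nonzero the value is zero; otherwise that factor disappears and the
others contribute units. -/
theorem apply_valueAt_some {χ : ℕ → MulChar F ℂ}
    (hχ : ∀ m, m ∣ Finset.univ.lcm r → orderOf (χ m) = m) (c : Fin n → Fˣ)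
    (b : Option F → RPrime r) (g : RootlessTuple F r) (a : F → RIdx r → Fˣ)
    (ha : ∀ x α, a x α = expCls RootlessPrime.values (g.part α) x) (p : SOmega r) (x : F) :
    χ p.ell (valueAt c (mkPoly (fun z => b (some z)) g) p (OnePoint.some x)) =
      stateValue χ (b (some x)) (pointUnit c b a (some x)) p := by
  have hval : valueAt c (mkPoly (fun z => b (some z)) g) p (OnePoint.some x) =
      (FPoly c (mkPoly (fun z => b (some z)) g) p).eval x := rfl
  have hord := hχ _ p.ell_dvd
  rw [hval, FPoly, eval_mul, eval_C, eval_prod, map_mul, apply_leadCoeff hord, map_prod, map_prod]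
  by_cases hp : p ∈ ASet (b (some x))
  · have e1 : ∀ α : RIdx r, χ p.ell (eval x (mkPoly (fun z => b (some z)) g α ^
        ((p.pairing fun j => (α.1 j : ℕ)) % p.ell))) =
        χ p.ell ((linUnit (fun z => b (some z)) α x * a x α : Fˣ) : F) ^
          (p.pairing fun j => (α.1 j : ℕ)) := by
      intro α
      rw [eval_pow]
      by_cases hα : b (some x) = α.1
      -- The reduced exponent is `0`, so the vanishing factor contributes `0 ^ 0 = 1`; on the right
      -- the unit may therefore be arbitrary at this index.
      · have hd : p.ell ∣ p.pairing fun j => (α.1 j : ℕ) := hα ▸ hp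
        rw [Nat.mod_eq_zero_of_dvd hd, pow_zero, ← apply_pow_mod hord, Nat.mod_eq_zero_of_dvd hd,
          pow_zero]
      · rw [mkPoly, eval_mul, eval_linPart (b := fun z => b (some z)) hα, eval_rootlessPoly, ← ha, ← Units.val_mul,
          apply_pow_mod hord]
    rw [Finset.prod_congr rfl fun α _ => e1 α]
    simp only [stateValue, hp, if_true, pointUnit]
    simp only [map_prod, map_pow, Units.val_mul, Units.coe_prod, Units.val_pow_eq_pow_val, mul_pow,
      map_mul, Finset.prod_mul_distrib, SOmega.pairing, ← Finset.prod_pow_eq_pow_sum,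
      ← Finset.prod_pow, ← pow_mul]
    congr 1
    rw [Finset.prod_comm (γ := RIdx r), Finset.prod_comm (γ := RIdx r)]
    simp only [mul_comm]
  · rw [(stateValue_eq_zero_iff _ _ _ _).2 hp]
    have h0 : b (some x) ≠ 0 := by
      rintro h0
      rw [h0, mem_ASet_iff, map_zero] at hp
      exact hp rfl
    rw [Finset.prod_eq_zero (Finset.mem_univ (⟨b (some x), h0⟩ : RIdx r)), mul_zero]
    have hne : (p.pairing fun j => (b (some x) j : ℕ)) % p.ell ≠ 0 := fun h =>
      hp (Nat.dvd_of_mod_eq_zero h)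
    rw [eval_pow, (eval_mkPoly_eq_zero_iff _ g _ x).2 rfl, zero_pow hne]
    exact MulChar.map_zero _

/-- The congruences on `d` give `deg F_j ≡ -b_j` modulo `r_j`, so the divisibility condition at
infinity is membership in `A_b`. -/
theorem apply_valueAt_none {χ : ℕ → MulChar F ℂ}
    (hχ : ∀ m, m ∣ Finset.univ.lcm r → orderOf (χ m) = m) {d : RIdx r → ℕ}
    (hd : ∀ j, r j ∣ ∑ α : RIdx r, (α.1 j : ℕ) * d α) (c : Fin n → Fˣ) {f : RIdx r → F[X]}
    {b : RPrime r} (hf : ∀ α : RIdx r, (f α).natDegree + (if b = α.1 then 1 else 0) = d α)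
    (p : SOmega r) :
    χ p.ell (valueAt c f p OnePoint.infty) = stateValue χ b c p := by
  classical
  have hval : valueAt c f p OnePoint.infty =
      if p.ell ∣ p.pairing (degF f) then leadCoeff c p else 0 := rfl
  have h1 : ∀ j, degF f j + (b j : ℕ) = ∑ α : RIdx r, (α.1 j : ℕ) * d α := by
    intro j
    have : (b j : ℕ) = ∑ α : RIdx r, (α.1 j : ℕ) * (if b = α.1 then 1 else 0) := by
      by_cases hb : b = 0
      · rw [Finset.sum_eq_zero fun α _ => by rw [if_neg fun h => α.2 (h.symm.trans hb), mul_zero],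
          hb]
        rfl
      · rw [Finset.sum_eq_single ⟨b, hb⟩]
        · simp
        · intro α _ hα
          rw [if_neg fun h => hα (Subtype.ext h.symm), mul_zero]
        · simp
    rw [this, degF, ← Finset.sum_add_distrib]
    exact Finset.sum_congr rfl fun α _ => by rw [← mul_add, hf]
  have h2 : ((p.pairing (degF f) : ℕ) : ZMod p.ell) + (p.pairing fun j => (b j : ℕ) : ℕ) = 0 := by
    have h3 : p.pairing (degF f) + (p.pairing fun j => (b j : ℕ)) =
        p.pairing fun j => degF f j + (b j : ℕ) := by
      simp only [SOmega.pairing, ← Finset.sum_add_distrib, ← mul_add]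
    rw [← Nat.cast_add, h3, ← p.cast_pairing_mod]
    have h4 : (fun j => (degF f j + (b j : ℕ)) % r j) = fun _ => 0 := funext fun j => by
      rw [h1, Nat.mod_eq_zero_of_dvd (hd j)]
    rw [h4]
    simp [SOmega.pairing]
  have h5 : p.ell ∣ p.pairing (degF f) ↔ p ∈ ASet b := by
    rw [← ZMod.natCast_eq_zero_iff, eq_neg_of_add_eq_zero_left h2, neg_eq_zero,
      ZMod.natCast_eq_zero_iff]
    rfl
  rw [hval]
  by_cases hp : p ∈ ASet b
  · rw [if_pos (h5.2 hp), apply_leadCoeff (hχ _ p.ell_dvd)]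
    simp [stateValue, hp]
  · rw [if_neg fun h => hp (h5.1 h), (stateValue_eq_zero_iff _ _ _ _).2 hp]
    exact MulChar.map_zero _

end Values

end AbelianCovers
namespace AbelianCovers

/-! ### Weights of ramification data. -/

section Ramification

variable {F : Type*} [Fintype F] {n : ℕ} {r : Fin n → ℕ} [∀ j, NeZero (r j)]

/-- The weight `q ^ (-t)` of ramification data with `t` ramified points. -/
noncomputable def ramWeight (b : Option F → RPrime r) : ℝ :=
  ∏ y, if b y = 0 then 1 else (Fintype.card F : ℝ)⁻¹

theorem inv_pow_sum_ramCount (b : Option F → RPrime r) :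
    (Fintype.card F : ℝ)⁻¹ ^ ∑ α, ramCount b α = ramWeight b := by
  simp only [ramCount, ramWeight]
  rw [Finset.sum_comm, ← Finset.prod_pow_eq_pow_sum]
  refine Finset.prod_congr rfl fun y _ => ?_
  by_cases h : b y = 0
  · rw [if_pos h, Finset.sum_eq_zero fun α _ => if_neg fun h' => α.2 (h'.symm.trans h), pow_zero]
  · rw [if_neg h, Finset.sum_eq_single ⟨b y, h⟩]
    · simp
    · intro α _ hα
      exact if_neg fun h' => hα (Subtype.ext h'.symm)
    · simp

theorem ramCount_le (b : Option F → RPrime r) (α : RIdx r) :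
    ramCount b α ≤ Fintype.card F + 1 := by
  have : ramCount b α ≤ ∑ _y : Option F, 1 :=
    Finset.sum_le_sum fun y _ => by split_ifs <;> omega
  simpa using this

theorem ramWeight_nonneg (b : Option F → RPrime r) : 0 ≤ ramWeight b :=
  Finset.prod_nonneg fun y _ => by split_ifs <;> positivity

theorem ramWeight_le_one [Nonempty F] (b : Option F → RPrime r) : ramWeight b ≤ 1 := by
  rw [← inv_pow_sum_ramCount]
  exact pow_le_one₀ (by positivity) (inv_le_one_of_one_le₀
    (by exact_mod_cast Fintype.card_pos (α := F)))

end Ramification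

/-! ### Counting the members with given local data. -/

section Counting

variable {F : Type*} [Field F] [Fintype F] {n : ℕ} {r : Fin n → ℕ} [∀ j, NeZero (r j)]

variable (F r) in
/-- The local data of a member of the full family: the leading coefficients, the ramification
vectors at the points of the projective line, and the values of the rootless parts at the finite
points. -/
abbrev LocalData : Type _ := (Fin n → Fˣ) × (Option F → RPrime r) × (F → RIdx r → Fˣ)

/-- The rootless tuples that, with the local data `ω`, give a member of the full family. -/
def fiber (d : RIdx r → ℕ) (ω : LocalData F r) : Set (RootlessTuple F r) :=
  {g | (∀ P, ∑ α, g P α ≤ 1) ∧ ∀ α,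
    expDeg (fun P : RootlessPrime F => P.1.natDegree) (g.part α) + ramCount ω.2.1 α = d α ∧
      expCls RootlessPrime.values (g.part α) = fun x => ω.2.2 x α}

/-- The member of the full family with given local data and rootless parts. -/
noncomputable def assemble (z : LocalData F r × RootlessTuple F r) :
    (Fin n → Fˣ) × (RIdx r → F[X]) :=
  (z.1.1, mkPoly (fun x => z.1.2.1 (some x)) z.2)

theorem natDegree_add_of_mem_fiber {d : RIdx r → ℕ} {ω : LocalData F r} {g : RootlessTuple F r}
    (hg : g ∈ fiber d ω) (α : RIdx r) :
    (mkPoly (fun x => ω.2.1 (some x)) g α).natDegree +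
      (if ω.2.1 none = α.1 then 1 else 0) = d α := by
  rw [← (hg.2 α).1, natDegree_mkPoly, ramCount, Fintype.sum_option]
  ring

theorem assemble_injOn (d : RIdx r → ℕ) :
    Set.InjOn (assemble (F := F)) {z | z.2 ∈ fiber d z.1} := by
  rintro ⟨⟨c, b, a⟩, g⟩ hz ⟨⟨c', b', a'⟩, g'⟩ hz' h
  simp only [assemble, Prod.mk.injEq] at h
  obtain ⟨rfl, h⟩ := h
  obtain ⟨hb, rfl⟩ := mkPoly_injective h
  have h1 := natDegree_add_of_mem_fiber hz
  have h2 := natDegree_add_of_mem_fiber hz'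
  simp only [← h] at h1 h2
  have h3 : ∀ α : RIdx r, b none = α.1 ↔ b' none = α.1 := fun α => by
    have := (h1 α).trans (h2 α).symm
    split_ifs at this with h4 h5 h5 <;> simp_all
  have hbn : b none = b' none := by
    by_cases h0 : b none = 0
    · by_contra hne
      have h4 : b' none ≠ 0 := fun h' => hne (h0.trans h'.symm)
      exact hne ((h3 ⟨b' none, h4⟩).2 rfl)
    · exact ((h3 ⟨b none, h0⟩).1 rfl).symm
  have hbb : b = b' := by
    funext y
    cases y with
    | none => exact hbn
    | some x => exact congrFun hb x
  subst hbb
  have ha : a = a' := by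
    funext x α
    have e1 := congrFun (hz.2 α).2 x
    have e2 := congrFun (hz'.2 α).2 x
    exact e1.symm.trans e2
  rw [ha]

/-- The local data are read off from the member: roots give the finite ramification vectors, the
lowered degree gives the one at infinity, and the rootless parts give the unit values. -/
theorem assemble_image (d : RIdx r → ℕ) :
    assemble '' {z : LocalData F r × RootlessTuple F r | z.2 ∈ fiber d z.1} = fullFamily F d := by
  ext cf
  rw [mem_fullFamily_iff]
  constructor
  · rintro ⟨⟨ω, g⟩, hz, rfl⟩
    exact ⟨mkPoly_monic _ _, (squarefree_prod_mkPoly_iff _ _).2 hz.1, ω.2.1 none,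
      natDegree_add_of_mem_fiber hz⟩
  · rintro ⟨h1, h2, bi, h3⟩
    obtain ⟨c, f⟩ := cf
    obtain ⟨b, g, rfl⟩ := exists_mkPoly_eq h1 h2
    refine ⟨((c, fun y => y.elim bi b, fun x α => expCls RootlessPrime.values (g.part α) x), g),
      ⟨(squarefree_prod_mkPoly_iff _ _).1 h2, fun α => ⟨?_, rfl⟩⟩, rfl⟩
    rw [← h3 α, natDegree_mkPoly, ramCount, Fintype.sum_option]
    exact (by intro a b c; ring : ∀ a b c : ℕ, a + (b + c) = c + a + b) _ _ _

theorem finite_fiber (d : RIdx r → ℕ) (ω : LocalData F r) : (fiber d ω).Finite := by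
  refine (finite_tuples fun α =>
    (primeSystem (F := F)).finite (d α - ramCount ω.2.1 α) fun x => ω.2.2 x α).subset ?_
  intro g hg α
  exact ⟨Nat.eq_sub_of_add_eq (hg.2 α).1, (hg.2 α).2⟩

theorem ncard_assemble_image (d : RIdx r → ℕ) (Q : Finset (LocalData F r)) :
    (assemble '' {z : LocalData F r × RootlessTuple F r | z.1 ∈ Q ∧ z.2 ∈ fiber d z.1}).ncard =
      ∑ ω ∈ Q, (fiber d ω).ncard := by
  rw [((assemble_injOn d).mono fun z hz => hz.2).ncard_image,
    ← Finset.sum_coe_sort Q]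
  have : ∀ ω : Q, Finite (fiber d ω.1) := fun ω => finite_fiber d ω.1
  simp only [← Nat.card_coe_set_eq]
  rw [← Nat.card_sigma]
  exact Nat.card_congr
    { toFun := fun z => ⟨⟨z.1.1, z.2.1⟩, z.1.2, z.2.2⟩
      invFun := fun z => ⟨(z.1.1, z.2.1), z.1.2, z.2.2⟩
      left_inv := fun _ => rfl
      right_inv := fun _ => rfl }

-- The fibre is a set of squarefree tuples with degrees `d(α)` minus the number of points ramified
-- at `α`. The main term depends on the local data only through the number of ramified points, not
-- on the unit values.
variable (F r) in
theorem exists_abs_ncard_fiber_sub_le :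
    ∃ Λ : ℝ, HasProd (fun P : RootlessPrime F =>
      (1 - ((Fintype.card F : ℝ) ^ P.1.natDegree)⁻¹) ^ Fintype.card (RIdx r) *
        (1 + Fintype.card (RIdx r) * ((Fintype.card F : ℝ) ^ P.1.natDegree)⁻¹)) Λ ∧
    ∃ C : ℝ, 0 ≤ C ∧ ∀ (d : RIdx r → ℕ) (ω : LocalData F r),
      |((fiber d ω).ncard : ℝ) - (((Fintype.card F : ℝ) ^ Fintype.card F)⁻¹ ^
        Fintype.card (RIdx r) * Λ * (Fintype.card F : ℝ) ^ (∑ α, d α)) * ramWeight ω.2.1| ≤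
      C * (Fintype.card F : ℝ) ^ (∑ α, d α) * (√(Fintype.card F : ℝ))⁻¹ ^ (⨅ α, d α) := by
  classical
  have H := primeSystem (F := F)
  obtain ⟨Λ, hΛ, C, hC, hest⟩ := H.exists_abs_ncard_sqfreeTuples_sub_le (RIdx r)
  refine ⟨Λ, hΛ, ?_⟩
  set q : ℝ := (Fintype.card F : ℝ)
  set k := Fintype.card (RIdx r)
  set c₀ : ℝ := (q ^ Fintype.card F)⁻¹ ^ k
  set s := √q
  have hs1 : 1 < s := H.one_lt_sqrt
  have hs0 : 0 < s := one_pos.trans hs1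
  have hq0 : 0 < q := by
    simp only [q]
    exact_mod_cast Fintype.card_pos (α := F)
  have hq1 : 1 ≤ q := by
    simp only [q]
    exact_mod_cast Fintype.card_pos (α := F)
  -- At most `q + 1` points are ramified, so lowering the degrees worsens the error by at most this
  -- factor.
  set B := s ^ (Fintype.card F + 1)
  have hB : 0 < B := pow_pos hs0 _
  have hc₀ : 0 ≤ c₀ := by positivity
  have hmin : ∀ (d : RIdx r → ℕ) α, ⨅ α, d α ≤ d α := fun d α => ciInf_le (OrderBot.bddBelow _) α
  have hpow : ∀ (d : RIdx r → ℕ) α m, d α ≤ m + (Fintype.card F + 1) →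
      s⁻¹ ^ m ≤ B * s⁻¹ ^ (⨅ α, d α) := by
    intro d α m hm
    have h1 : s⁻¹ ^ (m + (Fintype.card F + 1)) ≤ s⁻¹ ^ (⨅ α, d α) :=
      pow_le_pow_of_le_one (by positivity) (inv_le_one_of_one_le₀ hs1.le) ((hmin d α).trans hm)
    calc s⁻¹ ^ m = B * s⁻¹ ^ (m + (Fintype.card F + 1)) := by
          rw [pow_add, mul_left_comm, ← mul_pow, mul_inv_cancel₀ hs0.ne', one_pow, mul_one]
      _ ≤ _ := mul_le_mul_of_nonneg_left h1 hB.le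
  refine ⟨C * (k * B) + |c₀ * Λ| * B, by positivity, fun d ω => ?_⟩
  by_cases hle : ∀ α, ramCount ω.2.1 α ≤ d α
  · have hset : fiber d ω = PrimeSystem.sqfreeTuples (fun P : RootlessPrime F => P.1.natDegree)
        RootlessPrime.values (fun α => d α - ramCount ω.2.1 α) (fun α x => ω.2.2 x α) := by
      ext g
      refine and_congr Iff.rfl (forall_congr' fun α => and_congr ?_ Iff.rfl)
      have := hle α
      exact ⟨Nat.eq_sub_of_add_eq, fun h => (congrArg (· + _) h).trans (Nat.sub_add_cancel this)⟩
    have hsum : (∑ α, (d α - ramCount ω.2.1 α)) + ∑ α, ramCount ω.2.1 α = ∑ α, d α := by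
      rw [← Finset.sum_add_distrib]
      exact Finset.sum_congr rfl fun α _ => Nat.sub_add_cancel (hle α)
    have hqe : q ^ (∑ α, (d α - ramCount ω.2.1 α)) = q ^ (∑ α, d α) * ramWeight ω.2.1 := by
      rw [← inv_pow_sum_ramCount, ← hsum, pow_add, mul_assoc, ← mul_pow, mul_inv_cancel₀ hq0.ne',
        one_pow, mul_one]
    have h := hest (fun α => d α - ramCount ω.2.1 α) (fun α x => ω.2.2 x α)
    rw [← hset, hqe] at h
    have hsum2 : ∑ α, s⁻¹ ^ (d α - ramCount ω.2.1 α) ≤ k * B * s⁻¹ ^ (⨅ α, d α) := by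
      calc ∑ α, s⁻¹ ^ (d α - ramCount ω.2.1 α) ≤ ∑ _α : RIdx r, B * s⁻¹ ^ (⨅ α, d α) :=
            Finset.sum_le_sum fun α _ => hpow d α _ (by
              have := ramCount_le ω.2.1 α
              omega)
        _ = _ := by rw [Finset.sum_const, Finset.card_univ, nsmul_eq_mul, mul_assoc]
    have hE : 0 ≤ s⁻¹ ^ (⨅ α, d α) := by positivity
    calc _ = |((fiber d ω).ncard : ℝ) - c₀ * Λ * (q ^ (∑ α, d α) * ramWeight ω.2.1)| := by
          rw [mul_assoc]
      _ ≤ C * (q ^ (∑ α, d α) * ramWeight ω.2.1) * ∑ α, s⁻¹ ^ (d α - ramCount ω.2.1 α) := h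
      _ ≤ C * (q ^ (∑ α, d α) * 1) * (k * B * s⁻¹ ^ (⨅ α, d α)) := by
          have := ramWeight_nonneg ω.2.1
          have := ramWeight_le_one ω.2.1
          gcongr
      _ = C * (k * B) * q ^ (∑ α, d α) * s⁻¹ ^ (⨅ α, d α) := by ring
      _ ≤ _ := by
          gcongr
          exact le_add_of_nonneg_right (by positivity)
  · push Not at hle
    obtain ⟨α, hα⟩ := hle
    have hempty : fiber d ω = ∅ := by
      refine Set.eq_empty_of_forall_notMem fun g hg => ?_
      have := (hg.2 α).1
      omega
    -- The fibre is empty only if some `d α` is below `q + 1`; the error term then already dominates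
    -- the main term.
    have h1 : 1 ≤ B * s⁻¹ ^ (⨅ α, d α) := by
      have := hpow d α 0 (by
        have := ramCount_le ω.2.1 α
        omega)
      rwa [pow_zero] at this
    rw [hempty, Set.ncard_empty, Nat.cast_zero, zero_sub, abs_neg, abs_mul, abs_mul,
      abs_of_nonneg (ramWeight_nonneg _), abs_of_pos (pow_pos hq0 _)]
    calc |c₀ * Λ| * q ^ (∑ α, d α) * ramWeight ω.2.1
        ≤ |c₀ * Λ| * q ^ (∑ α, d α) * (B * s⁻¹ ^ (⨅ α, d α)) := by
          gcongr
          exact (ramWeight_le_one _).trans h1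
      _ = |c₀ * Λ| * B * q ^ (∑ α, d α) * s⁻¹ ^ (⨅ α, d α) := by ring
      _ ≤ _ := by
          gcongr
          exact le_add_of_nonneg_left (by positivity)

end Counting

end AbelianCovers
namespace AbelianCovers

/-! ### Summing the weights over the local data. -/

section Weights

/-- A surjective homomorphism has fibres of equal size, and the condition selects one coset of `H`.
-/
theorem card_filter_add_mem {A G : Type*} [CommGroup A] [Fintype A] [AddCommGroup G] [Fintype G]
    {θ : A →* Multiplicative G} (hθ : Function.Surjective θ) (H : AddSubgroup G) (t : G)
    [DecidablePred fun v : A => (θ v).toAdd + t ∈ H] :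
    (((Finset.univ.filter fun v : A => (θ v).toAdd + t ∈ H).card : ℕ) : ℝ) =
      Fintype.card A * ((Nat.card H : ℝ) / Fintype.card G) := by
  classical
  set K := (Finset.univ.filter fun v : A => θ v = 1).card
  have hK : ∀ g : Multiplicative G, (Finset.univ.filter fun v : A => θ v = g).card = K := fun g =>
    MonoidHom.card_fiber_eq_of_mem_range θ (hθ g) (hθ 1)
  have h1 : Fintype.card A = Fintype.card G * K := by
    rw [← Finset.card_univ, Finset.card_eq_sum_card_fiberwise (f := θ) (t := Finset.univ)
      (fun _ _ => Finset.mem_coe.2 (Finset.mem_univ _)), Finset.sum_congr rfl fun g _ => hK g]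
    simp
  set S := Finset.univ.filter fun g : Multiplicative G => g.toAdd + t ∈ H
  have hS : S.card = Nat.card H := by
    rw [Nat.card_eq_fintype_card, ← Fintype.card_coe]
    refine Fintype.card_congr
      { toFun := fun g => ⟨g.1.toAdd + t, (Finset.mem_filter.1 g.2).2⟩
        invFun := fun h => ⟨Multiplicative.ofAdd (h.1 - t), Finset.mem_filter.2 ⟨Finset.mem_univ _, ?_⟩⟩
        left_inv := fun g => ?_
        right_inv := fun h => ?_ }
    · simp
    · simp
    · simp
  have h2 : (Finset.univ.filter fun v : A => (θ v).toAdd + t ∈ H).card = Nat.card H * K := by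
    rw [Finset.card_eq_sum_card_fiberwise (f := θ) (t := S)
      (fun v hv => Finset.mem_coe.2 (Finset.mem_filter.2
        ⟨Finset.mem_univ _, (Finset.mem_filter.1 (Finset.mem_coe.1 hv)).2⟩))]
    rw [← hS, ← smul_eq_mul, ← Finset.sum_const]
    refine Finset.sum_congr rfl fun g hg => ?_
    rw [← hK g, Finset.filter_filter]
    congr 1
    ext v
    simp only [Finset.mem_filter, Finset.mem_univ, true_and, and_iff_right_iff_imp]
    rintro rfl
    exact (Finset.mem_filter.1 hg).2
  have hG : (Fintype.card G : ℝ) ≠ 0 := by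
    have := Fintype.card_pos (α := G)
    positivity
  rw [h2, h1]
  push_cast
  field_simp

variable {F : Type*} [Field F] [Fintype F] {n : ℕ} {r : Fin n → ℕ} [∀ j, NeZero (r j)]

variable (F r) in
/-- The homomorphism `v ↦ (∏_α v_α ^ α_j)_j`. -/
def monomialHom : (RIdx r → Fˣ) →* (Fin n → Fˣ) where
  toFun v j := ∏ α : RIdx r, v α ^ (α.1 j : ℕ)
  map_one' := by ext; simp
  map_mul' v w := by ext; simp [mul_pow, Finset.prod_mul_distrib]

theorem pointUnit_some (c : Fin n → Fˣ) (b : Option F → RPrime r) (a : F → RIdx r → Fˣ) (x : F) :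
    pointUnit c b a (some x) =
      monomialHom F r (a x) * (c * monomialHom F r fun α => linUnit (fun z => b (some z)) α x) := by
  ext j
  simp only [pointUnit, monomialHom, mul_pow, Finset.prod_mul_distrib, MonoidHom.coe_mk,
    OneHom.coe_mk, Pi.mul_apply, Units.val_mul]
  ring

/-- Every nonzero `y` in `R'` is itself an index `α`: a generator of `Fˣ` placed there, and `1`
elsewhere, maps to `y`. -/
theorem logHom_comp_monomialHom_surjective (hq : ∀ j, Fintype.card F ≡ 1 [MOD r j]) :
    Function.Surjective ((logHom hq).comp (monomialHom F r)) := by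
  classical
  intro y
  by_cases hy : y = 1
  · exact ⟨1, by rw [hy, map_one]⟩
  · have hy' : y.toAdd ≠ 0 := fun h => hy (Multiplicative.toAdd.injective h)
    refine ⟨Pi.mulSingle ⟨y.toAdd, hy'⟩ (unitGen F), ?_⟩
    have h1 : monomialHom F r (Pi.mulSingle ⟨y.toAdd, hy'⟩ (unitGen F)) =
        fun j => unitGen F ^ (y.toAdd j : ℕ) := by
      funext j
      change ∏ α : RIdx r, _ = _
      rw [Finset.prod_eq_single (⟨y.toAdd, hy'⟩ : RIdx r)]
      · rw [Pi.mulSingle_eq_same]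
      · intro α _ hα
        rw [Pi.mulSingle_eq_of_ne hα, one_pow]
      · simp
    rw [MonoidHom.comp_apply, h1]
    exact congrArg Multiplicative.ofAdd (logVec_pow_unitGen hq y.toAdd)

theorem cast_card_units [Fintype Fˣ] :
    ((Fintype.card Fˣ : ℕ) : ℝ) = (Fintype.card F : ℝ) - 1 := by
  rw [← Nat.card_eq_fintype_card, Nat.card_units, Nat.card_eq_fintype_card, Nat.cast_sub Fintype.card_pos, Nat.cast_one]

variable (F r) in
/-- The number of choices of the unit parts in the local data. -/
noncomputable def unitChoices : ℝ :=
  ((Fintype.card F : ℝ) - 1) ^ n * (((Fintype.card F : ℝ) - 1) ^ Fintype.card (RIdx r)) ^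
    Fintype.card F

-- The condition at infinity involves only `c`. Once `c` and `b` are fixed, the condition at `x`
-- involves only `a x`, whose image under `monomialHom` is multiplied by a fixed unit vector. Hence
-- the conditions at different points are independent.
open Classical in
theorem card_units_condition (hq : ∀ j, Fintype.card F ≡ 1 [MOD r j]) (b : Option F → RPrime r)
    (H : RPrime r → AddSubgroup (RPrime r)) (t : Option F → RPrime r) :
    (((Finset.univ.filter fun z : (Fin n → Fˣ) × (F → RIdx r → Fˣ) =>
      ∀ y, logVec r (pointUnit z.1 b z.2 y) - t y ∈ H (b y)).card : ℕ) : ℝ) =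
      unitChoices F r * ∏ y, ((Nat.card (H (b y)) : ℝ) / groupOrder r) := by
  have hcomp : ∀ c : Fin n → Fˣ,
      (((Finset.univ.filter fun a : F → RIdx r → Fˣ => ∀ x : F,
        logVec r (pointUnit c b a (some x)) - t (some x) ∈ H (b (some x))).card : ℕ) : ℝ) =
        ∏ x : F, (((Fintype.card F : ℝ) - 1) ^ Fintype.card (RIdx r) *
          ((Nat.card (H (b (some x))) : ℝ) / groupOrder r)) := by
    intro c
    set S : F → Finset (RIdx r → Fˣ) := fun x => Finset.univ.filter fun v =>
      (((logHom hq).comp (monomialHom F r)) v).toAdd +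
        (logVec r (c * monomialHom F r fun α => linUnit (fun z => b (some z)) α x) - t (some x)) ∈
          H (b (some x))
    have h1 : (Finset.univ.filter fun a : F → RIdx r → Fˣ => ∀ x : F,
        logVec r (pointUnit c b a (some x)) - t (some x) ∈ H (b (some x))) =
        Fintype.piFinset S := by
      ext a
      simp only [Finset.mem_filter, Finset.mem_univ, true_and, Fintype.mem_piFinset, S]
      refine forall_congr' fun x => ?_
      rw [pointUnit_some, logVec_mul hq, add_sub_assoc]
      rfl
    rw [h1, Fintype.card_piFinset, Nat.cast_prod]
    refine Finset.prod_congr rfl fun x _ => ?_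
    rw [card_filter_add_mem (logHom_comp_monomialHom_surjective (F := F) hq), Fintype.card_fun,
      Nat.cast_pow, cast_card_units, card_RPrime]
  rw [Finset.card_filter, Nat.cast_sum, Fintype.sum_prod_type]
  have h2 : ∀ c : Fin n → Fˣ, (∑ a : F → RIdx r → Fˣ, ((if ∀ y,
      logVec r (pointUnit c b a y) - t y ∈ H (b y) then 1 else 0 : ℕ) : ℝ)) =
      if (logHom hq c).toAdd + (- t none) ∈ H (b none) then
        ∏ x : F, (((Fintype.card F : ℝ) - 1) ^ Fintype.card (RIdx r) *
          ((Nat.card (H (b (some x))) : ℝ) / groupOrder r)) else 0 := by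
    intro c
    rw [← hcomp c, ← Nat.cast_sum, ← Finset.card_filter]
    have h3 : ∀ a, logVec r (pointUnit c b a none) - t none ∈ H (b none) ↔
        (logHom hq c).toAdd + (- t none) ∈ H (b none) := fun a => by
      rw [sub_eq_add_neg]
      rfl
    split_ifs with h
    · congr 2
      ext a
      simp only [Finset.mem_filter, Finset.mem_univ, true_and, Option.forall, h3, h]
    · rw [Finset.filter_eq_empty_iff.2 fun a _ ha => h ((h3 a).1 (ha none)), Finset.card_empty,
        Nat.cast_zero]
  rw [Finset.sum_congr rfl fun c _ => h2 c, ← Finset.sum_filter, Finset.sum_const, nsmul_eq_mul,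
    card_filter_add_mem (logHom_surjective hq), Fintype.card_fun, Nat.cast_pow, cast_card_units,
    Fintype.card_fin, card_RPrime, Fintype.prod_option, Finset.prod_mul_distrib, Finset.prod_const,
    Finset.card_univ, unitChoices]
  ring

open Classical in
/-- The local data with ramification vectors in the sets `T y` and with the logarithm of the unit
vector at `y` in the coset `t y + H (b y)`. -/
noncomputable def localCondition (T : Option F → Finset (RPrime r))
    (H : RPrime r → AddSubgroup (RPrime r)) (t : Option F → RPrime r) : Finset (LocalData F r) :=
  Finset.univ.filter fun ω => (∀ y, ω.2.1 y ∈ T y) ∧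
    ∀ y, logVec r (pointUnit ω.1 ω.2.1 ω.2.2 y) - t y ∈ H (ω.2.1 y)

theorem mem_localCondition {T : Option F → Finset (RPrime r)}
    {H : RPrime r → AddSubgroup (RPrime r)} {t : Option F → RPrime r} {ω : LocalData F r} :
    ω ∈ localCondition T H t ↔ (∀ y, ω.2.1 y ∈ T y) ∧
      ∀ y, logVec r (pointUnit ω.1 ω.2.1 ω.2.2 y) - t y ∈ H (ω.2.1 y) := by
  classical
  simp [localCondition]

/-- Arbitrary sets `T` and subgroups `H` cover both uses: the prescription, with the generators of a
cyclic group and that group, and the whole family, with everything and the full group. -/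
theorem sum_ramWeight (hq : ∀ j, Fintype.card F ≡ 1 [MOD r j]) (T : Option F → Finset (RPrime r))
    (H : RPrime r → AddSubgroup (RPrime r)) (t : Option F → RPrime r) :
    ∑ ω ∈ localCondition T H t, ramWeight ω.2.1 =
      unitChoices F r * ∏ y, ∑ γ ∈ T y, (Nat.card (H γ) : ℝ) / groupOrder r *
        (if γ = 0 then 1 else (Fintype.card F : ℝ)⁻¹) := by
  classical
  rw [localCondition, Finset.sum_filter]
  have h1 : (∑ ω : LocalData F r, if (∀ y, ω.2.1 y ∈ T y) ∧
      ∀ y, logVec r (pointUnit ω.1 ω.2.1 ω.2.2 y) - t y ∈ H (ω.2.1 y) then ramWeight ω.2.1 else 0) =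
      ∑ b : Option F → RPrime r, ∑ z : (Fin n → Fˣ) × (F → RIdx r → Fˣ),
        if (∀ y, b y ∈ T y) ∧ ∀ y, logVec r (pointUnit z.1 b z.2 y) - t y ∈ H (b y)
          then ramWeight b else 0 := by
    simp only [Fintype.sum_prod_type]
    exact Finset.sum_comm
  rw [h1, Finset.prod_univ_sum, Finset.mul_sum]
  have h2 : (Fintype.piFinset T : Finset (Option F → RPrime r)) =
      Finset.univ.filter fun b => ∀ y, b y ∈ T y := by
    ext b
    simp [Fintype.mem_piFinset]
  rw [h2, Finset.sum_filter]
  refine Finset.sum_congr rfl fun b _ => ?_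
  split_ifs with hb
  · rw [Finset.prod_mul_distrib, ← mul_assoc, ← card_units_condition hq b H t, Finset.card_filter,
      Nat.cast_sum, Finset.sum_mul]
    refine Finset.sum_congr rfl fun z _ => ?_
    by_cases hz : ∀ y, logVec r (pointUnit z.1 b z.2 y) - t y ∈ H (b y)
    · rw [if_pos ⟨hb, hz⟩, if_pos hz, Nat.cast_one, one_mul, ramWeight]
    · rw [if_neg fun h => hz h.2, if_neg hz, Nat.cast_zero, zero_mul]
  · exact Finset.sum_eq_zero fun z _ => if_neg fun h => hb h.1

end Weights

end AbelianCovers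
namespace AbelianCovers

/-! ### Local weights of the classes. -/

section ClassWeights

variable {F : Type*} [Fintype F] {n : ℕ} {r : Fin n → ℕ} [∀ j, NeZero (r j)]

open Classical in
/-- The vectors that generate the same cyclic group as `β`. -/
noncomputable def sameClass (β : RPrime r) : Finset (RPrime r) :=
  Finset.univ.filter fun γ => AddSubgroup.zmultiples γ = AddSubgroup.zmultiples β

theorem mem_sameClass {β γ : RPrime r} :
    γ ∈ sameClass β ↔ AddSubgroup.zmultiples γ = AddSubgroup.zmultiples β := by
  simp [sameClass]

theorem addOrderOf_eq_of_zmultiples_eq {G : Type*} [AddGroup G] {β γ : G}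
    (h : AddSubgroup.zmultiples γ = AddSubgroup.zmultiples β) : addOrderOf γ = addOrderOf β := by
  rw [← Nat.card_zmultiples, h, Nat.card_zmultiples]

theorem eq_zero_iff_of_zmultiples_eq {G : Type*} [AddGroup G] {β γ : G}
    (h : AddSubgroup.zmultiples γ = AddSubgroup.zmultiples β) : γ = 0 ↔ β = 0 := by
  rw [← AddSubgroup.zmultiples_eq_bot, h, AddSubgroup.zmultiples_eq_bot]

variable (F) in
/-- The weight of the vectors in the class of `β` at one point. -/
noncomputable def classWeight (β : RPrime r) : ℝ :=
  (Nat.totient (addOrderOf β ^ 2) : ℝ) / groupOrder r *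
    (if β = 0 then 1 else (Fintype.card F : ℝ)⁻¹)

theorem sum_sameClass (β : RPrime r) :
    ∑ γ ∈ sameClass β, (Nat.card (AddSubgroup.zmultiples γ) : ℝ) / groupOrder r *
      (if γ = 0 then 1 else (Fintype.card F : ℝ)⁻¹) = classWeight F β := by
  classical
  have h1 : (sameClass β).card = Nat.totient (addOrderOf β) := by
    rw [← card_generators_zmultiples β, ← Set.ncard_coe_finset]
    congr 1
    ext γ
    simp [mem_sameClass]
  rw [Finset.sum_congr rfl (g := fun _ => (addOrderOf β : ℝ) / groupOrder r *
    (if β = 0 then 1 else (Fintype.card F : ℝ)⁻¹)), Finset.sum_const, h1, nsmul_eq_mul,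
    classWeight, totient_sq (addOrderOf_pos β), Nat.cast_mul]
  · ring
  · intro γ hγ
    have hγ' := mem_sameClass.1 hγ
    rw [Nat.card_zmultiples, addOrderOf_eq_of_zmultiples_eq hγ']
    simp only [eq_zero_iff_of_zmultiples_eq hγ']

theorem cast_groupOrder : (groupOrder r : ℝ) = Fintype.card (RIdx r) + 1 := by
  exact_mod_cast (card_RIdx (r := r)).symm

theorem sum_univ_weight :
    ∑ γ : RPrime r, (Nat.card (⊤ : AddSubgroup (RPrime r)) : ℝ) / groupOrder r *
      (if γ = 0 then 1 else (Fintype.card F : ℝ)⁻¹) =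
        1 + Fintype.card (RIdx r) * (Fintype.card F : ℝ)⁻¹ := by
  classical
  have hg : (groupOrder r : ℝ) ≠ 0 := by rw [cast_groupOrder]; positivity
  rw [AddSubgroup.card_top, Nat.card_eq_fintype_card, card_RPrime, div_self hg]
  simp only [one_mul]
  rw [← Finset.add_sum_erase _ _ (Finset.mem_univ 0), if_pos rfl]
  congr 1
  rw [Finset.sum_congr rfl (g := fun _ => (Fintype.card F : ℝ)⁻¹)
    (fun γ hγ => if_neg (Finset.ne_of_mem_erase hγ)), Finset.sum_const, nsmul_eq_mul,
    Finset.card_erase_of_mem (Finset.mem_univ _), Finset.card_univ, card_RPrime,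
    ← card_RIdx, Nat.add_sub_cancel]

end ClassWeights

/-! ### Identifying the density and the main term. -/

section Densities

variable {F : Type*} [Field F] [Fintype F] {n : ℕ} {r : Fin n → ℕ} [∀ j, NeZero (r j)]

theorem apply_valueAt_assemble {χ : ℕ → MulChar F ℂ}
    (hχ : ∀ m, m ∣ Finset.univ.lcm r → orderOf (χ m) = m) {d : RIdx r → ℕ}
    (hd : ∀ j, r j ∣ ∑ α : RIdx r, (α.1 j : ℕ) * d α) {z : LocalData F r × RootlessTuple F r}
    (hz : z.2 ∈ fiber d z.1) (p : SOmega r) (y : Option F) :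
    χ p.ell (valueAt (assemble z).1 (assemble z).2 p (show OnePoint F from y)) =
      stateValue χ (z.1.2.1 y) (pointUnit z.1.1 z.1.2.1 z.1.2.2 y) p := by
  cases y with
  | none => exact apply_valueAt_none hχ hd z.1.1 (natDegree_add_of_mem_fiber hz) p
  | some x =>
    exact apply_valueAt_some hχ z.1.1 z.1.2.1 z.2 z.1.2.2
      (fun x α => (congrFun (hz.2 α).2 x).symm) p x

theorem IsAdmissible.exists_stateValue {χ : ℕ → MulChar F ℂ}
    (hχ : ∀ m, m ∣ Finset.univ.lcm r → orderOf (χ m) = m) {d : RIdx r → ℕ}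
    (hd : ∀ j, r j ∣ ∑ α : RIdx r, (α.1 j : ℕ) * d α) {ε : SOmega r → ℂ}
    (h : IsAdmissible χ d ε) : ∃ (β : RPrime r) (u : Fin n → Fˣ), ε = stateValue χ β u := by
  obtain ⟨cf, hcf, x, hx⟩ := h
  rw [← assemble_image] at hcf
  obtain ⟨z, hz, rfl⟩ := hcf
  exact ⟨_, _, funext fun p => (hx p).trans (apply_valueAt_assemble hχ hd hz p x)⟩

theorem attaining_eq {χ : ℕ → MulChar F ℂ}
    (hχ : ∀ m, m ∣ Finset.univ.lcm r → orderOf (χ m) = m) {d : RIdx r → ℕ}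
    (hd : ∀ j, r j ∣ ∑ α : RIdx r, (α.1 j : ℕ) * d α) {ε : OnePoint F → SOmega r → ℂ}
    {β : Option F → RPrime r} {u : Option F → Fin n → Fˣ}
    (hε : ∀ y : Option F, ε y = stateValue χ (β y) (u y)) :
    attaining χ d ε = assemble '' {z | z.1 ∈ localCondition (fun y => sameClass (β y))
      AddSubgroup.zmultiples (fun y => logVec r (u y)) ∧ z.2 ∈ fiber d z.1} := by
  have key : ∀ z : LocalData F r × RootlessTuple F r, z.2 ∈ fiber d z.1 →
      ((∀ (x : OnePoint F) (p : SOmega r),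
        χ p.ell (valueAt (assemble z).1 (assemble z).2 p x) = ε x p) ↔
      z.1 ∈ localCondition (fun y => sameClass (β y)) AddSubgroup.zmultiples
        (fun y => logVec r (u y))) := by
    intro z hz
    rw [mem_localCondition, ← forall_and]
    change (∀ y : Option F, _) ↔ _
    refine forall_congr' fun y => ?_
    rw [mem_sameClass, ← stateValue_eq_iff hχ, ← hε y, funext_iff]
    exact forall_congr' fun p => by rw [← apply_valueAt_assemble hχ hd hz p y]
  ext cf
  constructor
  · rintro ⟨h1, h2⟩
    rw [← assemble_image] at h1
    obtain ⟨z, hz, rfl⟩ := h1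
    exact ⟨z, ⟨(key z hz).1 h2, hz⟩, rfl⟩
  · rintro ⟨z, ⟨h1, h2⟩, rfl⟩
    exact ⟨assemble_image (F := F) d ▸ ⟨z, h2, rfl⟩, (key z h2).2 h1⟩

theorem fullFamily_eq (d : RIdx r → ℕ) :
    fullFamily F d = assemble '' {z : LocalData F r × RootlessTuple F r |
      z.1 ∈ localCondition (fun _ => Finset.univ) (fun _ => ⊤) 0 ∧ z.2 ∈ fiber d z.1} := by
  rw [← assemble_image]
  congr 1
  ext z
  simp [mem_localCondition]

/-- The zeros of `ε y` are exactly the complement of `A_(β y)`, so `m_[b]` counts the points whose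
`β y` lies in the class `b`. The product over classes then becomes one over points. -/
theorem density_eq {χ : ℕ → MulChar F ℂ} {d : RIdx r → ℕ} {ε : OnePoint F → SOmega r → ℂ}
    {β : Option F → RPrime r} {u : Option F → Fin n → Fˣ}
    (hadm : ∀ x, IsAdmissible χ d (ε x))
    (hε : ∀ y : Option F, ε y = stateValue χ (β y) (u y)) :
    density χ d ε = ∏ y, classWeight F (β y) *
      ((Fintype.card F : ℝ) / (Fintype.card F + Fintype.card (RIdx r))) := by
  classical
  have hq : (Fintype.card F : ℝ) ≠ 0 := Nat.cast_ne_zero.2 Fintype.card_ne_zero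
  have hqk : (Fintype.card F : ℝ) + Fintype.card (RIdx r) ≠ 0 := by
    have := Fintype.card_pos (α := F)
    positivity
  have hg : (groupOrder r : ℝ) ≠ 0 := by rw [cast_groupOrder]; positivity
  have hden : (Fintype.card F : ℝ) + groupOrder r - 1 = Fintype.card F + Fintype.card (RIdx r) := by
    rw [cast_groupOrder]; ring
  set cls : Option F → RTilde r := fun y => Quotient.mk (simSetoid r) (β y)
  have hcls : ∀ y b, cls y = b ↔ ASet (β y) = ASet b.rep := by
    intro y b
    conv_lhs => rw [← Quotient.out_eq b]
    exact Quotient.eq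
  have hmult : ∀ b, mult χ d ε b = (Finset.univ.filter fun y => cls y = b).card := by
    intro b
    rw [← Set.ncard_coe_finset, mult]
    congr 1
    ext y
    simp only [Finset.coe_filter, Finset.mem_univ, true_and, Set.mem_ofPred_eq, hcls]
    constructor
    · rintro ⟨-, h⟩
      ext p
      rw [← not_iff_not, ← h p, hε y, stateValue_eq_zero_iff]
    · intro h
      refine ⟨hadm y, fun p => ?_⟩
      rw [← h, hε y, stateValue_eq_zero_iff]
  set D : RTilde r → ℝ := fun b => if b = zeroClass r then
      (Fintype.card F : ℝ) / (groupOrder r * (Fintype.card F + groupOrder r - 1))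
    else (Nat.totient (ramIndex r (fun j => (b.rep j : ℕ)) ^ 2) : ℝ) /
      (groupOrder r * (Fintype.card F + groupOrder r - 1))
  have h1 : density χ d ε = ∏ b, D b ^ mult χ d ε b := by
    rw [Fintype.prod_eq_mul_prod_compl (zeroClass r), mul_comm, density]
    congr 1
    · refine Finset.prod_congr rfl fun b hb => ?_
      have hb' : b ≠ zeroClass r := by simpa using hb
      simp only [D, if_neg hb']
    · simp only [D, if_true]
  rw [h1]
  have h2 : ∏ b, D b ^ mult χ d ε b = ∏ y, D (cls y) := by
    rw [← Finset.prod_fiberwise' Finset.univ cls D]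
    exact Finset.prod_congr rfl fun b _ => by rw [Finset.prod_const, hmult]
  rw [h2]
  refine Finset.prod_congr rfl fun y _ => ?_
  have hzero : cls y = zeroClass r ↔ β y = 0 := by
    have : cls y = zeroClass r ↔ ASet (β y) = ASet 0 := Quotient.eq
    rw [this, ASet_eq_iff, AddSubgroup.zmultiples_zero_eq_bot, AddSubgroup.zmultiples_eq_bot]
  simp only [D, hzero, classWeight, hden]
  by_cases h0 : β y = 0
  · simp only [h0, if_true, addOrderOf_zero, one_pow, Nat.totient_one, Nat.cast_one]
    field_simp
  · have h3 : addOrderOf (cls y).rep = addOrderOf (β y) :=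
      addOrderOf_eq_of_zmultiples_eq ((ASet_eq_iff _ _).1 ((hcls y _).1 rfl).symm)
    simp only [if_neg h0, ramIndex_eq_addOrderOf, h3]
    field_simp

variable (F r) in
/-- A lower bound for the density. -/
noncomputable def densityFloor : ℝ :=
  ∏ _y : Option F, ((groupOrder r : ℝ) * (Fintype.card F + Fintype.card (RIdx r)))⁻¹

variable (F r) in
theorem densityFloor_pos : 0 < densityFloor F r := by
  refine Finset.prod_pos fun y _ => ?_
  rw [cast_groupOrder]
  have := Fintype.card_pos (α := F)
  positivity

theorem densityFloor_le (β : Option F → RPrime r) :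
    densityFloor F r ≤ ∏ y, classWeight F (β y) *
      ((Fintype.card F : ℝ) / (Fintype.card F + Fintype.card (RIdx r))) := by
  have hq : (1 : ℝ) ≤ Fintype.card F := by exact_mod_cast Fintype.card_pos (α := F)
  have hg : (0 : ℝ) < groupOrder r := by rw [cast_groupOrder]; positivity
  refine Finset.prod_le_prod (fun y _ => by positivity) fun y _ => ?_
  have h1 : (1 : ℝ) ≤ Nat.totient (addOrderOf (β y) ^ 2) := by
    exact_mod_cast Nat.totient_pos.2 (pow_pos (addOrderOf_pos (β y)) 2)
  have h2 : (Fintype.card F : ℝ)⁻¹ ≤ if β y = 0 then 1 else (Fintype.card F : ℝ)⁻¹ := by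
    split_ifs
    · exact inv_le_one_of_one_le₀ hq
    · exact le_rfl
  calc ((groupOrder r : ℝ) * (Fintype.card F + Fintype.card (RIdx r)))⁻¹
      = 1 / groupOrder r * (Fintype.card F : ℝ)⁻¹ *
        ((Fintype.card F : ℝ) / (Fintype.card F + Fintype.card (RIdx r))) := by
        field_simp
    _ ≤ _ := by
        rw [classWeight]
        gcongr

/-- The unit choices at the finite points and the interpolation density combine to `(1 - 1/q) ^
(kq)`. Of the `q + 1` factors `1 + k/q`, the finite points supply those of the linear primes and
infinity supplies `(q + |G| - 1)/q`. -/
theorem mainSize_eq {Λ : ℝ} (hΛ : HasProd (fun P : RootlessPrime F =>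
      (1 - ((Fintype.card F : ℝ) ^ P.1.natDegree)⁻¹) ^ Fintype.card (RIdx r) *
        (1 + Fintype.card (RIdx r) * ((Fintype.card F : ℝ) ^ P.1.natDegree)⁻¹)) Λ)
    (d : RIdx r → ℕ) :
    mainSize F d = ((Fintype.card F : ℝ) ^ Fintype.card F)⁻¹ ^ Fintype.card (RIdx r) * Λ *
      (Fintype.card F : ℝ) ^ (∑ α, d α) * (unitChoices F r *
        (1 + Fintype.card (RIdx r) * (Fintype.card F : ℝ)⁻¹) ^ (Fintype.card F + 1)) := by
  have h := local_density_eq F _ hΛ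
  have hq : (Fintype.card F : ℝ) ≠ 0 := Nat.cast_ne_zero.2 Fintype.card_ne_zero
  have hk1 : groupOrder r - 1 = Fintype.card (RIdx r) := by rw [← card_RIdx, Nat.add_sub_cancel]
  have hk2 : groupOrder r - 2 = Fintype.card (RIdx r) - 1 := by rw [← card_RIdx]; omega
  rw [mainSize, hk1, hk2, mul_div_right_comm (LConst F _), ← h, cast_groupOrder, unitChoices]
  set q : ℝ := (Fintype.card F : ℝ)
  set N := Fintype.card F
  set k := Fintype.card (RIdx r)
  have h1 : (1 - q⁻¹) = (q - 1) * q⁻¹ := by field_simp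
  have h2 : (q + (k + 1) - 1) / q = 1 + k * q⁻¹ := by field_simp; ring
  rw [mul_div_assoc, h2, h1, mul_pow, mul_pow (q - 1), mul_pow ((q - 1) ^ k), pow_succ (1 + k * q⁻¹), ← inv_pow,
    ← pow_mul, ← pow_mul, ← pow_mul, mul_comm N k]
  ring

theorem mainSize_pos (d : RIdx r → ℕ) : 0 < mainSize F d := by
  have hq : (1 : ℝ) < Fintype.card F := by exact_mod_cast Fintype.one_lt_card (α := F)
  have h1 : (0 : ℝ) < (Fintype.card F : ℝ) - 1 := by linarith
  have h2 : (0 : ℝ) < (Fintype.card F : ℝ) + groupOrder r - 1 := by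
    have : (0 : ℝ) ≤ groupOrder r := Nat.cast_nonneg _
    linarith
  have h3 := LConst_pos F (groupOrder r - 2)
  have h4 := zetaF_pos F
  rw [mainSize]
  positivity

end Densities

/-! ### From additive to relative errors. -/

section Comparison

/-- Approximations of a count and of a total by `M Δ` and `M`, with an error relative to `M`, give
an approximation of the proportion by `Δ` with a relative error, when `Δ` is bounded below. -/
theorem relative_error_bounds {N T M Δ δ η : ℝ} (hδ : 0 < δ) (hΔ : δ ≤ Δ) (hM : 0 < M)
    (hη : 0 ≤ η) (h1 : |N - M * Δ| ≤ η * M) (h2 : |T - M| ≤ η * M) (hN : 0 ≤ N) (hNT : N ≤ T) :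
    |N - M * Δ| ≤ 2 * (1 / δ + 1) * η * (M * Δ) ∧ |N / T - Δ| ≤ 2 * (1 / δ + 1) * η * Δ := by
  have hΔ0 : 0 < Δ := hδ.trans_le hΔ
  have h3 : 1 ≤ 1 / δ * Δ := by rw [one_div, inv_mul_eq_div, one_le_div hδ]; exact hΔ
  have hA : 1 + Δ ≤ (1 / δ + 1) * Δ := by linarith
  have h4 : η * M * (1 + Δ) ≤ (1 / δ + 1) * η * (M * Δ) := by
    calc η * M * (1 + Δ) ≤ η * M * ((1 / δ + 1) * Δ) := by gcongr
      _ = _ := by ring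
  constructor
  · have h5 : η * M ≤ η * M * (1 + Δ) := le_mul_of_one_le_right (by positivity) (by linarith)
    have h6 : 0 ≤ (1 / δ + 1) * η * (M * Δ) := by positivity
    linarith
  · by_cases hs : η ≤ 1 / 2
    · have h5 : M / 2 ≤ T := by
        have := (abs_le.1 h2).1
        nlinarith
      have hT : 0 < T := by linarith
      have h6 : N / T - Δ = (N - T * Δ) / T := by field_simp
      rw [h6, abs_div, abs_of_pos hT, div_le_iff₀ hT]
      have h7 : |N - T * Δ| ≤ η * M * (1 + Δ) := by
        calc |N - T * Δ| = |(N - M * Δ) - (T - M) * Δ| := by ring_nf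
          _ ≤ |N - M * Δ| + |(T - M) * Δ| := abs_sub _ _
          _ ≤ η * M + η * M * Δ := by
              rw [abs_mul, abs_of_pos hΔ0]
              gcongr
          _ = _ := by ring
      calc |N - T * Δ| ≤ (1 / δ + 1) * η * (M * Δ) := h7.trans h4
        _ = 2 * (1 / δ + 1) * η * Δ * (M / 2) := by ring
        _ ≤ _ := by gcongr
    -- If `η > 1/2`, the claimed bound exceeds `1 + Δ` and holds because the proportion lies in `[0,
    -- 1]`.
    · push Not at hs
      have h5 : 0 ≤ N / T := div_nonneg hN (hN.trans hNT)
      have h6 : N / T ≤ 1 := div_le_one_of_le₀ hNT (hN.trans hNT)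
      have h7 : |N / T - Δ| ≤ 1 + Δ := abs_le.2 ⟨by linarith, by linarith⟩
      have h8 : (1 / δ + 1) * Δ ≤ 2 * (1 / δ + 1) * η * Δ := by
        calc (1 / δ + 1) * Δ = 2 * (1 / δ + 1) * (1 / 2) * Δ := by ring
          _ ≤ _ := by gcongr
      linarith

theorem inv_sqrt_pow_eq_rpow {q : ℝ} (hq : 0 ≤ q) (m : ℕ) :
    (√q)⁻¹ ^ m = q ^ (-(m : ℝ) / 2) := by
  rw [Real.sqrt_eq_rpow, ← Real.rpow_neg hq, ← Real.rpow_natCast, ← Real.rpow_mul hq]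
  congr 1
  ring

end Comparison

end AbelianCovers
namespace AbelianCovers

/-! ### The uniform estimate and the conclusion. -/

section MainEstimate

variable (F : Type*) [Field F] [Fintype F] {n : ℕ} (r : Fin n → ℕ) [∀ j, NeZero (r j)]

/-- There are finitely many local data, and their number depends only on `F` and `r`; summing the
fibre estimates therefore keeps the error uniform in `d` and in the conditions. -/
theorem exists_abs_ncard_assemble_sub_le (hq : ∀ j, Fintype.card F ≡ 1 [MOD r j]) :
    ∃ C : ℝ, 0 ≤ C ∧ ∀ (d : RIdx r → ℕ) (T : Option F → Finset (RPrime r))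
      (H : RPrime r → AddSubgroup (RPrime r)) (t : Option F → RPrime r),
      |((assemble '' {z : LocalData F r × RootlessTuple F r |
          z.1 ∈ localCondition T H t ∧ z.2 ∈ fiber d z.1}).ncard : ℝ) -
        mainSize F d * ∏ y, (∑ γ ∈ T y, (Nat.card (H γ) : ℝ) / groupOrder r *
          (if γ = 0 then 1 else (Fintype.card F : ℝ)⁻¹)) *
            ((Fintype.card F : ℝ) / (Fintype.card F + Fintype.card (RIdx r)))| ≤
      C * (√(Fintype.card F : ℝ))⁻¹ ^ (⨅ α, d α) * mainSize F d := by
  classical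
  obtain ⟨Λ, hΛ, C, hC, hest⟩ := exists_abs_ncard_fiber_sub_le F r
  set q : ℝ := (Fintype.card F : ℝ) with hqdef
  set k := Fintype.card (RIdx r)
  have hq0 : 0 < q := by
    rw [hqdef]
    exact_mod_cast Fintype.card_pos (α := F)
  have hqk : 0 < q + k := by positivity
  set A : ℝ := (q ^ Fintype.card F)⁻¹ ^ k * Λ
  set W : ℝ := unitChoices F r * (1 + k * q⁻¹) ^ (Fintype.card F + 1)
  have hM : ∀ d : RIdx r → ℕ, mainSize F d = A * q ^ (∑ α, d α) * W := fun d => mainSize_eq hΛ d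
  have hAW : 0 < A * W := by
    have := mainSize_pos (F := F) (r := r) 0
    rw [hM] at this
    simpa using this
  set L : ℝ := (Fintype.card (LocalData F r) : ℝ)
  refine ⟨L * C / (A * W), by positivity, fun d T H t => ?_⟩
  rw [ncard_assemble_image]
  set E := (√q)⁻¹ ^ (⨅ α, d α)
  set S := q ^ (∑ α, d α)
  have hmain : mainSize F d * ∏ y, (∑ γ ∈ T y, (Nat.card (H γ) : ℝ) / groupOrder r *
      (if γ = 0 then 1 else q⁻¹)) * (q / (q + k)) =
      A * S * ∑ ω ∈ localCondition T H t, ramWeight ω.2.1 := by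
    rw [sum_ramWeight hq, hM, Finset.prod_mul_distrib, Finset.prod_const, Finset.card_univ,
      Fintype.card_option]
    -- At each point `q / (q + k)` undoes the unrestricted local weight contained in the main term.
    have h1 : (1 + k * q⁻¹) * (q / (q + k)) = 1 := by
      field_simp
    calc _ = A * S * (unitChoices F r * (∏ y, ∑ γ ∈ T y, (Nat.card (H γ) : ℝ) / groupOrder r *
          (if γ = 0 then 1 else q⁻¹)) *
          ((1 + k * q⁻¹) * (q / (q + k))) ^ (Fintype.card F + 1)) := by
            rw [mul_pow (1 + k * q⁻¹)]
            simp only [W]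
            ring
      _ = _ := by rw [h1, one_pow, mul_one]
  rw [hmain, Finset.mul_sum, Nat.cast_sum, ← Finset.sum_sub_distrib]
  calc _ ≤ ∑ ω ∈ localCondition T H t,
        |((fiber d ω).ncard : ℝ) - A * S * ramWeight ω.2.1| := Finset.abs_sum_le_sum_abs _ _
    _ ≤ ∑ _ω ∈ localCondition T H t, C * S * E := Finset.sum_le_sum fun ω _ => hest d ω
    _ = (localCondition T H t).card * (C * S * E) := by rw [Finset.sum_const, nsmul_eq_mul]
    _ ≤ L * (C * S * E) := by
        have : ((localCondition T H t).card : ℝ) ≤ L := by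
          simp only [L]
          exact_mod_cast Finset.card_le_univ _
        gcongr
    _ = _ := by
        rw [hM, mul_right_comm A, mul_right_comm (L * C / (A * W)), ← mul_assoc (L * C / (A * W)),
          div_mul_cancel₀ _ hAW.ne']
        ring

end MainEstimate

end AbelianCovers

theorem proposition5p4 {F : Type*} [Field F] [Fintype F] {n : ℕ} (r : Fin n → ℕ)
    [∀ j, NeZero (r j)] (hr : ∀ i j, i ≤ j → r i ∣ r j)
    (hq : ∀ j, Fintype.card F ≡ 1 [MOD r j]) :
    ∃ K : ℝ, ∀ χ : ℕ → MulChar F ℂ, (∀ m, m ∣ Finset.univ.lcm r → orderOf (χ m) = m) →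
      ∀ d : AbelianCovers.RIdx r → ℕ,
        (∀ j, r j ∣ ∑ α : AbelianCovers.RIdx r, (α.1 j : ℕ) * d α) →
        ∀ ε : OnePoint F → AbelianCovers.SOmega r → ℂ,
          (∀ x, AbelianCovers.IsAdmissible χ d (ε x)) →
          |((AbelianCovers.attaining χ d ε).ncard : ℝ) -
              AbelianCovers.mainSize F d * AbelianCovers.density χ d ε| ≤
            K * (Fintype.card F : ℝ) ^ (-((⨅ α, d α : ℕ) : ℝ) / 2) *
              (AbelianCovers.mainSize F d * AbelianCovers.density χ d ε) ∧
          |((AbelianCovers.attaining χ d ε).ncard : ℝ) /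
                ((AbelianCovers.fullFamily F d).ncard : ℝ) - AbelianCovers.density χ d ε| ≤
            K * (Fintype.card F : ℝ) ^ (-((⨅ α, d α : ℕ) : ℝ) / 2) *
              AbelianCovers.density χ d ε := by
  obtain ⟨C, hC, hest⟩ := AbelianCovers.exists_abs_ncard_assemble_sub_le F r hq
  refine ⟨2 * (1 / AbelianCovers.densityFloor F r + 1) * C, fun χ hχ d hd ε hε => ?_⟩
  choose β u hβ using fun x => (hε x).exists_stateValue hχ hd
  have hden := AbelianCovers.density_eq (β := β) (u := u) hε hβ
  have hN := hest d (fun y => AbelianCovers.sameClass (β y)) AddSubgroup.zmultiples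
    (fun y => AbelianCovers.logVec r (u y))
  rw [← AbelianCovers.attaining_eq hχ hd hβ] at hN
  simp only [AbelianCovers.sum_sameClass] at hN
  rw [← hden] at hN
  -- The same estimate without restrictions counts the whole family, with normalized local factors
  -- equal to `1`.
  have hT := hest d (fun _ => Finset.univ) (fun _ => ⊤) 0
  rw [← AbelianCovers.fullFamily_eq] at hT
  have hone : (1 + Fintype.card (AbelianCovers.RIdx r) * (Fintype.card F : ℝ)⁻¹) *
      ((Fintype.card F : ℝ) / (Fintype.card F + Fintype.card (AbelianCovers.RIdx r))) = 1 := by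
    have := Fintype.card_pos (α := F)
    field_simp
  simp only [AbelianCovers.sum_univ_weight, hone, Finset.prod_const_one, mul_one] at hT
  have hfin : (AbelianCovers.fullFamily F d).Finite := by
    rw [AbelianCovers.fullFamily_eq]
    refine (Set.Finite.subset (Set.Finite.prod Set.finite_univ
      (Set.finite_iUnion fun ω => AbelianCovers.finite_fiber d ω)) fun z hz =>
        ⟨Set.mem_univ z.1, Set.mem_iUnion.2 ⟨z.1, hz.2⟩⟩).image _
  have hle : ((AbelianCovers.attaining χ d ε).ncard : ℝ) ≤
      ((AbelianCovers.fullFamily F d).ncard : ℝ) := by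
    exact_mod_cast Set.ncard_le_ncard (Set.sep_subset _ _) hfin
  have h := AbelianCovers.relative_error_bounds (AbelianCovers.densityFloor_pos F r)
    (hden ▸ AbelianCovers.densityFloor_le β) (AbelianCovers.mainSize_pos d)
    (by positivity) hN hT (Nat.cast_nonneg _) hle
  rw [AbelianCovers.inv_sqrt_pow_eq_rpow (Nat.cast_nonneg _)] at h
  simpa only [mul_assoc] using h
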